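/- **Lie groups.** Let $G$ be a Lie group and let $H$ be an abelian Lie group, written additively (finite-dimensional, without boundary, Hausdorff, second countable), with a smooth action of $G$ on $H$ by automorphisms. An $H$-valued $4$-cochain on $G$ is a smooth map $\pi : G^4 \to H$. It is *normalized* if $\pi(g_1,g_2,g_3,g_4)=0$ whenever some $g_i=1$, and it is a *cocycle* if $d\pi=0$, where $$d\pi(g_1,\dots,g_5)=g_1\pi(g_2,\dots,g_5)+\sum_{i=1}^{4}(-1)^i\pi(g_1,\dots,g_ig_{i+1},\dots,g_5)-\pi(g_1,\dots,g_4).$$ For such $\pi$ let $\mathrm{Brane}_\pi(G,H)$ be the following data for a tricategory internal to smooth manifolds: * the manifold of objects is a point; the manifold of morphisms is $G$, and composition at a $0$-cell is the multiplication of $G$; * the manifold of $2$-morphisms is again $G$ (all $2$-morphisms are identities); * the manifold of $3$-morphisms is $G\times H$; the source and target of $(g,h)$ are both the identity $2$-morphism of $g$; composition at a $1$-cell and at a $2$-cell is addition in $H$, and composition at a $0$-cell is the multiplication of $G\ltimes H$, that is, $(g,h)(g',h')=(gg',\,h+gh')$; * the pentagonator at $(g_1,g_2,g_3,g_4)$ is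 the $3$-morphism $(g_1g_2g_3g_4,\pi(g_1,g_2,g_3,g_4))$; associator, unitors, triangulators and all other constraints are trivial. Then: 1. For every $4$-cochain $\pi$, the data $\mathrm{Brane}_\pi(G,H)$ satisfy the pentagonator identity (equality of the two halves of the surface of the three-dimensional associahedron, for every composable quintet of morphisms) if and only if $\pi$ is a cocycle. 2. If $\pi$ is a normalized cocycle, then $\mathrm{Brane}_\pi(G,H)$ is a Lie $3$-group: a tricategory internal to smooth manifolds (all operations smooth, all axioms of a tricategory satisfied) with one object, all of whose morphisms, $2$-morphisms and $3$-morphisms are weakly invertible. **Supergroups.** The same two assertions hold internally to supermanifolds. Here a supermanifold is a functor $A\mapsto M_A$ from finite-dimensional real Grassmann algebras and homomorphisms of superalgebras to smooth manifolds, equipped with an atlas of superdomains in a finite-dimensional super vector space whose transition functions have $A_0$-linear derivatives; a smooth map of supermanifolds is a natural transformation whose components are smooth with $A_0$-linear derivatives; a supergroup is a group object in supermanifolds. Let $G$ be a supergroup, let $H$ be an abelian supergroup, and let $\alpha: G\times H\to H$ be a smooth map which on $A$-points is an action of the group $G_A$ on the abelian group $H_A$ by automorphisms, for every $A$. Let $\pi:G^4\to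 H$ be a smooth map; it is normalized, respectively a cocycle, if $\pi_A$ is so for every $A$. Then the data $\mathrm{Brane}_\pi(G,H)$, formed as above in supermanifolds with the one-point supermanifold of objects, satisfy the pentagonator identity if and only if $\pi$ is a cocycle; and if $\pi$ is a normalized cocycle, then $\mathrm{Brane}_\pi(G,H)$ is a $3$-supergroup: a tricategory internal to supermanifolds with one object, all of whose morphisms, $2$-morphisms and $3$-morphisms are weakly invertible. -/

import Mathlib

open CategoryTheory Limits MonoidalCategory CartesianMonoidalCategory
open scoped Manifold ContDiff

universe u

/-! ## Bicategories, pseudofunctors, transformations and modifications: data and axioms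

Throughout, composites are written in diagrammatic order.  Data and axioms are kept
apart, so that a single axiom can be discussed for given data. -/

/-- The cells of a bicategory: objects, morphisms and 2-morphisms. -/
structure Cells where
  Ob : Type u
  Hom : Ob → Ob → Type u
  Hom₂ : ∀ {x y : Ob}, Hom x y → Hom x y → Type u

/-- Pairs of cells. -/
@[reducible] def Cells.prod (B C : Cells.{u}) : Cells.{u} where
  Ob := B.Ob × C.Ob
  Hom p q := B.Hom p.1 q.1 × C.Hom p.2 q.2
  Hom₂ f g := B.Hom₂ f.1 g.1 × C.Hom₂ f.2 g.2

/-- The operations of a bicategory: identities, composition of morphisms, vertical (`vcomp`)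
and horizontal (`hcomp`) composition of 2-morphisms, associator and unitors with their inverses. -/
structure BicatData (C : Cells.{u}) where
  id : ∀ x, C.Hom x x
  comp : ∀ {x y z}, C.Hom x y → C.Hom y z → C.Hom x z
  id₂ : ∀ {x y} (f : C.Hom x y), C.Hom₂ f f
  vcomp : ∀ {x y} {f g h : C.Hom x y}, C.Hom₂ f g → C.Hom₂ g h → C.Hom₂ f h
  hcomp : ∀ {x y z} {f f' : C.Hom x y} {g g' : C.Hom y z},
    C.Hom₂ f f' → C.Hom₂ g g' → C.Hom₂ (comp f g) (comp f' g')
  assoc : ∀ {x y z w} (f : C.Hom x y) (g : C.Hom y z) (h : C.Hom z w),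
    C.Hom₂ (comp (comp f g) h) (comp f (comp g h))
  assocInv : ∀ {x y z w} (f : C.Hom x y) (g : C.Hom y z) (h : C.Hom z w),
    C.Hom₂ (comp f (comp g h)) (comp (comp f g) h)
  lun : ∀ {x y} (f : C.Hom x y), C.Hom₂ (comp (id x) f) f
  lunInv : ∀ {x y} (f : C.Hom x y), C.Hom₂ f (comp (id x) f)
  run : ∀ {x y} (f : C.Hom x y), C.Hom₂ (comp f (id y)) f
  runInv : ∀ {x y} (f : C.Hom x y), C.Hom₂ f (comp f (id y))

namespace BicatData

variable {C : Cells.{u}} (B : BicatData C)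

/-- Whiskering on the left. -/
def wl {x y z} (f : C.Hom x y) {g g' : C.Hom y z} (Γ : C.Hom₂ g g') :
    C.Hom₂ (B.comp f g) (B.comp f g') := B.hcomp (B.id₂ f) Γ

/-- Whiskering on the right. -/
def wr {x y z} {f f' : C.Hom x y} (Γ : C.Hom₂ f f') (g : C.Hom y z) :
    C.Hom₂ (B.comp f g) (B.comp f' g) := B.hcomp Γ (B.id₂ g)

/-- Two 2-morphisms are mutually inverse. -/
def Inverse {x y} {f g : C.Hom x y} (Γ : C.Hom₂ f g) (Δ : C.Hom₂ g f) : Prop :=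
  B.vcomp Γ Δ = B.id₂ f ∧ B.vcomp Δ Γ = B.id₂ g

/-- The axioms of a bicategory. -/
structure IsBicategory : Prop where
  vcomp_assoc : ∀ {x y} {f g h k : C.Hom x y}
    (Γ : C.Hom₂ f g) (Δ : C.Hom₂ g h) (Θ : C.Hom₂ h k),
    B.vcomp (B.vcomp Γ Δ) Θ = B.vcomp Γ (B.vcomp Δ Θ)
  id_vcomp : ∀ {x y} {f g : C.Hom x y} (Γ : C.Hom₂ f g), B.vcomp (B.id₂ f) Γ = Γ
  vcomp_id : ∀ {x y} {f g : C.Hom x y} (Γ : C.Hom₂ f g), B.vcomp Γ (B.id₂ g) = Γ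
  hcomp_id : ∀ {x y z} (f : C.Hom x y) (g : C.Hom y z),
    B.hcomp (B.id₂ f) (B.id₂ g) = B.id₂ (B.comp f g)
  hcomp_vcomp : ∀ {x y z} {f f' f'' : C.Hom x y} {g g' g'' : C.Hom y z}
    (Γ : C.Hom₂ f f') (Γ' : C.Hom₂ f' f'') (Δ : C.Hom₂ g g') (Δ' : C.Hom₂ g' g''),
    B.hcomp (B.vcomp Γ Γ') (B.vcomp Δ Δ') = B.vcomp (B.hcomp Γ Δ) (B.hcomp Γ' Δ')
  assoc_natural : ∀ {x y z w} {f f' : C.Hom x y} {g g' : C.Hom y z} {h h' : C.Hom z w}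
    (Γ : C.Hom₂ f f') (Δ : C.Hom₂ g g') (Θ : C.Hom₂ h h'),
    B.vcomp (B.hcomp (B.hcomp Γ Δ) Θ) (B.assoc f' g' h') =
      B.vcomp (B.assoc f g h) (B.hcomp Γ (B.hcomp Δ Θ))
  lun_natural : ∀ {x y} {f g : C.Hom x y} (Γ : C.Hom₂ f g),
    B.vcomp (B.wl (B.id x) Γ) (B.lun g) = B.vcomp (B.lun f) Γ
  run_natural : ∀ {x y} {f g : C.Hom x y} (Γ : C.Hom₂ f g),
    B.vcomp (B.wr Γ (B.id y)) (B.run g) = B.vcomp (B.run f) Γ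
  assoc_inverse : ∀ {x y z w} (f : C.Hom x y) (g : C.Hom y z) (h : C.Hom z w),
    B.Inverse (B.assoc f g h) (B.assocInv f g h)
  lun_inverse : ∀ {x y} (f : C.Hom x y), B.Inverse (B.lun f) (B.lunInv f)
  run_inverse : ∀ {x y} (f : C.Hom x y), B.Inverse (B.run f) (B.runInv f)
  pentagon : ∀ {x y z w v} (f : C.Hom x y) (g : C.Hom y z) (h : C.Hom z w) (k : C.Hom w v),
    B.vcomp (B.wr (B.assoc f g h) k)
        (B.vcomp (B.assoc f (B.comp g h) k) (B.wl f (B.assoc g h k))) =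
      B.vcomp (B.assoc (B.comp f g) h k) (B.assoc f g (B.comp h k))
  triangle : ∀ {x y z} (f : C.Hom x y) (g : C.Hom y z),
    B.vcomp (B.assoc f (B.id y) g) (B.wl f (B.lun g)) = B.wr (B.run f) g

/-- The product of two bicategories. -/
@[reducible] def prod {D : Cells.{u}} (B : BicatData C) (B' : BicatData D) :
    BicatData (C.prod D) where
  id x := (B.id x.1, B'.id x.2)
  comp f g := (B.comp f.1 g.1, B'.comp f.2 g.2)
  id₂ f := (B.id₂ f.1, B'.id₂ f.2)
  vcomp Γ Δ := (B.vcomp Γ.1 Δ.1, B'.vcomp Γ.2 Δ.2)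
  hcomp Γ Δ := (B.hcomp Γ.1 Δ.1, B'.hcomp Γ.2 Δ.2)
  assoc f g h := (B.assoc f.1 g.1 h.1, B'.assoc f.2 g.2 h.2)
  assocInv f g h := (B.assocInv f.1 g.1 h.1, B'.assocInv f.2 g.2 h.2)
  lun f := (B.lun f.1, B'.lun f.2)
  lunInv f := (B.lunInv f.1, B'.lunInv f.2)
  run f := (B.run f.1, B'.run f.2)
  runInv f := (B.runInv f.1, B'.runInv f.2)

/-! ### Squares

A square with left side `θ`, right side `φ`, top `u` and bottom `v` is filled by a 2-morphism
`u ∘ φ ⇒ θ ∘ v`. -/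

/-- Juxtaposition of two squares along a common `v`. -/
def sqComp {x x' y y' z z'} {u : C.Hom x x'} {v : C.Hom y y'} {w : C.Hom z z'}
    {θ : C.Hom x y} {φ : C.Hom x' y'} {θ' : C.Hom y z} {φ' : C.Hom y' z'}
    (Γ : C.Hom₂ (B.comp u φ) (B.comp θ v)) (Δ : C.Hom₂ (B.comp v φ') (B.comp θ' w)) :
    C.Hom₂ (B.comp u (B.comp φ φ')) (B.comp (B.comp θ θ') w) :=
  B.vcomp (B.assocInv u φ φ') <| B.vcomp (B.wr Γ φ') <| B.vcomp (B.assoc θ v φ') <|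
    B.vcomp (B.wl θ Δ) (B.assocInv θ θ' w)

/-- The inverse of `sqComp Γ Δ`, given the inverses of `Γ` and `Δ`. -/
def sqCompInv {x x' y y' z z'} {u : C.Hom x x'} {v : C.Hom y y'} {w : C.Hom z z'}
    {θ : C.Hom x y} {φ : C.Hom x' y'} {θ' : C.Hom y z} {φ' : C.Hom y' z'}
    (Γ : C.Hom₂ (B.comp θ v) (B.comp u φ)) (Δ : C.Hom₂ (B.comp θ' w) (B.comp v φ')) :
    C.Hom₂ (B.comp (B.comp θ θ') w) (B.comp u (B.comp φ φ')) :=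
  B.vcomp (B.assoc θ θ' w) <| B.vcomp (B.wl θ Δ) <| B.vcomp (B.assocInv θ v φ') <|
    B.vcomp (B.wr Γ φ') (B.assoc u φ φ')

end BicatData

/-- A map on objects and morphisms between two bicategories. -/
structure MapData (B C : Cells.{u}) where
  obj : B.Ob → C.Ob
  map : ∀ {x y}, B.Hom x y → C.Hom (obj x) (obj y)

/-- The identity map. -/
@[reducible] def MapData.id (B : Cells.{u}) : MapData B B where
  obj x := x
  map f := f

/-- The composite of two maps. -/
@[reducible] def MapData.comp {B C D : Cells.{u}} (F : MapData B C) (G : MapData C D) :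
    MapData B D where
  obj x := G.obj (F.obj x)
  map f := G.map (F.map f)

/-- The first projection. -/
@[reducible] def MapData.fst (B C : Cells.{u}) : MapData (B.prod C) B where
  obj x := x.1
  map f := f.1

/-- The second projection. -/
@[reducible] def MapData.snd (B C : Cells.{u}) : MapData (B.prod C) C where
  obj x := x.2
  map f := f.2

/-- The pairing of two maps. -/
@[reducible] def MapData.pair {B C D : Cells.{u}} (F : MapData B C) (G : MapData B D) :
    MapData B (C.prod D) where
  obj x := (F.obj x, G.obj x)
  map f := (F.map f, G.map f)

/-- The data of a pseudofunctor. -/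
structure PseudoData {C D : Cells.{u}} (B : BicatData C) (B' : BicatData D)
    extends MapData C D where
  map₂ : ∀ {x y} {f g : C.Hom x y}, C.Hom₂ f g → D.Hom₂ (map f) (map g)
  mapComp : ∀ {x y z} (f : C.Hom x y) (g : C.Hom y z),
    D.Hom₂ (B'.comp (map f) (map g)) (map (B.comp f g))
  mapCompInv : ∀ {x y z} (f : C.Hom x y) (g : C.Hom y z),
    D.Hom₂ (map (B.comp f g)) (B'.comp (map f) (map g))
  mapId : ∀ x, D.Hom₂ (B'.id (obj x)) (map (B.id x))
  mapIdInv : ∀ x, D.Hom₂ (map (B.id x)) (B'.id (obj x))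

namespace PseudoData

variable {C D E : Cells.{u}} {B : BicatData C} {B' : BicatData D} {B'' : BicatData E}

/-- The axioms of a pseudofunctor. -/
structure IsPseudofunctor (F : PseudoData B B') : Prop where
  map₂_id : ∀ {x y} (f : C.Hom x y), F.map₂ (B.id₂ f) = B'.id₂ (F.map f)
  map₂_vcomp : ∀ {x y} {f g h : C.Hom x y} (Γ : C.Hom₂ f g) (Δ : C.Hom₂ g h),
    F.map₂ (B.vcomp Γ Δ) = B'.vcomp (F.map₂ Γ) (F.map₂ Δ)
  mapComp_natural : ∀ {x y z} {f f' : C.Hom x y} {g g' : C.Hom y z}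
    (Γ : C.Hom₂ f f') (Δ : C.Hom₂ g g'),
    B'.vcomp (B'.hcomp (F.map₂ Γ) (F.map₂ Δ)) (F.mapComp f' g') =
      B'.vcomp (F.mapComp f g) (F.map₂ (B.hcomp Γ Δ))
  mapComp_inverse : ∀ {x y z} (f : C.Hom x y) (g : C.Hom y z),
    B'.Inverse (F.mapComp f g) (F.mapCompInv f g)
  mapId_inverse : ∀ x, B'.Inverse (F.mapId x) (F.mapIdInv x)
  map₂_assoc : ∀ {x y z w} (f : C.Hom x y) (g : C.Hom y z) (h : C.Hom z w),
    B'.vcomp (B'.wr (F.mapComp f g) (F.map h))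
        (B'.vcomp (F.mapComp (B.comp f g) h) (F.map₂ (B.assoc f g h))) =
      B'.vcomp (B'.assoc (F.map f) (F.map g) (F.map h))
        (B'.vcomp (B'.wl (F.map f) (F.mapComp g h)) (F.mapComp f (B.comp g h)))
  map₂_lun : ∀ {x y} (f : C.Hom x y),
    B'.vcomp (B'.wr (F.mapId x) (F.map f))
        (B'.vcomp (F.mapComp (B.id x) f) (F.map₂ (B.lun f))) = B'.lun (F.map f)
  map₂_run : ∀ {x y} (f : C.Hom x y),
    B'.vcomp (B'.wl (F.map f) (F.mapId y))
        (B'.vcomp (F.mapComp f (B.id y)) (F.map₂ (B.run f))) = B'.run (F.map f)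

/-- The identity pseudofunctor. -/
def id (B : BicatData C) : PseudoData B B where
  toMapData := MapData.id C
  map₂ Γ := Γ
  mapComp f g := B.id₂ (B.comp f g)
  mapCompInv f g := B.id₂ (B.comp f g)
  mapId x := B.id₂ (B.id x)
  mapIdInv x := B.id₂ (B.id x)

/-- The composite of two pseudofunctors. -/
def comp (F : PseudoData B B') (G : PseudoData B' B'') : PseudoData B B'' where
  toMapData := F.toMapData.comp G.toMapData
  map₂ Γ := G.map₂ (F.map₂ Γ)
  mapComp f g := B''.vcomp (G.mapComp (F.map f) (F.map g)) (G.map₂ (F.mapComp f g))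
  mapCompInv f g := B''.vcomp (G.map₂ (F.mapCompInv f g)) (G.mapCompInv (F.map f) (F.map g))
  mapId x := B''.vcomp (G.mapId (F.obj x)) (G.map₂ (F.mapId x))
  mapIdInv x := B''.vcomp (G.map₂ (F.mapIdInv x)) (G.mapIdInv (F.obj x))

/-- The first projection. -/
def fst (B : BicatData C) (B' : BicatData D) : PseudoData (B.prod B') B where
  toMapData := MapData.fst C D
  map₂ Γ := Γ.1
  mapComp f g := B.id₂ (B.comp f.1 g.1)
  mapCompInv f g := B.id₂ (B.comp f.1 g.1)
  mapId x := B.id₂ (B.id x.1)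
  mapIdInv x := B.id₂ (B.id x.1)

/-- The second projection. -/
def snd (B : BicatData C) (B' : BicatData D) : PseudoData (B.prod B') B' where
  toMapData := MapData.snd C D
  map₂ Γ := Γ.2
  mapComp f g := B'.id₂ (B'.comp f.2 g.2)
  mapCompInv f g := B'.id₂ (B'.comp f.2 g.2)
  mapId x := B'.id₂ (B'.id x.2)
  mapIdInv x := B'.id₂ (B'.id x.2)

/-- The pairing of two pseudofunctors. -/
def pair (F : PseudoData B B') (G : PseudoData B B'') : PseudoData B (B'.prod B'') where
  toMapData := F.toMapData.pair G.toMapData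
  map₂ Γ := (F.map₂ Γ, G.map₂ Γ)
  mapComp f g := (F.mapComp f g, G.mapComp f g)
  mapCompInv f g := (F.mapCompInv f g, G.mapCompInv f g)
  mapId x := (F.mapId x, G.mapId x)
  mapIdInv x := (F.mapIdInv x, G.mapIdInv x)

/-- The constant pseudofunctor at an object. -/
def const (B : BicatData C) (B' : BicatData D) (c : D.Ob) : PseudoData B B' where
  obj _ := c
  map _ := B'.id c
  map₂ _ := B'.id₂ (B'.id c)
  mapComp _ _ := B'.lun (B'.id c)
  mapCompInv _ _ := B'.lunInv (B'.id c)
  mapId _ := B'.id₂ (B'.id c)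
  mapIdInv _ := B'.id₂ (B'.id c)

end PseudoData

/-- The data of a pseudonatural transformation from `F` to `G`: for each object `x` a morphism
`app x : F x → G x`, and for each `f : x → y` a 2-isomorphism
`F f ∘ app y ⇒ app x ∘ G f`. -/
structure TransData {C D : Cells.{u}} (B' : BicatData D) (F G : MapData C D) where
  app : ∀ x, D.Hom (F.obj x) (G.obj x)
  nat : ∀ {x y} (f : C.Hom x y),
    D.Hom₂ (B'.comp (F.map f) (app y)) (B'.comp (app x) (G.map f))
  natInv : ∀ {x y} (f : C.Hom x y),
    D.Hom₂ (B'.comp (app x) (G.map f)) (B'.comp (F.map f) (app y))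

namespace TransData

variable {C C' D : Cells.{u}} {B : BicatData C} {B' : BicatData D}

/-- The axioms of a pseudonatural transformation. -/
structure IsPseudonatural {F G : PseudoData B B'} (θ : TransData B' F.toMapData G.toMapData) :
    Prop where
  nat_inverse : ∀ {x y} (f : C.Hom x y), B'.Inverse (θ.nat f) (θ.natInv f)
  natural : ∀ {x y} {f g : C.Hom x y} (Γ : C.Hom₂ f g),
    B'.vcomp (B'.wr (F.map₂ Γ) (θ.app y)) (θ.nat g) =
      B'.vcomp (θ.nat f) (B'.wl (θ.app x) (G.map₂ Γ))
  nat_comp : ∀ {x y z} (f : C.Hom x y) (g : C.Hom y z),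
    B'.vcomp (B'.wr (F.mapComp f g) (θ.app z)) (θ.nat (B.comp f g)) =
      B'.vcomp (B'.assoc (F.map f) (F.map g) (θ.app z)) (
      B'.vcomp (B'.wl (F.map f) (θ.nat g)) (
      B'.vcomp (B'.assocInv (F.map f) (θ.app y) (G.map g)) (
      B'.vcomp (B'.wr (θ.nat f) (G.map g)) (
      B'.vcomp (B'.assoc (θ.app x) (G.map f) (G.map g))
        (B'.wl (θ.app x) (G.mapComp f g))))))
  nat_id : ∀ x,
    B'.vcomp (B'.wr (F.mapId x) (θ.app x)) (θ.nat (B.id x)) =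
      B'.vcomp (B'.lun (θ.app x)) (
      B'.vcomp (B'.runInv (θ.app x)) (B'.wl (θ.app x) (G.mapId x)))

/-- The identity transformation. -/
def id (B' : BicatData D) (F : MapData C D) : TransData B' F F where
  app x := B'.id (F.obj x)
  nat f := B'.vcomp (B'.run (F.map f)) (B'.lunInv (F.map f))
  natInv f := B'.vcomp (B'.lun (F.map f)) (B'.runInv (F.map f))

/-- The composite of two transformations. -/
def comp {F G H : MapData C D} (θ : TransData B' F G) (φ : TransData B' G H) :
    TransData B' F H where
  app x := B'.comp (θ.app x) (φ.app x)
  nat f := B'.sqComp (θ.nat f) (φ.nat f)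
  natInv f := B'.sqCompInv (θ.natInv f) (φ.natInv f)

/-- The transformation obtained by restricting `θ` along a map. -/
def restrict (P : MapData C' C) {F G : MapData C D} (θ : TransData B' F G) :
    TransData B' (P.comp F) (P.comp G) where
  app x := θ.app (P.obj x)
  nat f := θ.nat (P.map f)
  natInv f := θ.natInv (P.map f)

/-- The modification equation for a family of 2-morphisms `Π x : θ x ⇒ φ x`. -/
def IsModification {F G : MapData C D} (θ φ : TransData B' F G)
    (m : ∀ x, D.Hom₂ (θ.app x) (φ.app x)) : Prop :=
  ∀ {x y} (f : C.Hom x y),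
    B'.vcomp (B'.wl (F.map f) (m y)) (φ.nat f) = B'.vcomp (θ.nat f) (B'.wr (m x) (G.map f))

/-- An invertible modification, given with its inverse. -/
def IsModIso {F G : MapData C D} (θ φ : TransData B' F G)
    (m : ∀ x, D.Hom₂ (θ.app x) (φ.app x)) (mInv : ∀ x, D.Hom₂ (φ.app x) (θ.app x)) : Prop :=
  (∀ x, B'.Inverse (m x) (mInv x)) ∧ IsModification θ φ m

end TransData

/-- The data of a pseudonatural adjoint equivalence between `F` and `G`. -/
structure AdjEquivData {C D : Cells.{u}} (B' : BicatData D) (F G : MapData C D) where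
  hom : TransData B' F G
  inv : TransData B' G F
  unit : ∀ x, D.Hom₂ (B'.id (F.obj x)) (B'.comp (hom.app x) (inv.app x))
  unitInv : ∀ x, D.Hom₂ (B'.comp (hom.app x) (inv.app x)) (B'.id (F.obj x))
  counit : ∀ x, D.Hom₂ (B'.comp (inv.app x) (hom.app x)) (B'.id (G.obj x))
  counitInv : ∀ x, D.Hom₂ (B'.id (G.obj x)) (B'.comp (inv.app x) (hom.app x))

/-- The axioms of a pseudonatural adjoint equivalence: both transformations are pseudonatural,
unit and counit are invertible modifications, and the two triangle identities hold. -/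
structure AdjEquivData.IsAdjEquiv {C D : Cells.{u}} {B : BicatData C} {B' : BicatData D}
    {F G : PseudoData B B'} (e : AdjEquivData B' F.toMapData G.toMapData) : Prop where
  hom : e.hom.IsPseudonatural (F := F) (G := G)
  inv : e.inv.IsPseudonatural (F := G) (G := F)
  unit : TransData.IsModIso (TransData.id B' F.toMapData) (e.hom.comp e.inv) e.unit e.unitInv
  counit : TransData.IsModIso (e.inv.comp e.hom) (TransData.id B' G.toMapData)
    e.counit e.counitInv
  triangle_hom : ∀ x,
    B'.vcomp (B'.lunInv (e.hom.app x)) (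
    B'.vcomp (B'.wr (e.unit x) (e.hom.app x)) (
    B'.vcomp (B'.assoc (e.hom.app x) (e.inv.app x) (e.hom.app x)) (
    B'.vcomp (B'.wl (e.hom.app x) (e.counit x)) (B'.run (e.hom.app x))))) =
      B'.id₂ (e.hom.app x)
  triangle_inv : ∀ x,
    B'.vcomp (B'.runInv (e.inv.app x)) (
    B'.vcomp (B'.wl (e.inv.app x) (e.unit x)) (
    B'.vcomp (B'.assocInv (e.inv.app x) (e.hom.app x) (e.inv.app x)) (
    B'.vcomp (B'.wr (e.counit x) (e.inv.app x)) (B'.lun (e.inv.app x))))) =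
      B'.id₂ (e.inv.app x)

/-! ## Tricategories -/

/-- A 3-globular set. -/
structure GlobularSet where
  (C₀ C₁ C₂ C₃ : Type u)
  (s₀ t₀ : C₁ → C₀)
  (s₁ t₁ : C₂ → C₁)
  (s₂ t₂ : C₃ → C₂)
  s₀_s₁ : ∀ α, s₀ (s₁ α) = s₀ (t₁ α)
  t₀_s₁ : ∀ α, t₀ (s₁ α) = t₀ (t₁ α)
  s₁_s₂ : ∀ Γ, s₁ (s₂ Γ) = s₁ (t₂ Γ)
  t₁_s₂ : ∀ Γ, t₁ (s₂ Γ) = t₁ (t₂ Γ)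

/-- The morphisms from `x` to `y`, the 2-morphisms between them, and the 3-morphisms between
these. -/
def GlobularSet.cells (S : GlobularSet.{u}) (x y : S.C₀) : Cells.{u} where
  Ob := {f : S.C₁ // S.s₀ f = x ∧ S.t₀ f = y}
  Hom f g := {α : S.C₂ // S.s₁ α = f.1 ∧ S.t₁ α = g.1}
  Hom₂ α β := {Γ : S.C₃ // S.s₂ Γ = α.1 ∧ S.t₂ Γ = β.1}

/-- The first part of the data of a tricategory: the operations of the bicategories of morphisms
(composition at a 1-cell and at a 2-cell), identity morphisms, and the pseudofunctors
"composition at a 0-cell". -/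
structure TricatBase (S : GlobularSet.{u}) where
  hom : ∀ x y, BicatData (S.cells x y)
  one : ∀ x, (S.cells x x).Ob
  tensor : ∀ x y z, PseudoData ((hom x y).prod (hom y z)) (hom x z)

namespace TricatBase

variable {S : GlobularSet.{u}} (T : TricatBase S)

/-- Composition at a 0-cell of morphisms. -/
def c₁ {x y z} (f : (S.cells x y).Ob) (g : (S.cells y z).Ob) : (S.cells x z).Ob :=
  (T.tensor x y z).obj (f, g)

/-- Composition at a 0-cell of 2-morphisms. -/
def c₂ {x y z} {f f' : (S.cells x y).Ob} {g g' : (S.cells y z).Ob}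
    (α : (S.cells x y).Hom f f') (β : (S.cells y z).Hom g g') :
    (S.cells x z).Hom (T.c₁ f g) (T.c₁ f' g') :=
  (T.tensor x y z).map (x := (f, g)) (y := (f', g')) (α, β)

/-- Composition at a 0-cell of 3-morphisms. -/
def c₃ {x y z} {f f' : (S.cells x y).Ob} {g g' : (S.cells y z).Ob}
    {α α' : (S.cells x y).Hom f f'} {β β' : (S.cells y z).Hom g g'}
    (Γ : (S.cells x y).Hom₂ α α') (Δ : (S.cells y z).Hom₂ β β') :
    (S.cells x z).Hom₂ (T.c₂ α β) (T.c₂ α' β') :=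
  (T.tensor x y z).map₂ (x := (f, g)) (y := (f', g')) (f := (α, β)) (g := (α', β')) (Γ, Δ)

/-- The constraint `(α · β) ∘ (α' · β') ⇛ (α ∘ α') · (β ∘ β')`. -/
def χ {x y z} {f f' f'' : (S.cells x y).Ob} {g g' g'' : (S.cells y z).Ob}
    (α : (S.cells x y).Hom f f') (α' : (S.cells x y).Hom f' f'')
    (β : (S.cells y z).Hom g g') (β' : (S.cells y z).Hom g' g'') :
    (S.cells x z).Hom₂ ((T.hom x z).comp (T.c₂ α β) (T.c₂ α' β'))
      (T.c₂ ((T.hom x y).comp α α') ((T.hom y z).comp β β')) :=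
  (T.tensor x y z).mapComp (x := (f, g)) (y := (f', g')) (z := (f'', g'')) (α, β) (α', β')

/-- The inverse of `χ`. -/
def χInv {x y z} {f f' f'' : (S.cells x y).Ob} {g g' g'' : (S.cells y z).Ob}
    (α : (S.cells x y).Hom f f') (α' : (S.cells x y).Hom f' f'')
    (β : (S.cells y z).Hom g g') (β' : (S.cells y z).Hom g' g'') :
    (S.cells x z).Hom₂ (T.c₂ ((T.hom x y).comp α α') ((T.hom y z).comp β β'))
      ((T.hom x z).comp (T.c₂ α β) (T.c₂ α' β')) :=
  (T.tensor x y z).mapCompInv (x := (f, g)) (y := (f', g')) (z := (f'', g'')) (α, β) (α', β')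

/-- The constraint `1_(f · g) ⇛ 1_f · 1_g`. -/
def i {x y z} (f : (S.cells x y).Ob) (g : (S.cells y z).Ob) :
    (S.cells x z).Hom₂ ((T.hom x z).id (T.c₁ f g)) (T.c₂ ((T.hom x y).id f) ((T.hom y z).id g)) :=
  (T.tensor x y z).mapId (f, g)

/-- The inverse of `i`. -/
def iInv {x y z} (f : (S.cells x y).Ob) (g : (S.cells y z).Ob) :
    (S.cells x z).Hom₂ (T.c₂ ((T.hom x y).id f) ((T.hom y z).id g)) ((T.hom x z).id (T.c₁ f g)) :=
  (T.tensor x y z).mapIdInv (f, g)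

/-- Composition at a 0-cell of two pseudofunctors with values in bicategories of morphisms. -/
def ten {C : Cells.{u}} {B : BicatData C} {x y z} (P : PseudoData B (T.hom x y))
    (Q : PseudoData B (T.hom y z)) : PseudoData B (T.hom x z) :=
  (P.pair Q).comp (T.tensor x y z)

/-- The constant pseudofunctor at the identity morphism of `x`. -/
def unit {C : Cells.{u}} (B : BicatData C) (x : S.C₀) : PseudoData B (T.hom x x) :=
  PseudoData.const B (T.hom x x) (T.one x)

/-- Composition at a 0-cell of two maps with values in bicategories of morphisms. -/
@[reducible] def tenMap {C : Cells.{u}} {x y z} (P : MapData C (S.cells x y))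
    (Q : MapData C (S.cells y z)) : MapData C (S.cells x z) where
  obj b := T.c₁ (P.obj b) (Q.obj b)
  map u := T.c₂ (P.map u) (Q.map u)

/-- The constant map at the identity morphism of `x`. -/
@[reducible] def unitMap (C : Cells.{u}) (x : S.C₀) : MapData C (S.cells x x) where
  obj _ := T.one x
  map _ := (T.hom x x).id (T.one x)

/-- Composition at a 0-cell of two transformations. -/
def tenTrans {C : Cells.{u}} {x y z} {P P' : MapData C (S.cells x y)}
    {Q Q' : MapData C (S.cells y z)} (θ : TransData (T.hom x y) P P')
    (φ : TransData (T.hom y z) Q Q') :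
    TransData (T.hom x z) (T.tenMap P Q) (T.tenMap P' Q') where
  app b := T.c₂ (θ.app b) (φ.app b)
  nat {b c} u := (T.hom x z).vcomp (T.χ (P.map u) (θ.app c) (Q.map u) (φ.app c)) <|
    (T.hom x z).vcomp (T.c₃ (θ.nat u) (φ.nat u))
      (T.χInv (θ.app b) (P'.map u) (φ.app b) (Q'.map u))
  natInv {b c} u := (T.hom x z).vcomp (T.χ (θ.app b) (P'.map u) (φ.app b) (Q'.map u)) <|
    (T.hom x z).vcomp (T.c₃ (θ.natInv u) (φ.natInv u))
      (T.χInv (P.map u) (θ.app c) (Q.map u) (φ.app c))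

/-- The pseudofunctor `(f, g, h) ↦ (f · g) · h`. -/
def left₃ (x y z w : S.C₀) :
    PseudoData (((T.hom x y).prod (T.hom y z)).prod (T.hom z w)) (T.hom x w) :=
  T.ten (T.ten ((PseudoData.fst _ _).comp (PseudoData.fst _ _))
    ((PseudoData.fst _ _).comp (PseudoData.snd _ _))) (PseudoData.snd _ _)

/-- The pseudofunctor `(f, g, h) ↦ f · (g · h)`. -/
def right₃ (x y z w : S.C₀) :
    PseudoData (((T.hom x y).prod (T.hom y z)).prod (T.hom z w)) (T.hom x w) :=
  T.ten ((PseudoData.fst _ _).comp (PseudoData.fst _ _))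
    (T.ten ((PseudoData.fst _ _).comp (PseudoData.snd _ _)) (PseudoData.snd _ _))

/-- The pseudofunctor `f ↦ 1 · f`. -/
def oneLeft (x y : S.C₀) : PseudoData (T.hom x y) (T.hom x y) :=
  T.ten (T.unit _ x) (PseudoData.id _)

/-- The pseudofunctor `f ↦ f · 1`. -/
def oneRight (x y : S.C₀) : PseudoData (T.hom x y) (T.hom x y) :=
  T.ten (PseudoData.id _) (T.unit _ y)

end TricatBase

/-- The second part of the data of a tricategory: associator `a` and unitors `l`, `r`. -/
structure TricatConstraints (S : GlobularSet.{u}) extends TricatBase S where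
  a : ∀ x y z w, AdjEquivData (hom x w)
    (toTricatBase.left₃ x y z w).toMapData (toTricatBase.right₃ x y z w).toMapData
  l : ∀ x y, AdjEquivData (hom x y)
    (toTricatBase.oneLeft x y).toMapData (PseudoData.id (hom x y)).toMapData
  r : ∀ x y, AdjEquivData (hom x y)
    (toTricatBase.oneRight x y).toMapData (PseudoData.id (hom x y)).toMapData

namespace TricatConstraints

variable {S : GlobularSet.{u}} (T : TricatConstraints S)

/-- The component `a(f, g, h) : (f · g) · h ⇒ f · (g · h)`. -/
def a₁ {x y z w} (f : (S.cells x y).Ob) (g : (S.cells y z).Ob) (h : (S.cells z w).Ob) :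
    (S.cells x w).Hom (T.c₁ (T.c₁ f g) h) (T.c₁ f (T.c₁ g h)) :=
  (T.a x y z w).hom.app ((f, g), h)

/-- The component `a*(f, g, h) : f · (g · h) ⇒ (f · g) · h`. -/
def a₁' {x y z w} (f : (S.cells x y).Ob) (g : (S.cells y z).Ob) (h : (S.cells z w).Ob) :
    (S.cells x w).Hom (T.c₁ f (T.c₁ g h)) (T.c₁ (T.c₁ f g) h) :=
  (T.a x y z w).inv.app ((f, g), h)

/-- The component `l(f) : 1 · f ⇒ f`. -/
def l₁ {x y} (f : (S.cells x y).Ob) : (S.cells x y).Hom (T.c₁ (T.one x) f) f :=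
  (T.l x y).hom.app f

/-- The component `r(f) : f · 1 ⇒ f`. -/
def r₁ {x y} (f : (S.cells x y).Ob) : (S.cells x y).Hom (T.c₁ f (T.one y)) f :=
  (T.r x y).hom.app f

/-- The component `r*(f) : f ⇒ f · 1`. -/
def r₁' {x y} (f : (S.cells x y).Ob) : (S.cells x y).Hom f (T.c₁ f (T.one y)) :=
  (T.r x y).inv.app f

section
variable {C : Cells.{u}} {x y z w : S.C₀}
  (P : MapData C (S.cells x y)) (Q : MapData C (S.cells y z)) (R : MapData C (S.cells z w))

/-- The transformation `a : (P · Q) · R ⇒ P · (Q · R)`. -/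
def aT : TransData (T.hom x w) (T.tenMap (T.tenMap P Q) R) (T.tenMap P (T.tenMap Q R)) :=
  TransData.restrict ((P.pair Q).pair R) (T.a x y z w).hom

/-- The transformation `a* : P · (Q · R) ⇒ (P · Q) · R`. -/
def aT' : TransData (T.hom x w) (T.tenMap P (T.tenMap Q R)) (T.tenMap (T.tenMap P Q) R) :=
  TransData.restrict ((P.pair Q).pair R) (T.a x y z w).inv

/-- The transformation `l : 1 · P ⇒ P`. -/
def lT : TransData (T.hom x y) (T.tenMap (T.unitMap C x) P) P :=
  TransData.restrict P (T.l x y).hom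

/-- The transformation `r : P · 1 ⇒ P`. -/
def rT : TransData (T.hom x y) (T.tenMap P (T.unitMap C y)) P :=
  TransData.restrict P (T.r x y).hom

/-- The transformation `r* : P ⇒ P · 1`. -/
def rT' : TransData (T.hom x y) P (T.tenMap P (T.unitMap C y)) :=
  TransData.restrict P (T.r x y).inv

/-- The identity transformation of `P`. -/
def idT : TransData (T.hom x y) P P := TransData.id (T.hom x y) P

end

/-- Quadruples of composable morphisms. -/
@[reducible] def Quad (S : GlobularSet.{u}) (x y z w v : S.C₀) : Cells.{u} :=
  (((S.cells x y).prod (S.cells y z)).prod (S.cells z w)).prod (S.cells w v)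

section
variable (S) (x y z w v : S.C₀)

/-- The first entry of a quadruple. -/
@[reducible] def q₁ : MapData (Quad S x y z w v) (S.cells x y) where
  obj b := b.1.1.1
  map u := u.1.1.1

/-- The second entry of a quadruple. -/
@[reducible] def q₂ : MapData (Quad S x y z w v) (S.cells y z) where
  obj b := b.1.1.2
  map u := u.1.1.2

/-- The third entry of a quadruple. -/
@[reducible] def q₃ : MapData (Quad S x y z w v) (S.cells z w) where
  obj b := b.1.2
  map u := u.1.2

/-- The fourth entry of a quadruple. -/
@[reducible] def q₄ : MapData (Quad S x y z w v) (S.cells w v) where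
  obj b := b.2
  map u := u.2

end

/-- The long side `(a(f,g,h) · 1_k) ∘ a(f,gh,k) ∘ (1_f · a(g,h,k))` of the pentagon. -/
def pentLong (x y z w v : S.C₀) :=
  (T.tenTrans (T.aT (q₁ S x y z w v) (q₂ S x y z w v) (q₃ S x y z w v))
    (T.idT (q₄ S x y z w v))).comp
  ((T.aT (q₁ S x y z w v) (T.tenMap (q₂ S x y z w v) (q₃ S x y z w v)) (q₄ S x y z w v)).comp
  (T.tenTrans (T.idT (q₁ S x y z w v))
    (T.aT (q₂ S x y z w v) (q₃ S x y z w v) (q₄ S x y z w v))))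

/-- The short side `a(fg,h,k) ∘ a(f,g,hk)` of the pentagon. -/
def pentShort (x y z w v : S.C₀) :=
  (T.aT (T.tenMap (q₁ S x y z w v) (q₂ S x y z w v)) (q₃ S x y z w v) (q₄ S x y z w v)).comp
  (T.aT (q₁ S x y z w v) (q₂ S x y z w v) (T.tenMap (q₃ S x y z w v) (q₄ S x y z w v)))

section
variable (x y z : S.C₀)

/-- The first entry of a pair. -/
@[reducible] def p₁ (S : GlobularSet.{u}) (x y z : S.C₀) :
    MapData ((S.cells x y).prod (S.cells y z)) (S.cells x y) := MapData.fst _ _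

/-- The second entry of a pair. -/
@[reducible] def p₂ (S : GlobularSet.{u}) (x y z : S.C₀) :
    MapData ((S.cells x y).prod (S.cells y z)) (S.cells y z) := MapData.snd _ _

/-- `(r*_f · 1_g) ∘ a(f,1,g) ∘ (1_f · l_g)`. -/
def midSource :=
  (T.tenTrans (T.rT' (p₁ S x y z)) (T.idT (p₂ S x y z))).comp
  ((T.aT (p₁ S x y z) (T.unitMap _ y) (p₂ S x y z)).comp
  (T.tenTrans (T.idT (p₁ S x y z)) (T.lT (p₂ S x y z))))

/-- `1_f · 1_g`. -/
def midTarget := T.tenTrans (T.idT (p₁ S x y z)) (T.idT (p₂ S x y z))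

/-- `l_f · 1_g`. -/
def leftSource := T.tenTrans (T.lT (p₁ S x y z)) (T.idT (p₂ S x y z))

/-- `a(1,f,g) ∘ l_(fg)`. -/
def leftTarget :=
  (T.aT (T.unitMap _ x) (p₁ S x y z) (p₂ S x y z)).comp
    (T.lT (T.tenMap (p₁ S x y z) (p₂ S x y z)))

/-- `1_f · r_g`. -/
def rightSource := T.tenTrans (T.idT (p₁ S x y z)) (T.rT (p₂ S x y z))

/-- `a*(f,g,1) ∘ r_(fg)`. -/
def rightTarget :=
  (T.aT' (p₁ S x y z) (p₂ S x y z) (T.unitMap _ z)).comp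
    (T.rT (T.tenMap (p₁ S x y z) (p₂ S x y z)))

end

end TricatConstraints

/-- The data of a tricategory on a 3-globular set, without its axioms: bicategories of morphisms,
identities, composition at a 0-cell, associator, unitors, pentagonator `π` and the middle, left and
right triangulators `μ`, `lam`, `ρ`; all invertible cells come with their inverses. -/
structure TricatData (S : GlobularSet.{u}) extends TricatConstraints S where
  π : ∀ x y z w v, ∀ b, (S.cells x v).Hom₂
    ((toTricatConstraints.pentLong x y z w v).app b)
    ((toTricatConstraints.pentShort x y z w v).app b)
  πInv : ∀ x y z w v, ∀ b, (S.cells x v).Hom₂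
    ((toTricatConstraints.pentShort x y z w v).app b)
    ((toTricatConstraints.pentLong x y z w v).app b)
  μ : ∀ x y z, ∀ b, (S.cells x z).Hom₂ ((toTricatConstraints.midSource x y z).app b)
    ((toTricatConstraints.midTarget x y z).app b)
  μInv : ∀ x y z, ∀ b, (S.cells x z).Hom₂ ((toTricatConstraints.midTarget x y z).app b)
    ((toTricatConstraints.midSource x y z).app b)
  lam : ∀ x y z, ∀ b, (S.cells x z).Hom₂ ((toTricatConstraints.leftSource x y z).app b)
    ((toTricatConstraints.leftTarget x y z).app b)
  lamInv : ∀ x y z, ∀ b, (S.cells x z).Hom₂ ((toTricatConstraints.leftTarget x y z).app b)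
    ((toTricatConstraints.leftSource x y z).app b)
  ρ : ∀ x y z, ∀ b, (S.cells x z).Hom₂ ((toTricatConstraints.rightSource x y z).app b)
    ((toTricatConstraints.rightTarget x y z).app b)
  ρInv : ∀ x y z, ∀ b, (S.cells x z).Hom₂ ((toTricatConstraints.rightTarget x y z).app b)
    ((toTricatConstraints.rightSource x y z).app b)

namespace TricatData

variable {S : GlobularSet.{u}} (T : TricatData S)

section Cells
variable {x y z w v : S.C₀}

/-- Composition of 2-morphisms at a 1-cell. -/
@[reducible] def k₂ {f g h : (S.cells x y).Ob} (α : (S.cells x y).Hom f g) (β : (S.cells x y).Hom g h) :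
    (S.cells x y).Hom f h := (T.hom x y).comp α β

/-- Composition of 3-morphisms at a 2-cell. -/
def v₃ {f g : (S.cells x y).Ob} {α β γ : (S.cells x y).Hom f g}
    (Γ : (S.cells x y).Hom₂ α β) (Δ : (S.cells x y).Hom₂ β γ) : (S.cells x y).Hom₂ α γ :=
  (T.hom x y).vcomp Γ Δ

/-- The identity 2-morphism. -/
@[reducible] def id₂ (f : (S.cells x y).Ob) : (S.cells x y).Hom f f := (T.hom x y).id f

/-- The identity 3-morphism. -/
def id₃ {f g : (S.cells x y).Ob} (α : (S.cells x y).Hom f g) : (S.cells x y).Hom₂ α α :=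
  (T.hom x y).id₂ α

/-- Whiskering `α ◁ Γ` at a 1-cell. -/
def wl {f g h : (S.cells x y).Ob} (α : (S.cells x y).Hom f g) {β β' : (S.cells x y).Hom g h}
    (Γ : (S.cells x y).Hom₂ β β') : (S.cells x y).Hom₂ (T.k₂ α β) (T.k₂ α β') :=
  (T.hom x y).wl α Γ

/-- Whiskering `Γ ▷ β` at a 1-cell. -/
def wr {f g h : (S.cells x y).Ob} {α α' : (S.cells x y).Hom f g}
    (Γ : (S.cells x y).Hom₂ α α') (β : (S.cells x y).Hom g h) :
    (S.cells x y).Hom₂ (T.k₂ α β) (T.k₂ α' β) := (T.hom x y).wr Γ β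

/-- The associator of the bicategory of morphisms from `x` to `y`. -/
def as {f g h k : (S.cells x y).Ob} (α : (S.cells x y).Hom f g) (β : (S.cells x y).Hom g h)
    (γ : (S.cells x y).Hom h k) :
    (S.cells x y).Hom₂ (T.k₂ (T.k₂ α β) γ) (T.k₂ α (T.k₂ β γ)) := (T.hom x y).assoc α β γ

/-- The inverse of `as`. -/
def asInv {f g h k : (S.cells x y).Ob} (α : (S.cells x y).Hom f g) (β : (S.cells x y).Hom g h)
    (γ : (S.cells x y).Hom h k) :
    (S.cells x y).Hom₂ (T.k₂ α (T.k₂ β γ)) (T.k₂ (T.k₂ α β) γ) := (T.hom x y).assocInv α β γ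

/-- Apply a 3-morphism `α ∘ β ⇛ γ ∘ δ` to the first two factors of `α ∘ (β ∘ ε)`. -/
def on₂ {f g g' h k : (S.cells x y).Ob} {α : (S.cells x y).Hom f g} {β : (S.cells x y).Hom g h}
    {γ : (S.cells x y).Hom f g'} {δ : (S.cells x y).Hom g' h}
    (Γ : (S.cells x y).Hom₂ (T.k₂ α β) (T.k₂ γ δ)) (ε : (S.cells x y).Hom h k) :
    (S.cells x y).Hom₂ (T.k₂ α (T.k₂ β ε)) (T.k₂ γ (T.k₂ δ ε)) :=
  T.v₃ (T.asInv α β ε) (T.v₃ (T.wr Γ ε) (T.as γ δ ε))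

/-- Apply a 3-morphism `α ∘ (β ∘ β') ⇛ γ ∘ δ` to the first three factors of
`α ∘ (β ∘ (β' ∘ ε))`. -/
def on₃ {f g g₁ g' h k : (S.cells x y).Ob} {α : (S.cells x y).Hom f g}
    {β : (S.cells x y).Hom g g₁} {β' : (S.cells x y).Hom g₁ h}
    {γ : (S.cells x y).Hom f g'} {δ : (S.cells x y).Hom g' h}
    (Γ : (S.cells x y).Hom₂ (T.k₂ α (T.k₂ β β')) (T.k₂ γ δ)) (ε : (S.cells x y).Hom h k) :
    (S.cells x y).Hom₂ (T.k₂ α (T.k₂ β (T.k₂ β' ε))) (T.k₂ γ (T.k₂ δ ε)) :=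
  T.v₃ (T.wl α (T.asInv β β' ε)) (T.on₂ (β := T.k₂ β β') Γ ε)

/-- `(α · 1_k) ∘ (β · 1_k) ⇛ (α ∘ β) · 1_k`. -/
def mergeR {f g h : (S.cells x y).Ob} (α : (S.cells x y).Hom f g) (β : (S.cells x y).Hom g h)
    (k : (S.cells y z).Ob) :
    (S.cells x z).Hom₂ (T.k₂ (T.c₂ α (T.id₂ k)) (T.c₂ β (T.id₂ k))) (T.c₂ (T.k₂ α β) (T.id₂ k)) :=
  T.v₃ (T.χ α β (T.id₂ k) (T.id₂ k)) (T.c₃ (T.id₃ (T.k₂ α β)) ((T.hom y z).lun (T.id₂ k)))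

/-- The inverse of `mergeR`. -/
def splitR {f g h : (S.cells x y).Ob} (α : (S.cells x y).Hom f g) (β : (S.cells x y).Hom g h)
    (k : (S.cells y z).Ob) :
    (S.cells x z).Hom₂ (T.c₂ (T.k₂ α β) (T.id₂ k)) (T.k₂ (T.c₂ α (T.id₂ k)) (T.c₂ β (T.id₂ k))) :=
  T.v₃ (T.c₃ (T.id₃ (T.k₂ α β)) ((T.hom y z).lunInv (T.id₂ k))) (T.χInv α β (T.id₂ k) (T.id₂ k))

/-- `(1_k · α) ∘ (1_k · β) ⇛ 1_k · (α ∘ β)`. -/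
def mergeL (k : (S.cells x y).Ob) {f g h : (S.cells y z).Ob} (α : (S.cells y z).Hom f g)
    (β : (S.cells y z).Hom g h) :
    (S.cells x z).Hom₂ (T.k₂ (T.c₂ (T.id₂ k) α) (T.c₂ (T.id₂ k) β)) (T.c₂ (T.id₂ k) (T.k₂ α β)) :=
  T.v₃ (T.χ (T.id₂ k) (T.id₂ k) α β) (T.c₃ ((T.hom x y).lun (T.id₂ k)) (T.id₃ (T.k₂ α β)))

/-- The inverse of `mergeL`. -/
def splitL (k : (S.cells x y).Ob) {f g h : (S.cells y z).Ob} (α : (S.cells y z).Hom f g)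
    (β : (S.cells y z).Hom g h) :
    (S.cells x z).Hom₂ (T.c₂ (T.id₂ k) (T.k₂ α β)) (T.k₂ (T.c₂ (T.id₂ k) α) (T.c₂ (T.id₂ k) β)) :=
  T.v₃ (T.c₃ ((T.hom x y).lunInv (T.id₂ k)) (T.id₃ (T.k₂ α β))) (T.χInv (T.id₂ k) (T.id₂ k) α β)

/-- The naturality cell of the associator at three 2-morphisms. -/
def aNat {f f' : (S.cells x y).Ob} {g g' : (S.cells y z).Ob} {h h' : (S.cells z w).Ob}
    (α : (S.cells x y).Hom f f') (β : (S.cells y z).Hom g g') (γ : (S.cells z w).Hom h h') :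
    (S.cells x w).Hom₂ (T.k₂ (T.c₂ (T.c₂ α β) γ) (T.a₁ f' g' h'))
      (T.k₂ (T.a₁ f g h) (T.c₂ α (T.c₂ β γ))) :=
  (T.a x y z w).hom.nat (x := ((f, g), h)) (y := ((f', g'), h')) ((α, β), γ)

/-- The inverse of `aNat`. -/
def aNatInv {f f' : (S.cells x y).Ob} {g g' : (S.cells y z).Ob} {h h' : (S.cells z w).Ob}
    (α : (S.cells x y).Hom f f') (β : (S.cells y z).Hom g g') (γ : (S.cells z w).Hom h h') :
    (S.cells x w).Hom₂ (T.k₂ (T.a₁ f g h) (T.c₂ α (T.c₂ β γ)))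
      (T.k₂ (T.c₂ (T.c₂ α β) γ) (T.a₁ f' g' h')) :=
  (T.a x y z w).hom.natInv (x := ((f, g), h)) (y := ((f', g'), h')) ((α, β), γ)

/-- The pentagonator `π(f, g, h, k)`. -/
def pent (f : (S.cells x y).Ob) (g : (S.cells y z).Ob) (h : (S.cells z w).Ob)
    (k : (S.cells w v).Ob) :
    (S.cells x v).Hom₂
      (T.k₂ (T.c₂ (T.a₁ f g h) (T.id₂ k))
        (T.k₂ (T.a₁ f (T.c₁ g h) k) (T.c₂ (T.id₂ f) (T.a₁ g h k))))
      (T.k₂ (T.a₁ (T.c₁ f g) h k) (T.a₁ f g (T.c₁ h k))) :=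
  T.π x y z w v (((f, g), h), k)

/-- The face `π(f, g, h, k) · 1_p` of the associahedron. -/
def pentR {u : S.C₀} (f : (S.cells x y).Ob) (g : (S.cells y z).Ob) (h : (S.cells z w).Ob)
    (k : (S.cells w v).Ob) (p : (S.cells v u).Ob) :
    (S.cells x u).Hom₂
      (T.k₂ (T.c₂ (T.c₂ (T.a₁ f g h) (T.id₂ k)) (T.id₂ p))
        (T.k₂ (T.c₂ (T.a₁ f (T.c₁ g h) k) (T.id₂ p))
          (T.c₂ (T.c₂ (T.id₂ f) (T.a₁ g h k)) (T.id₂ p))))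
      (T.k₂ (T.c₂ (T.a₁ (T.c₁ f g) h k) (T.id₂ p)) (T.c₂ (T.a₁ f g (T.c₁ h k)) (T.id₂ p))) :=
  T.v₃ (T.wl _ (T.mergeR _ _ p)) <| T.v₃ (T.mergeR _ _ p) <|
    T.v₃ (T.c₃ (T.pent f g h k) (T.id₃ (T.id₂ p))) (T.splitR _ _ p)

/-- The face `1_e · π(f, g, h, k)` of the associahedron. -/
def pentL {u : S.C₀} (e : (S.cells u x).Ob) (f : (S.cells x y).Ob) (g : (S.cells y z).Ob)
    (h : (S.cells z w).Ob) (k : (S.cells w v).Ob) :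
    (S.cells u v).Hom₂
      (T.k₂ (T.c₂ (T.id₂ e) (T.c₂ (T.a₁ f g h) (T.id₂ k)))
        (T.k₂ (T.c₂ (T.id₂ e) (T.a₁ f (T.c₁ g h) k))
          (T.c₂ (T.id₂ e) (T.c₂ (T.id₂ f) (T.a₁ g h k)))))
      (T.k₂ (T.c₂ (T.id₂ e) (T.a₁ (T.c₁ f g) h k)) (T.c₂ (T.id₂ e) (T.a₁ f g (T.c₁ h k)))) :=
  T.v₃ (T.wl _ (T.mergeL e _ _)) <| T.v₃ (T.mergeL e _ _) <|
    T.v₃ (T.c₃ (T.id₃ (T.id₂ e)) (T.pent f g h k)) (T.splitL e _ _)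

/-- The naturality cell of the associator at `1_f, 1_g, γ`, with `1_f · 1_g` replaced
by `1_(f · g)`. -/
def aNatR (f : (S.cells x y).Ob) (g : (S.cells y z).Ob) {h h' : (S.cells z w).Ob}
    (γ : (S.cells z w).Hom h h') :
    (S.cells x w).Hom₂ (T.k₂ (T.a₁ f g h) (T.c₂ (T.id₂ f) (T.c₂ (T.id₂ g) γ)))
      (T.k₂ (T.c₂ (T.id₂ (T.c₁ f g)) γ) (T.a₁ f g h')) :=
  T.v₃ (T.aNatInv (T.id₂ f) (T.id₂ g) γ) (T.wr (T.c₃ (T.iInv f g) (T.id₃ γ)) (T.a₁ f g h'))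

/-- The naturality cell of the associator at `α, 1_g, 1_h`, with `1_g · 1_h` replaced
by `1_(g · h)`. -/
def aNatL {f f' : (S.cells x y).Ob} (α : (S.cells x y).Hom f f') (g : (S.cells y z).Ob)
    (h : (S.cells z w).Ob) :
    (S.cells x w).Hom₂ (T.k₂ (T.c₂ (T.c₂ α (T.id₂ g)) (T.id₂ h)) (T.a₁ f' g h))
      (T.k₂ (T.a₁ f g h) (T.c₂ α (T.id₂ (T.c₁ g h)))) :=
  T.v₃ (T.aNat α (T.id₂ g) (T.id₂ h)) (T.wl (T.a₁ f g h) (T.c₃ (T.id₃ α) (T.iInv g h)))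

/-- The 2-morphism of `((((f g) h) k) p ⇒ f (g (h (k p)))` from which both halves of the surface
of the associahedron start. -/
def K5source {u : S.C₀} (f : (S.cells x y).Ob) (g : (S.cells y z).Ob) (h : (S.cells z w).Ob)
    (k : (S.cells w v).Ob) (p : (S.cells v u).Ob) :
    (S.cells x u).Hom (T.c₁ (T.c₁ (T.c₁ (T.c₁ f g) h) k) p)
      (T.c₁ f (T.c₁ g (T.c₁ h (T.c₁ k p)))) :=
  T.k₂ (T.c₂ (T.c₂ (T.a₁ f g h) (T.id₂ k)) (T.id₂ p)) <|
  T.k₂ (T.c₂ (T.a₁ f (T.c₁ g h) k) (T.id₂ p)) <|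
  T.k₂ (T.c₂ (T.c₂ (T.id₂ f) (T.a₁ g h k)) (T.id₂ p)) <|
  T.k₂ (T.a₁ f (T.c₁ g (T.c₁ h k)) p) <|
  T.k₂ (T.c₂ (T.id₂ f) (T.a₁ g (T.c₁ h k) p)) <|
  T.c₂ (T.id₂ f) (T.c₂ (T.id₂ g) (T.a₁ h k p))

/-- The 2-morphism at which both halves of the surface of the associahedron end. -/
def K5target {u : S.C₀} (f : (S.cells x y).Ob) (g : (S.cells y z).Ob) (h : (S.cells z w).Ob)
    (k : (S.cells w v).Ob) (p : (S.cells v u).Ob) :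
    (S.cells x u).Hom (T.c₁ (T.c₁ (T.c₁ (T.c₁ f g) h) k) p)
      (T.c₁ f (T.c₁ g (T.c₁ h (T.c₁ k p)))) :=
  T.k₂ (T.a₁ (T.c₁ (T.c₁ f g) h) k p) <|
  T.k₂ (T.a₁ (T.c₁ f g) h (T.c₁ k p)) (T.a₁ f g (T.c₁ h (T.c₁ k p)))

/-- The half of the surface of the associahedron with the faces `π(f,g,h,k) · 1_p`,
`π(f,g,hk,p)`, a naturality square, and `π(fg,h,k,p)`. -/
def K5left {u : S.C₀} (f : (S.cells x y).Ob) (g : (S.cells y z).Ob) (h : (S.cells z w).Ob)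
    (k : (S.cells w v).Ob) (p : (S.cells v u).Ob) :
    (S.cells x u).Hom₂ (T.K5source f g h k p) (T.K5target f g h k p) :=
  T.v₃ (T.on₃ (T.pentR f g h k p) _) <|
  T.v₃ (T.wl _ (T.on₃ (T.pent f g (T.c₁ h k) p) _)) <|
  T.v₃ (T.wl _ (T.wl _ (T.aNatR f g (T.a₁ h k p)))) <|
  T.on₃ (T.pent (T.c₁ f g) h k p) _

/-- The half of the surface of the associahedron with a naturality square, the faces
`1_f · π(g,h,k,p)` and `π(f,gh,k,p)`, a naturality square, and `π(f,g,h,kp)`. -/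
def K5right {u : S.C₀} (f : (S.cells x y).Ob) (g : (S.cells y z).Ob) (h : (S.cells z w).Ob)
    (k : (S.cells w v).Ob) (p : (S.cells v u).Ob) :
    (S.cells x u).Hom₂ (T.K5source f g h k p) (T.K5target f g h k p) :=
  T.v₃ (T.wl _ (T.wl _ (T.on₂ (T.aNat (T.id₂ f) (T.a₁ g h k) (T.id₂ p)) _))) <|
  T.v₃ (T.wl _ (T.wl _ (T.wl _ (T.pentL f g h k p)))) <|
  T.v₃ (T.wl _ (T.on₃ (T.pent f (T.c₁ g h) k p) _)) <|
  T.v₃ (T.on₂ (T.aNatL (T.a₁ f g h) k p) _) <|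
  T.wl _ (T.pent f g h (T.c₁ k p))

/-- The middle triangulator in the form `a(f,1,g) ∘ (1_f · l_g) ⇛ r_f · 1_g`, obtained from `μ`
by means of the unit of the adjoint equivalence of `r` and `r*`. -/
def mid (f : (S.cells x y).Ob) (g : (S.cells y z).Ob) :
    (S.cells x z).Hom₂ (T.k₂ (T.a₁ f (T.one y) g) (T.c₂ (T.id₂ f) (T.l₁ g)))
      (T.c₂ (T.r₁ f) (T.id₂ g)) :=
  T.v₃ ((T.hom x z).lunInv _) <|
  T.v₃ (T.wr (T.v₃ (T.i (T.c₁ f (T.one y)) g) (T.v₃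
    (T.c₃ ((T.r x y).unit f) (T.id₃ (T.id₂ g))) (T.splitR (T.r₁ f) (T.r₁' f) g))) _) <|
  T.v₃ (T.as _ _ _) <|
  T.v₃ (T.wl _ (T.v₃ (T.μ x y z (f, g)) (T.iInv f g))) ((T.hom x z).run _)

/-- The left triangulator `l_f · 1_g ⇛ a(1,f,g) ∘ l_(fg)`, inverted. -/
def lamC (f : (S.cells x y).Ob) (g : (S.cells y z).Ob) :
    (S.cells x z).Hom₂ (T.k₂ (T.a₁ (T.one x) f g) (T.l₁ (T.c₁ f g))) (T.c₂ (T.l₁ f) (T.id₂ g)) :=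
  T.lamInv x y z (f, g)

/-- The right triangulator in the form `a(f,g,1) ∘ (1_f · r_g) ⇛ r_(fg)`, obtained from `ρ` by
means of the unit of the adjoint equivalence of `a` and `a*`. -/
def rhoC (f : (S.cells x y).Ob) (g : (S.cells y z).Ob) :
    (S.cells x z).Hom₂ (T.k₂ (T.a₁ f g (T.one z)) (T.c₂ (T.id₂ f) (T.r₁ g))) (T.r₁ (T.c₁ f g)) :=
  T.v₃ (T.wl _ (T.ρ x y z (f, g))) <|
  T.v₃ (T.asInv (T.a₁ f g (T.one z)) (T.a₁' f g (T.one z)) (T.r₁ (T.c₁ f g))) <|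
  T.v₃ (T.wr ((T.a x y z z).unitInv ((f, g), T.one z)) _) ((T.hom x z).lun _)

end Cells

/-- The pentagonator identity: the two halves of the surface of the associahedron agree. -/
def PentagonatorIdentity : Prop :=
  ∀ {x y z w v u} (f : (S.cells x y).Ob) (g : (S.cells y z).Ob) (h : (S.cells z w).Ob)
    (k : (S.cells w v).Ob) (p : (S.cells v u).Ob), T.K5left f g h k p = T.K5right f g h k p

/-- The left normalization axiom: two 3-morphisms from
`(a(f,1,g) · 1_h) ∘ a(f,1g,h) ∘ (1_f · a(1,g,h)) ∘ (1_f · l_(gh))` to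
`((r_f · 1_g) · 1_h) ∘ a(f,g,h)` agree. -/
def LeftNormalization : Prop :=
  ∀ {x y z w} (f : (S.cells x y).Ob) (g : (S.cells y z).Ob) (h : (S.cells z w).Ob),
    (T.v₃ (T.on₃ (T.pent f (T.one y) g h) (T.c₂ (T.id₂ f) (T.l₁ (T.c₁ g h)))) <|
      T.v₃ (T.wl _ (T.mid f (T.c₁ g h))) <|
      T.v₃ (T.wl _ (T.c₃ (T.id₃ (T.r₁ f)) (T.i g h)))
        (T.aNatInv (T.r₁ f) (T.id₂ g) (T.id₂ h))) =
    (T.v₃ (T.wl _ (T.wl _ (T.v₃ (T.mergeL f _ _) (T.c₃ (T.id₃ (T.id₂ f)) (T.lamC g h))))) <|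
      T.v₃ (T.wl _ (T.aNatInv (T.id₂ f) (T.l₁ g) (T.id₂ h))) <|
      T.v₃ (T.asInv _ _ _) <|
      T.wr (T.v₃ (T.mergeR _ _ h) (T.c₃ (T.mid f g) (T.id₃ (T.id₂ h)))) (T.a₁ f g h))

/-- The right normalization axiom: two 3-morphisms from
`(a(f,g,1) · 1_h) ∘ a(f,g1,h) ∘ (1_f · a(g,1,h)) ∘ (1_f · (1_g · l_h))` to
`(r_(fg) · 1_h) ∘ a(f,g,h)` agree. -/
def RightNormalization : Prop :=
  ∀ {x y z w} (f : (S.cells x y).Ob) (g : (S.cells y z).Ob) (h : (S.cells z w).Ob),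
    (T.v₃ (T.on₃ (T.pent f g (T.one z) h) (T.c₂ (T.id₂ f) (T.c₂ (T.id₂ g) (T.l₁ h)))) <|
      T.v₃ (T.wl _ (T.aNatR f g (T.l₁ h))) <|
      T.v₃ (T.asInv _ _ _) <|
      T.wr (T.mid (T.c₁ f g) h) (T.a₁ f g h)) =
    (T.v₃ (T.wl _ (T.wl _ (T.v₃ (T.mergeL f _ _) (T.c₃ (T.id₃ (T.id₂ f)) (T.mid g h))))) <|
      T.v₃ (T.wl _ (T.aNatInv (T.id₂ f) (T.r₁ g) (T.id₂ h))) <|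
      T.v₃ (T.asInv _ _ _) <|
      T.wr (T.v₃ (T.mergeR _ _ h) (T.c₃ (T.rhoC f g) (T.id₃ (T.id₂ h)))) (T.a₁ f g h))

/-- The axioms of a tricategory. -/
structure IsTricategory : Prop where
  hom : ∀ x y, (T.hom x y).IsBicategory
  tensor : ∀ x y z, (T.tensor x y z).IsPseudofunctor
  a : ∀ x y z w, (T.a x y z w).IsAdjEquiv (F := T.left₃ x y z w) (G := T.right₃ x y z w)
  l : ∀ x y, (T.l x y).IsAdjEquiv (F := T.oneLeft x y) (G := PseudoData.id (T.hom x y))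
  r : ∀ x y, (T.r x y).IsAdjEquiv (F := T.oneRight x y) (G := PseudoData.id (T.hom x y))
  π : ∀ x y z w v, TransData.IsModIso (T.pentLong x y z w v) (T.pentShort x y z w v)
    (T.π x y z w v) (T.πInv x y z w v)
  μ : ∀ x y z, TransData.IsModIso (T.midSource x y z) (T.midTarget x y z)
    (T.μ x y z) (T.μInv x y z)
  lam : ∀ x y z, TransData.IsModIso (T.leftSource x y z) (T.leftTarget x y z)
    (T.lam x y z) (T.lamInv x y z)
  ρ : ∀ x y z, TransData.IsModIso (T.rightSource x y z) (T.rightTarget x y z)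
    (T.ρ x y z) (T.ρInv x y z)
  pentagonator : T.PentagonatorIdentity
  leftNormalization : T.LeftNormalization
  rightNormalization : T.RightNormalization

/-- A 3-morphism is invertible. -/
def Invertible₃ {x y} {f g : (S.cells x y).Ob} {α β : (S.cells x y).Hom f g}
    (Γ : (S.cells x y).Hom₂ α β) : Prop :=
  ∃ Δ : (S.cells x y).Hom₂ β α, (T.hom x y).Inverse Γ Δ

/-- A 2-morphism is weakly invertible: invertible up to invertible 3-morphisms. -/
def Invertible₂ {x y} {f g : (S.cells x y).Ob} (α : (S.cells x y).Hom f g) : Prop :=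
  ∃ β : (S.cells x y).Hom g f,
    (∃ Γ : (S.cells x y).Hom₂ (T.k₂ α β) (T.id₂ f), T.Invertible₃ Γ) ∧
    (∃ Γ : (S.cells x y).Hom₂ (T.k₂ β α) (T.id₂ g), T.Invertible₃ Γ)

/-- A morphism is weakly invertible: invertible up to weakly invertible 2-morphisms. -/
def Invertible₁ {x y} (f : (S.cells x y).Ob) : Prop :=
  ∃ g : (S.cells y x).Ob,
    (∃ α : (S.cells x x).Hom (T.c₁ f g) (T.one x), T.Invertible₂ α) ∧
    (∃ α : (S.cells y y).Hom (T.c₁ g f) (T.one y), T.Invertible₂ α)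

end TricatData

/-! ## Strict maps -/

/-- A map of 3-globular sets. -/
structure GlobularSet.Map (S S' : GlobularSet.{u}) where
  f₀ : S.C₀ → S'.C₀
  f₁ : S.C₁ → S'.C₁
  f₂ : S.C₂ → S'.C₂
  f₃ : S.C₃ → S'.C₃
  s₀ : ∀ f, S'.s₀ (f₁ f) = f₀ (S.s₀ f)
  t₀ : ∀ f, S'.t₀ (f₁ f) = f₀ (S.t₀ f)
  s₁ : ∀ f, S'.s₁ (f₂ f) = f₁ (S.s₁ f)
  t₁ : ∀ f, S'.t₁ (f₂ f) = f₁ (S.t₁ f)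
  s₂ : ∀ f, S'.s₂ (f₃ f) = f₂ (S.s₂ f)
  t₂ : ∀ f, S'.t₂ (f₃ f) = f₂ (S.t₂ f)

namespace GlobularSet.Map

variable {S S' : GlobularSet.{u}} (F : GlobularSet.Map S S')

/-- The induced map on morphisms from `x` to `y`. -/
def ob {x y} (f : (S.cells x y).Ob) : (S'.cells (F.f₀ x) (F.f₀ y)).Ob :=
  ⟨F.f₁ f.1, by rw [F.s₀, f.2.1], by rw [F.t₀, f.2.2]⟩

/-- The induced map on 2-morphisms. -/
def hom {x y} {f g : (S.cells x y).Ob} (α : (S.cells x y).Hom f g) :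
    (S'.cells (F.f₀ x) (F.f₀ y)).Hom (F.ob f) (F.ob g) :=
  ⟨F.f₂ α.1, by rw [F.s₁, α.2.1]; rfl, by rw [F.t₁, α.2.2]; rfl⟩

/-- The induced map on 3-morphisms. -/
def hom₂ {x y} {f g : (S.cells x y).Ob} {α β : (S.cells x y).Hom f g}
    (Γ : (S.cells x y).Hom₂ α β) : (S'.cells (F.f₀ x) (F.f₀ y)).Hom₂ (F.hom α) (F.hom β) :=
  ⟨F.f₃ Γ.1, by rw [F.s₂, Γ.2.1]; rfl, by rw [F.t₂, Γ.2.2]; rfl⟩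

end GlobularSet.Map

/-- All components of `e` are sent to the corresponding components of `e'`, where `o` and `m` map
the indices, and the values are compared in `A₂` and `A₃`. -/
structure AdjEquivData.Preserved {C D C' D' : Cells.{u}} {B : BicatData D} {B' : BicatData D'}
    {F G : MapData C D} {F' G' : MapData C' D'}
    (e : AdjEquivData B F G) (e' : AdjEquivData B' F' G')
    (o : C.Ob → C'.Ob) (m : ∀ {x y}, C.Hom x y → C'.Hom (o x) (o y)) {A₂ A₃ : Type u}
    (p₂ : ∀ {x y}, D.Hom x y → A₂) (p₂' : ∀ {x y}, D'.Hom x y → A₂)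
    (p₃ : ∀ {x y} {f g : D.Hom x y}, D.Hom₂ f g → A₃)
    (p₃' : ∀ {x y} {f g : D'.Hom x y}, D'.Hom₂ f g → A₃) : Prop where
  hom_app : ∀ x, p₂' (e'.hom.app (o x)) = p₂ (e.hom.app x)
  hom_nat : ∀ {x y} (f : C.Hom x y), p₃' (e'.hom.nat (m f)) = p₃ (e.hom.nat f)
  hom_natInv : ∀ {x y} (f : C.Hom x y), p₃' (e'.hom.natInv (m f)) = p₃ (e.hom.natInv f)
  inv_app : ∀ x, p₂' (e'.inv.app (o x)) = p₂ (e.inv.app x)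
  inv_nat : ∀ {x y} (f : C.Hom x y), p₃' (e'.inv.nat (m f)) = p₃ (e.inv.nat f)
  inv_natInv : ∀ {x y} (f : C.Hom x y), p₃' (e'.inv.natInv (m f)) = p₃ (e.inv.natInv f)
  unit : ∀ x, p₃' (e'.unit (o x)) = p₃ (e.unit x)
  unitInv : ∀ x, p₃' (e'.unitInv (o x)) = p₃ (e.unitInv x)
  counit : ∀ x, p₃' (e'.counit (o x)) = p₃ (e.counit x)
  counitInv : ∀ x, p₃' (e'.counitInv (o x)) = p₃ (e.counitInv x)

/-- A map of 3-globular sets strictly preserves all operations of a tricategory. -/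
structure TricatData.Preserved {S S' : GlobularSet.{u}} (T : TricatData S) (T' : TricatData S')
    (F : GlobularSet.Map S S') : Prop where
  id : ∀ {x y} (f : (S.cells x y).Ob), ((T'.hom _ _).id (F.ob f)).1 = F.f₂ ((T.hom x y).id f).1
  comp : ∀ {x y} {f g h : (S.cells x y).Ob} (α : (S.cells x y).Hom f g)
    (β : (S.cells x y).Hom g h),
    ((T'.hom _ _).comp (F.hom α) (F.hom β)).1 = F.f₂ ((T.hom x y).comp α β).1
  id₂ : ∀ {x y} {f g : (S.cells x y).Ob} (α : (S.cells x y).Hom f g),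
    ((T'.hom _ _).id₂ (F.hom α)).1 = F.f₃ ((T.hom x y).id₂ α).1
  vcomp : ∀ {x y} {f g : (S.cells x y).Ob} {α β γ : (S.cells x y).Hom f g}
    (Γ : (S.cells x y).Hom₂ α β) (Δ : (S.cells x y).Hom₂ β γ),
    ((T'.hom _ _).vcomp (F.hom₂ Γ) (F.hom₂ Δ)).1 = F.f₃ ((T.hom x y).vcomp Γ Δ).1
  hcomp : ∀ {x y} {f g h : (S.cells x y).Ob} {α α' : (S.cells x y).Hom f g}
    {β β' : (S.cells x y).Hom g h} (Γ : (S.cells x y).Hom₂ α α') (Δ : (S.cells x y).Hom₂ β β'),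
    ((T'.hom _ _).hcomp (F.hom₂ Γ) (F.hom₂ Δ)).1 = F.f₃ ((T.hom x y).hcomp Γ Δ).1
  assoc : ∀ {x y} {f g h k : (S.cells x y).Ob} (α : (S.cells x y).Hom f g)
    (β : (S.cells x y).Hom g h) (γ : (S.cells x y).Hom h k),
    ((T'.hom _ _).assoc (F.hom α) (F.hom β) (F.hom γ)).1 = F.f₃ ((T.hom x y).assoc α β γ).1
  assocInv : ∀ {x y} {f g h k : (S.cells x y).Ob} (α : (S.cells x y).Hom f g)
    (β : (S.cells x y).Hom g h) (γ : (S.cells x y).Hom h k),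
    ((T'.hom _ _).assocInv (F.hom α) (F.hom β) (F.hom γ)).1 = F.f₃ ((T.hom x y).assocInv α β γ).1
  lun : ∀ {x y} {f g : (S.cells x y).Ob} (α : (S.cells x y).Hom f g),
    ((T'.hom _ _).lun (F.hom α)).1 = F.f₃ ((T.hom x y).lun α).1
  lunInv : ∀ {x y} {f g : (S.cells x y).Ob} (α : (S.cells x y).Hom f g),
    ((T'.hom _ _).lunInv (F.hom α)).1 = F.f₃ ((T.hom x y).lunInv α).1
  run : ∀ {x y} {f g : (S.cells x y).Ob} (α : (S.cells x y).Hom f g),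
    ((T'.hom _ _).run (F.hom α)).1 = F.f₃ ((T.hom x y).run α).1
  runInv : ∀ {x y} {f g : (S.cells x y).Ob} (α : (S.cells x y).Hom f g),
    ((T'.hom _ _).runInv (F.hom α)).1 = F.f₃ ((T.hom x y).runInv α).1
  one : ∀ x, (T'.one (F.f₀ x)).1 = F.f₁ (T.one x).1
  c₁ : ∀ {x y z} (f : (S.cells x y).Ob) (g : (S.cells y z).Ob),
    (T'.c₁ (F.ob f) (F.ob g)).1 = F.f₁ (T.c₁ f g).1
  c₂ : ∀ {x y z} {f f' : (S.cells x y).Ob} {g g' : (S.cells y z).Ob}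
    (α : (S.cells x y).Hom f f') (β : (S.cells y z).Hom g g'),
    (T'.c₂ (F.hom α) (F.hom β)).1 = F.f₂ (T.c₂ α β).1
  c₃ : ∀ {x y z} {f f' : (S.cells x y).Ob} {g g' : (S.cells y z).Ob}
    {α α' : (S.cells x y).Hom f f'} {β β' : (S.cells y z).Hom g g'}
    (Γ : (S.cells x y).Hom₂ α α') (Δ : (S.cells y z).Hom₂ β β'),
    (T'.c₃ (F.hom₂ Γ) (F.hom₂ Δ)).1 = F.f₃ (T.c₃ Γ Δ).1
  χ : ∀ {x y z} {f f' f'' : (S.cells x y).Ob} {g g' g'' : (S.cells y z).Ob}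
    (α : (S.cells x y).Hom f f') (α' : (S.cells x y).Hom f' f'')
    (β : (S.cells y z).Hom g g') (β' : (S.cells y z).Hom g' g''),
    (T'.χ (F.hom α) (F.hom α') (F.hom β) (F.hom β')).1 = F.f₃ (T.χ α α' β β').1
  χInv : ∀ {x y z} {f f' f'' : (S.cells x y).Ob} {g g' g'' : (S.cells y z).Ob}
    (α : (S.cells x y).Hom f f') (α' : (S.cells x y).Hom f' f'')
    (β : (S.cells y z).Hom g g') (β' : (S.cells y z).Hom g' g''),
    (T'.χInv (F.hom α) (F.hom α') (F.hom β) (F.hom β')).1 = F.f₃ (T.χInv α α' β β').1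
  i : ∀ {x y z} (f : (S.cells x y).Ob) (g : (S.cells y z).Ob),
    (T'.i (F.ob f) (F.ob g)).1 = F.f₃ (T.i f g).1
  iInv : ∀ {x y z} (f : (S.cells x y).Ob) (g : (S.cells y z).Ob),
    (T'.iInv (F.ob f) (F.ob g)).1 = F.f₃ (T.iInv f g).1
  a : ∀ x y z w, (T.a x y z w).Preserved (T'.a (F.f₀ x) (F.f₀ y) (F.f₀ z) (F.f₀ w))
    (fun b => ((F.ob b.1.1, F.ob b.1.2), F.ob b.2))
    (fun u => ((F.hom u.1.1, F.hom u.1.2), F.hom u.2))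
    (fun α => F.f₂ α.1) (fun α => α.1) (fun Γ => F.f₃ Γ.1) (fun Γ => Γ.1)
  l : ∀ x y, (T.l x y).Preserved (T'.l (F.f₀ x) (F.f₀ y)) F.ob F.hom
    (fun α => F.f₂ α.1) (fun α => α.1) (fun Γ => F.f₃ Γ.1) (fun Γ => Γ.1)
  r : ∀ x y, (T.r x y).Preserved (T'.r (F.f₀ x) (F.f₀ y)) F.ob F.hom
    (fun α => F.f₂ α.1) (fun α => α.1) (fun Γ => F.f₃ Γ.1) (fun Γ => Γ.1)
  π : ∀ {x y z w v} (f : (S.cells x y).Ob) (g : (S.cells y z).Ob) (h : (S.cells z w).Ob)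
    (k : (S.cells w v).Ob),
    (T'.π _ _ _ _ _ (((F.ob f, F.ob g), F.ob h), F.ob k)).1 =
      F.f₃ (T.π _ _ _ _ _ (((f, g), h), k)).1
  πInv : ∀ {x y z w v} (f : (S.cells x y).Ob) (g : (S.cells y z).Ob) (h : (S.cells z w).Ob)
    (k : (S.cells w v).Ob),
    (T'.πInv _ _ _ _ _ (((F.ob f, F.ob g), F.ob h), F.ob k)).1 =
      F.f₃ (T.πInv _ _ _ _ _ (((f, g), h), k)).1
  μ : ∀ {x y z} (f : (S.cells x y).Ob) (g : (S.cells y z).Ob),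
    (T'.μ _ _ _ (F.ob f, F.ob g)).1 = F.f₃ (T.μ _ _ _ (f, g)).1
  μInv : ∀ {x y z} (f : (S.cells x y).Ob) (g : (S.cells y z).Ob),
    (T'.μInv _ _ _ (F.ob f, F.ob g)).1 = F.f₃ (T.μInv _ _ _ (f, g)).1
  lam : ∀ {x y z} (f : (S.cells x y).Ob) (g : (S.cells y z).Ob),
    (T'.lam _ _ _ (F.ob f, F.ob g)).1 = F.f₃ (T.lam _ _ _ (f, g)).1
  lamInv : ∀ {x y z} (f : (S.cells x y).Ob) (g : (S.cells y z).Ob),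
    (T'.lamInv _ _ _ (F.ob f, F.ob g)).1 = F.f₃ (T.lamInv _ _ _ (f, g)).1
  ρ : ∀ {x y z} (f : (S.cells x y).Ob) (g : (S.cells y z).Ob),
    (T'.ρ _ _ _ (F.ob f, F.ob g)).1 = F.f₃ (T.ρ _ _ _ (f, g)).1
  ρInv : ∀ {x y z} (f : (S.cells x y).Ob) (g : (S.cells y z).Ob),
    (T'.ρInv _ _ _ (F.ob f, F.ob g)).1 = F.f₃ (T.ρInv _ _ _ (f, g)).1

/-! ## Tricategories internal to a category -/

/-- The objects of objects, morphisms, 2-morphisms and 3-morphisms of an internal tricategory,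
with their source and target maps. -/
structure InternalGlobular (K : Type*) [Category.{u} K] where
  (T₀ T₁ T₂ T₃ : K)
  (s₀ t₀ : T₁ ⟶ T₀)
  (s₁ t₁ : T₂ ⟶ T₁)
  (s₂ t₂ : T₃ ⟶ T₂)
  s₀_s₁ : s₁ ≫ s₀ = t₁ ≫ s₀
  t₀_s₁ : s₁ ≫ t₀ = t₁ ≫ t₀
  s₁_s₂ : s₂ ≫ s₁ = t₂ ≫ s₁
  t₁_s₂ : s₂ ≫ t₁ = t₂ ≫ t₁

namespace InternalGlobular

variable {K : Type*} [Category.{u} K] (D : InternalGlobular K)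

/-- The 3-globular set of `X`-points (morphisms with domain `X`). -/
def points (X : K) : GlobularSet.{u} where
  C₀ := X ⟶ D.T₀
  C₁ := X ⟶ D.T₁
  C₂ := X ⟶ D.T₂
  C₃ := X ⟶ D.T₃
  s₀ f := f ≫ D.s₀
  t₀ f := f ≫ D.t₀
  s₁ f := f ≫ D.s₁
  t₁ f := f ≫ D.t₁
  s₂ f := f ≫ D.s₂
  t₂ f := f ≫ D.t₂
  s₀_s₁ f := by simp [D.s₀_s₁]
  t₀_s₁ f := by simp [D.t₀_s₁]
  s₁_s₂ f := by simp [D.s₁_s₂]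
  t₁_s₂ f := by simp [D.t₁_s₂]

/-- Restriction of `X`-points along `φ : Y ⟶ X`. -/
def restrict {X Y : K} (φ : Y ⟶ X) : GlobularSet.Map (D.points X) (D.points Y) where
  f₀ f := φ ≫ f
  f₁ f := φ ≫ f
  f₂ f := φ ≫ f
  f₃ f := φ ≫ f
  s₀ f := Category.assoc _ _ _
  t₀ f := Category.assoc _ _ _
  s₁ f := Category.assoc _ _ _
  t₁ f := Category.assoc _ _ _
  s₂ f := Category.assoc _ _ _
  t₂ f := Category.assoc _ _ _

end InternalGlobular

section Composable

variable {K : Type*} [Category.{u} K] {B E : K}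

/-- The object `E ×_B E` of pairs with `t` of the first entry equal to `s` of the second exists. -/
def HasPairs (s t : E ⟶ B) : Prop := HasPullback t s

/-- The object `(E ×_B E) ×_B E` of composable triples exists. -/
def HasTriples (s t : E ⟶ B) : Prop :=
  ∃ _ : HasPullback t s, HasPullback (pullback.snd t s ≫ t) s

/-- The object `((E ×_B E) ×_B E) ×_B E` of composable quadruples exists. -/
def HasQuadruples (s t : E ⟶ B) : Prop :=
  ∃ (_ : HasPullback t s) (_ : HasPullback (pullback.snd t s ≫ t) s),
    HasPullback (pullback.snd (pullback.snd t s ≫ t) s ≫ t) s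

/-- For `s t : E ⟶ B` and `s' t' : B ⟶ A`, the object `(E ×_B E) ×_A (E ×_B E)` exists. -/
def HasSquares {A : K} (s t : E ⟶ B) (s' t' : B ⟶ A) : Prop :=
  ∃ _ : HasPullback t s,
    HasPullback (pullback.fst t s ≫ s ≫ t') (pullback.fst t s ≫ s ≫ s')

end Composable

/-- The data of a tricategory internal to `K`, without its axioms.  The operations are given on
`X`-points for all objects `X`.  Once they are natural in `X`, they are, by the Yoneda lemma, the
same as morphisms of `K`, whose domains are the objects of composable tuples of cells. -/
structure InternalTricatData (K : Type*) [Category.{u} K] extends InternalGlobular K where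
  ops : ∀ X : K, TricatData (toInternalGlobular.points X)

namespace InternalTricatData

variable {K : Type*} [Category.{u} K] (D : InternalTricatData K)

/-- The objects of composable tuples of cells on which the operations of a tricategory are defined
exist in `K`. -/
structure HasComposables : Prop where
  pairs₁ : HasPairs D.s₀ D.t₀
  triples₁ : HasTriples D.s₀ D.t₀
  quadruples₁ : HasQuadruples D.s₀ D.t₀
  pairs₂ : HasPairs (D.s₁ ≫ D.s₀) (D.s₁ ≫ D.t₀)
  triples₂ : HasTriples (D.s₁ ≫ D.s₀) (D.s₁ ≫ D.t₀)
  pairs₃ : HasPairs (D.s₂ ≫ D.s₁ ≫ D.s₀) (D.s₂ ≫ D.s₁ ≫ D.t₀)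
  vpairs₂ : HasPairs D.s₁ D.t₁
  vtriples₂ : HasTriples D.s₁ D.t₁
  vpairs₃ : HasPairs (D.s₂ ≫ D.s₁) (D.s₂ ≫ D.t₁)
  tpairs₃ : HasPairs D.s₂ D.t₂
  squares₂ : HasSquares D.s₁ D.t₁ D.s₀ D.t₀

/-- All operations are natural, that is, given by morphisms of `K`. -/
def IsNatural : Prop :=
  ∀ {X Y : K} (φ : Y ⟶ X), (D.ops X).Preserved (D.ops Y) (D.restrict φ)

/-- The pentagonator identity. -/
def PentagonatorIdentity : Prop := ∀ X : K, (D.ops X).PentagonatorIdentity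

/-- The data form a tricategory internal to `K`. -/
structure IsTricategory : Prop where
  composables : D.HasComposables
  natural : D.IsNatural
  pointwise : ∀ X : K, (D.ops X).IsTricategory

/-- The data form a 3-group internal to `K`: a tricategory with one object, all of whose
morphisms, 2-morphisms and 3-morphisms are weakly invertible. -/
structure IsThreeGroup : Prop extends D.IsTricategory where
  one_object : Nonempty (IsTerminal D.T₀)
  invertible₁ : ∀ (X : K) (x y) (f : ((D.points X).cells x y).Ob), (D.ops X).Invertible₁ f
  invertible₂ : ∀ (X : K) (x y) (f g : ((D.points X).cells x y).Ob)
    (α : ((D.points X).cells x y).Hom f g), (D.ops X).Invertible₂ α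
  invertible₃ : ∀ (X : K) (x y) (f g : ((D.points X).cells x y).Ob)
    (α β : ((D.points X).cells x y).Hom f g) (Γ : ((D.points X).cells x y).Hom₂ α β),
    (D.ops X).Invertible₃ Γ

end InternalTricatData

/-! ## The tricategory of a 4-cochain -/

namespace Brane

variable {K : Type*} [Category.{u} K] [CartesianMonoidalCategory K] {G H : K}
  [GrpObj G] [AddGrpObj H] (act : G ⊗ H ⟶ H) (π : G ⊗ (G ⊗ (G ⊗ G)) ⟶ H)

/-- Multiplication of points of `G`. -/
def mul {X : K} (g g' : X ⟶ G) : X ⟶ G := lift g g' ≫ MonObj.mul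

variable (G) in
/-- The neutral point of `G`. -/
def one (X : K) : X ⟶ G := toUnit X ≫ MonObj.one

/-- Addition of points of `H`. -/
def add {X : K} (h h' : X ⟶ H) : X ⟶ H := lift h h' ≫ AddMonObj.add

variable (H) in
/-- The neutral point of `H`. -/
def zero (X : K) : X ⟶ H := toUnit X ≫ AddMonObj.zero

/-- The action of a point of `G` on a point of `H`. -/
def smul {X : K} (g : X ⟶ G) (h : X ⟶ H) : X ⟶ H := lift g h ≫ act

theorem mul_assoc' {X : K} (f g h : X ⟶ G) : mul (mul f g) h = mul f (mul g h) :=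
  letI := Hom.group (G := G) (X := X)
  _root_.mul_assoc f g h

theorem one_mul' {X : K} (f : X ⟶ G) : mul (one G X) f = f :=
  letI := Hom.group (G := G) (X := X)
  _root_.one_mul f

theorem mul_one' {X : K} (f : X ⟶ G) : mul f (one G X) = f :=
  letI := Hom.group (G := G) (X := X)
  _root_.mul_one f

variable (G H) in
/-- One object, `G` as the morphisms, only identity 2-morphisms (so the 2-morphisms are `G` again,
with source and target the identity), and `G × H` as the 3-morphisms, with source and target the
projection to `G`. -/
@[reducible] def globular : InternalGlobular K where
  T₀ := 𝟙_ K
  T₁ := G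
  T₂ := G
  T₃ := G ⊗ H
  s₀ := toUnit G
  t₀ := toUnit G
  s₁ := 𝟙 G
  t₁ := 𝟙 G
  s₂ := fst G H
  t₂ := fst G H
  s₀_s₁ := rfl
  t₀_s₁ := rfl
  s₁_s₂ := rfl
  t₁_s₂ := rfl

section

variable {X : K} {x y z : X ⟶ 𝟙_ K}

/-- The morphism given by a point of `G`. -/
def mk₁ (x y : X ⟶ 𝟙_ K) (g : X ⟶ G) : (((globular G H).points X).cells x y).Ob :=
  ⟨g, toUnit_unique _ _, toUnit_unique _ _⟩

/-- The identity 2-morphism of a morphism, as a 2-morphism between equal morphisms. -/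
def mk₂ (f g : (((globular G H).points X).cells x y).Ob) (e : f.1 = g.1) :
    (((globular G H).points X).cells x y).Hom f g :=
  ⟨f.1, Category.comp_id _, (Category.comp_id _).trans e⟩

theorem eq_of_hom {f g : (((globular G H).points X).cells x y).Ob}
    (α : (((globular G H).points X).cells x y).Hom f g) : f.1 = g.1 :=
  α.2.1.symm.trans α.2.2

theorem hom_val {f g : (((globular G H).points X).cells x y).Ob}
    (α : (((globular G H).points X).cells x y).Hom f g) : α.1 = f.1 :=
  (Category.comp_id _).symm.trans α.2.1

/-- The 3-morphism `(g, h)`, where `g` is the underlying point of `α` and `β`. -/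
def mk₃ {f g : (((globular G H).points X).cells x y).Ob}
    (α β : (((globular G H).points X).cells x y).Hom f g) (h : X ⟶ H) :
    (((globular G H).points X).cells x y).Hom₂ α β :=
  ⟨lift α.1 h, lift_fst _ _, (lift_fst _ _).trans ((hom_val α).trans (hom_val β).symm)⟩

/-- The point of `H` underlying a 3-morphism. -/
def val₃ {f g : (((globular G H).points X).cells x y).Ob}
    {α β : (((globular G H).points X).cells x y).Hom f g}
    (Γ : (((globular G H).points X).cells x y).Hom₂ α β) : X ⟶ H := Γ.1 ≫ snd G H

end

variable (X : K)

/-- Composition at a 1-cell and at a 2-cell: both are trivial on `G`, and addition on `H`. -/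
@[reducible] def homData (x y : X ⟶ 𝟙_ K) : BicatData (((globular G H).points X).cells x y) where
  id f := mk₂ f f rfl
  comp α β := mk₂ _ _ ((eq_of_hom α).trans (eq_of_hom β))
  id₂ _ := mk₃ _ _ (zero H X)
  vcomp Γ Δ := mk₃ _ _ (add (val₃ Γ) (val₃ Δ))
  hcomp Γ Δ := mk₃ _ _ (add (val₃ Γ) (val₃ Δ))
  assoc _ _ _ := mk₃ _ _ (zero H X)
  assocInv _ _ _ := mk₃ _ _ (zero H X)
  lun _ := mk₃ _ _ (zero H X)
  lunInv _ := mk₃ _ _ (zero H X)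
  run _ := mk₃ _ _ (zero H X)
  runInv _ := mk₃ _ _ (zero H X)

/-- Composition at a 0-cell: the multiplication of `G` on morphisms and 2-morphisms, and
`(g, h) (g', h') = (g g', h + g h')`, the multiplication of the semidirect product, on
3-morphisms. -/
@[reducible] def base : TricatBase ((globular G H).points X) where
  hom x y := homData X x y
  one x := mk₁ x x (one G X)
  tensor x y z :=
    { obj := fun p => mk₁ x z (mul p.1.1 p.2.1)
      map := fun α => mk₂ _ _ (congrArg₂ mul (eq_of_hom α.1) (eq_of_hom α.2))
      map₂ := fun {_ _ α _} Γ => mk₃ _ _ (add (val₃ Γ.1) (smul act α.1.1 (val₃ Γ.2)))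
      mapComp := fun _ _ => mk₃ _ _ (zero H X)
      mapCompInv := fun _ _ => mk₃ _ _ (zero H X)
      mapId := fun _ => mk₃ _ _ (zero H X)
      mapIdInv := fun _ => mk₃ _ _ (zero H X) }

/-- The trivial adjoint equivalence between two maps that agree on morphisms. -/
@[reducible] def trivialEquiv {C : Cells.{u}} {x y : X ⟶ 𝟙_ K}
    (F F' : MapData C (((globular G H).points X).cells x y))
    (e : ∀ b, (F.obj b).1 = (F'.obj b).1) :
    AdjEquivData (homData X x y) F F' where
  hom :=
    { app := fun b => mk₂ _ _ (e b)
      nat := fun _ => mk₃ _ _ (zero H X)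
      natInv := fun _ => mk₃ _ _ (zero H X) }
  inv :=
    { app := fun b => mk₂ _ _ (e b).symm
      nat := fun _ => mk₃ _ _ (zero H X)
      natInv := fun _ => mk₃ _ _ (zero H X) }
  unit _ := mk₃ _ _ (zero H X)
  unitInv _ := mk₃ _ _ (zero H X)
  counit _ := mk₃ _ _ (zero H X)
  counitInv _ := mk₃ _ _ (zero H X)

/-- The associator and the unitors are trivial. -/
@[reducible] def constraints : TricatConstraints ((globular G H).points X) where
  toTricatBase := base act X
  a x y z w := trivialEquiv X _ _ fun b => mul_assoc' b.1.1.1 b.1.2.1 b.2.1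
  l x y := trivialEquiv X _ _ fun b => one_mul' b.1
  r x y := trivialEquiv X _ _ fun b => mul_one' b.1

/-- The pentagonator is `π`; the other constraints are trivial. -/
def ops : TricatData ((globular G H).points X) where
  toTricatConstraints := constraints act X
  π _ _ _ _ _ b := mk₃ _ _ (lift b.1.1.1.1 (lift b.1.1.2.1 (lift b.1.2.1 b.2.1)) ≫ π)
  πInv _ _ _ _ _ b :=
    mk₃ _ _ (lift b.1.1.1.1 (lift b.1.1.2.1 (lift b.1.2.1 b.2.1)) ≫ π ≫ AddGrpObj.neg)
  μ _ _ _ _ := mk₃ _ _ (zero H X)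
  μInv _ _ _ _ := mk₃ _ _ (zero H X)
  lam _ _ _ _ := mk₃ _ _ (zero H X)
  lamInv _ _ _ _ := mk₃ _ _ (zero H X)
  ρ _ _ _ _ := mk₃ _ _ (zero H X)
  ρInv _ _ _ _ := mk₃ _ _ (zero H X)

end Brane

/-- The data of the tricategory `Brane_π(G, H)` internal to `K`, for a group `G` in `K`, a group
`H` in `K`, a morphism `act : G × H ⟶ H`, and a morphism `π : G⁴ ⟶ H`. -/
def brane {K : Type*} [Category.{u} K] [CartesianMonoidalCategory K] {G H : K}
    [GrpObj G] [AddGrpObj H] (act : G ⊗ H ⟶ H) (π : G ⊗ (G ⊗ (G ⊗ G)) ⟶ H) :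
    InternalTricatData K where
  toInternalGlobular := Brane.globular G H
  ops := Brane.ops act π

noncomputable section

/-! ## Smooth manifolds -/

/-- A smooth manifold: finite-dimensional, without boundary, Hausdorff, second countable. -/
structure SmoothMan where
  {E M : Type u}
  pt : Type u
  [normed : NormedAddCommGroup E]
  [space : NormedSpace ℝ E]
  [finite : FiniteDimensional ℝ E]
  [topModel : TopologicalSpace M]
  I : ModelWithCorners ℝ E M
  [boundaryless : I.Boundaryless]
  [top : TopologicalSpace pt]
  [charted : ChartedSpace M pt]
  [manifold : IsManifold I ∞ pt]
  [t2 : T2Space pt]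
  [second : SecondCountableTopology pt]

namespace SmoothMan

attribute [instance] normed space finite topModel boundaryless top charted manifold t2 second

/-- Smooth maps. -/
@[ext] structure Hom (X Y : SmoothMan.{u}) where
  toFun : X.pt → Y.pt
  smooth : ContMDiff X.I Y.I ∞ toFun

instance : Category SmoothMan.{u} where
  Hom := Hom
  id X := ⟨fun x => x, contMDiff_id⟩
  comp f g := ⟨fun x => g.toFun (f.toFun x), g.smooth.comp f.smooth⟩

/-- The underlying function of a morphism. -/
def fn {X Y : SmoothMan.{u}} (f : X ⟶ Y) : X.pt → Y.pt := Hom.toFun f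

theorem fn_smooth {X Y : SmoothMan.{u}} (f : X ⟶ Y) : ContMDiff X.I Y.I ∞ (fn f) := Hom.smooth f

/-- The morphism given by a smooth function. -/
def mk' {X Y : SmoothMan.{u}} (f : X.pt → Y.pt) (hf : ContMDiff X.I Y.I ∞ f) : X ⟶ Y := ⟨f, hf⟩

theorem hom_ext {X Y : SmoothMan.{u}} {f g : X ⟶ Y} (h : ∀ x, fn f x = fn g x) : f = g :=
  Hom.ext (funext h)

/-- The one-point manifold. -/
@[reducible] def point : SmoothMan.{u} where
  E := PUnit
  M := PUnit
  pt := PUnit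
  I := 𝓘(ℝ, PUnit)

/-- The product of two manifolds. -/
@[reducible] def prod (X Y : SmoothMan.{u}) : SmoothMan.{u} where
  E := X.E × Y.E
  M := ModelProd X.M Y.M
  pt := X.pt × Y.pt
  I := X.I.prod Y.I

/-- The first projection. -/
def prodFst (X Y : SmoothMan.{u}) : prod X Y ⟶ X := mk' Prod.fst contMDiff_fst

/-- The second projection. -/
def prodSnd (X Y : SmoothMan.{u}) : prod X Y ⟶ Y := mk' Prod.snd contMDiff_snd

/-- The pairing of two smooth maps. -/
def prodLift {X Y Z : SmoothMan.{u}} (f : Z ⟶ X) (g : Z ⟶ Y) : Z ⟶ prod X Y :=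
  mk' (fun z => (fn f z, fn g z)) ((fn_smooth f).prodMk (fn_smooth g))

/-- The one-point manifold is terminal. -/
def pointIsTerminal : IsTerminal point.{u} :=
  IsTerminal.ofUniqueHom (fun _ => mk' (fun _ => PUnit.unit) contMDiff_const)
    (fun _ _ => hom_ext fun _ => rfl)

/-- The product is a categorical product. -/
def prodIsLimit (X Y : SmoothMan.{u}) : IsLimit (BinaryFan.mk (prodFst X Y) (prodSnd X Y)) :=
  BinaryFan.IsLimit.mk _ (fun f g => prodLift f g) (fun _ _ => rfl) (fun _ _ => rfl)
    (fun f g m hf hg => by subst hf hg; rfl)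

instance : CartesianMonoidalCategory SmoothMan.{u} :=
  CartesianMonoidalCategory.ofChosenFiniteProducts ⟨asEmptyCone point, pointIsTerminal⟩
    (fun X Y => ⟨BinaryFan.mk (prodFst X Y) (prodSnd X Y), prodIsLimit X Y⟩)

section Lie

variable {E M E' M' : Type u} [NormedAddCommGroup E] [NormedSpace ℝ E] [FiniteDimensional ℝ E]
  [TopologicalSpace M] (I : ModelWithCorners ℝ E M) [I.Boundaryless]

/-- A manifold as an object of `SmoothMan`. -/
@[reducible] def of (G : Type u) [TopologicalSpace G] [ChartedSpace M G] [IsManifold I ∞ G]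
    [T2Space G] [SecondCountableTopology G] : SmoothMan.{u} where
  pt := G
  I := I

/-- A Lie group is a group object in smooth manifolds. -/
instance (G : Type u) [TopologicalSpace G] [ChartedSpace M G] [T2Space G]
    [SecondCountableTopology G] [Group G] [LieGroup I ∞ G] : GrpObj (of I G) where
  one := mk' (X := point) (fun _ => (1 : G)) contMDiff_const
  mul := mk' (X := prod (of I G) (of I G)) (fun p => (p.1 * p.2 : G))
    (contMDiff_fst.mul contMDiff_snd)
  inv := mk' (X := of I G) (Y := of I G) (fun g => (g⁻¹ : G)) (contMDiff_id.inv)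
  one_mul := hom_ext fun p => one_mul (p.2 : G)
  mul_one := hom_ext fun p => mul_one (p.1 : G)
  mul_assoc := hom_ext fun p => mul_assoc (p.1.1 : G) p.1.2 p.2
  left_inv := hom_ext fun p => inv_mul_cancel (p : G)
  right_inv := hom_ext fun p => mul_inv_cancel (p : G)

/-- An additive Lie group is an additive group object in smooth manifolds. -/
instance (G : Type u) [TopologicalSpace G] [ChartedSpace M G] [T2Space G]
    [SecondCountableTopology G] [AddGroup G] [LieAddGroup I ∞ G] : AddGrpObj (of I G) where
  zero := mk' (X := point) (fun _ => (0 : G)) contMDiff_const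
  add := mk' (X := prod (of I G) (of I G)) (fun p => (p.1 + p.2 : G))
    (contMDiff_fst.add contMDiff_snd)
  neg := mk' (X := of I G) (Y := of I G) (fun g => (-g : G)) (contMDiff_id.neg)
  zero_add := hom_ext fun p => zero_add (p.2 : G)
  add_zero := hom_ext fun p => add_zero (p.1 : G)
  add_assoc := hom_ext fun p => add_assoc (p.1.1 : G) p.1.2 p.2
  left_neg := hom_ext fun p => neg_add_cancel (p : G)
  right_neg := hom_ext fun p => add_neg_cancel (p : G)

end Lie

end SmoothMan

/-! ## Grassmann algebras and superdomains -/

/-- The Grassmann algebra with `n` generators, the exterior algebra of `ℝⁿ`. -/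
structure GrAlg where
  n : ℕ

namespace GrAlg

/-- The underlying algebra. -/
abbrev alg (A : GrAlg) : Type := ExteriorAlgebra ℝ (Fin A.n → ℝ)

/-- The even part (`j = 0`) or the odd part (`j = 1`) of a Grassmann algebra. -/
abbrev part (A : GrAlg) (j : ZMod 2) : Submodule ℝ A.alg := CliffordAlgebra.evenOdd _ j

/-- Homomorphisms of superalgebras: algebra homomorphisms that respect the grading. -/
@[ext] structure Hom (A B : GrAlg) where
  toAlgHom : A.alg →ₐ[ℝ] B.alg
  map_part : ∀ j, ∀ a ∈ A.part j, toAlgHom a ∈ B.part j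

instance : Category GrAlg where
  Hom := Hom
  id A := ⟨AlgHom.id ℝ A.alg, fun _ _ h => h⟩
  comp f g := ⟨g.toAlgHom.comp f.toAlgHom, fun j a h => g.map_part j _ (f.map_part j a h)⟩

/-- The algebra homomorphism `ε_A : A → ℝ` that kills all generators. -/
def ε (A : GrAlg) : A.alg →ₐ[ℝ] ℝ := ExteriorAlgebra.algebraMapInv

instance (A : GrAlg) : FiniteDimensional ℝ A.alg :=
  Module.Finite.of_basis (Pi.basisFun ℝ (Fin A.n)).ExteriorAlgebra

/-- The type of even or odd elements of a Grassmann algebra. -/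
def Part (A : GrAlg) (j : ZMod 2) : Type := A.part j

instance (A : GrAlg) (j : ZMod 2) : AddCommGroup (A.Part j) :=
  inferInstanceAs (AddCommGroup (A.part j))

instance (A : GrAlg) (j : ZMod 2) : Module ℝ (A.Part j) :=
  inferInstanceAs (Module ℝ (A.part j))

instance (A : GrAlg) (j : ZMod 2) : FiniteDimensional ℝ (A.Part j) :=
  inferInstanceAs (FiniteDimensional ℝ (A.part j))

/-- Some norm; all norms on this finite-dimensional space are equivalent. -/
instance (A : GrAlg) (j : ZMod 2) : NormedAddCommGroup (A.Part j) :=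
  NormedAddCommGroup.induced (A.Part j) (Fin (Module.finrank ℝ (A.Part j)) → ℝ)
    (Module.finBasis ℝ (A.Part j)).equivFun (Module.finBasis ℝ (A.Part j)).equivFun.injective

instance (A : GrAlg) (j : ZMod 2) : NormedSpace ℝ (A.Part j) :=
  NormedSpace.induced ℝ (A.Part j) (Fin (Module.finrank ℝ (A.Part j)) → ℝ)
    (Module.finBasis ℝ (A.Part j)).equivFun.toLinearMap

/-- The product of an even element with an element of parity `j`. -/
def mulPart {A : GrAlg} {j : ZMod 2} (a : A.Part 0) (b : A.Part j) : A.Part j :=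
  ⟨a.1 * b.1, by
    have h := SetLike.mul_mem_graded (A := CliffordAlgebra.evenOdd _) a.2 b.2
    rwa [zero_add] at h⟩

/-- The map induced by a homomorphism of superalgebras on elements of parity `j`. -/
def mapPart {A B : GrAlg} (f : A ⟶ B) {j : ZMod 2} (a : A.Part j) : B.Part j :=
  ⟨Hom.toAlgHom f a.1, Hom.map_part f j a.1 a.2⟩

end GrAlg

/-- The `A`-points `(A ⊗ V)₀ = A₀ ⊗ V₀ ⊕ A₁ ⊗ V₁` of the super vector space `V` with
basis `ι`, where the basis vector `i` has parity `p i`. -/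
abbrev SuperPoint {ι : Type} (p : ι → ZMod 2) (A : GrAlg) : Type := ∀ i, A.Part (p i)

namespace SuperPoint

variable {ι κ τ : Type} {p : ι → ZMod 2} {q : κ → ZMod 2} {r : τ → ZMod 2} {A B : GrAlg}

/-- The action of `A₀` on `A`-points. -/
def evenSMul (a : A.Part 0) (v : SuperPoint p A) : SuperPoint p A :=
  fun i => GrAlg.mulPart a (v i)

/-- The map `V_f` on points induced by a homomorphism `f` of superalgebras. -/
def map (f : A ⟶ B) (v : SuperPoint p A) : SuperPoint p B := fun i => GrAlg.mapPart f (v i)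

/-- The map `V_ε` on points, with values in the even part of `V`. -/
def body (v : SuperPoint p A) : {i // p i = 0} → ℝ := fun i => A.ε (v i.1).1

variable [Fintype ι] [Fintype κ] [Fintype τ]

/-- A map is `A₀`-smooth at `v` if its derivative at `v` is `A₀`-linear. -/
def EvenLinearAt (F : SuperPoint p A → SuperPoint q A) (v : SuperPoint p A) : Prop :=
  ∀ a w, fderiv ℝ F v (evenSMul a w) = evenSMul a (fderiv ℝ F v w)

end SuperPoint

/-! ## Supermanifolds -/

/-- A supermanifold: a functor from Grassmann algebras to manifolds, with an atlas whose charts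
identify it locally with superdomains in a super vector space.  The super vector space has basis
`ι` and parities `parity`.  The chart `c` is the natural isomorphism of an open part of the
functor with the superdomain over the open subset `dom c` of the even part of the super vector
space, whose `A`-points are the points with body in `dom c`. -/
structure SuperMan where
  pts : GrAlg ⥤ SmoothMan.{u}
  ι : Type
  [fin : Fintype ι]
  parity : ι → ZMod 2
  Chart : Type u
  dom : Chart → Set ({i // parity i = 0} → ℝ)
  dom_open : ∀ c, IsOpen (dom c)
  chart : ∀ c A, OpenPartialHomeomorph (pts.obj A).pt (SuperPoint parity A)
  chart_target : ∀ c A, (chart c A).target = SuperPoint.body ⁻¹' dom c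
  chart_smooth : ∀ c A, ContMDiffOn (pts.obj A).I 𝓘(ℝ, SuperPoint parity A) ∞ (chart c A)
    (chart c A).source
  chart_symm_smooth : ∀ c A, ContMDiffOn 𝓘(ℝ, SuperPoint parity A) (pts.obj A).I ∞
    (chart c A).symm (chart c A).target
  chart_natural : ∀ c {A B} (f : A ⟶ B), ∀ v ∈ (chart c A).target,
    SmoothMan.fn (pts.map f) ((chart c A).symm v) = (chart c B).symm (SuperPoint.map f v)
  chart_cover : ∀ A (x : (pts.obj A).pt), ∃ c, x ∈ (chart c A).source
  transition : ∀ c d A, ∀ x ∈ (chart c A).source, x ∈ (chart d A).source →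
    SuperPoint.EvenLinearAt (chart d A ∘ (chart c A).symm) (chart c A x)

namespace SuperMan

attribute [instance] fin

/-- A natural transformation all of whose components have `A₀`-linear derivatives. -/
def IsSmooth {M N : SuperMan.{u}} (φ : M.pts ⟶ N.pts) : Prop :=
  ∀ c d A, ∀ x ∈ (M.chart c A).source, SmoothMan.fn (φ.app A) x ∈ (N.chart d A).source →
    SuperPoint.EvenLinearAt (N.chart d A ∘ SmoothMan.fn (φ.app A) ∘ (M.chart c A).symm)
      (M.chart c A x)

/-- Smooth maps of supermanifolds. -/
@[ext] structure Hom (M N : SuperMan.{u}) where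
  trans : M.pts ⟶ N.pts
  smooth : IsSmooth trans

theorem differentiableAt {M N : SuperMan.{u}} (φ : M.pts ⟶ N.pts) (c d A) (x : (M.pts.obj A).pt)
    (hx : x ∈ (M.chart c A).source) (hy : SmoothMan.fn (φ.app A) x ∈ (N.chart d A).source) :
    DifferentiableAt ℝ (N.chart d A ∘ SmoothMan.fn (φ.app A) ∘ (M.chart c A).symm)
      (M.chart c A x) := by
  have hv := (M.chart c A).map_source hx
  have hb := (M.chart c A).left_inv hx
  have h1 : ContMDiffAt 𝓘(ℝ, SuperPoint M.parity A) (M.pts.obj A).I ∞ (M.chart c A).symm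
      (M.chart c A x) :=
    (M.chart_symm_smooth c A).contMDiffAt ((M.chart c A).open_target.mem_nhds hv)
  have h2 : ContMDiffAt (M.pts.obj A).I (N.pts.obj A).I ∞ (SmoothMan.fn (φ.app A))
      ((M.chart c A).symm (M.chart c A x)) := (SmoothMan.fn_smooth (φ.app A)).contMDiffAt
  have h3 : ContMDiffAt (N.pts.obj A).I 𝓘(ℝ, SuperPoint N.parity A) ∞ (N.chart d A)
      (SmoothMan.fn (φ.app A) ((M.chart c A).symm (M.chart c A x))) := by
    rw [hb]
    exact (N.chart_smooth d A).contMDiffAt ((N.chart d A).open_source.mem_nhds hy)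
  have h : ContMDiffAt 𝓘(ℝ, SuperPoint M.parity A) 𝓘(ℝ, SuperPoint N.parity A) ∞
      (N.chart d A ∘ SmoothMan.fn (φ.app A) ∘ (M.chart c A).symm) (M.chart c A x) :=
    ContMDiffAt.comp (M.chart c A x) h3 (h2.comp (M.chart c A x) h1)
  exact h.contDiffAt.differentiableAt (by simp)

theorem isSmooth_id (M : SuperMan.{u}) : IsSmooth (M := M) (N := M) (𝟙 M.pts) :=
  fun c d A x hx hy => M.transition c d A x hx hy

theorem isSmooth_comp {M N P : SuperMan.{u}} {φ : M.pts ⟶ N.pts} {ψ : N.pts ⟶ P.pts}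
    (hφ : IsSmooth φ) (hψ : IsSmooth ψ) : IsSmooth (M := M) (N := P) (φ ≫ ψ) := by
  intro c e A x hx hz a w
  have hz' : SmoothMan.fn (ψ.app A) (SmoothMan.fn (φ.app A) x) ∈ (P.chart e A).source := hz
  obtain ⟨d, hd⟩ := N.chart_cover A (SmoothMan.fn (φ.app A) x)
  have hb := (M.chart c A).left_inv hx
  set F := N.chart d A ∘ SmoothMan.fn (φ.app A) ∘ (M.chart c A).symm with hF
  set G := P.chart e A ∘ SmoothMan.fn (ψ.app A) ∘ (N.chart d A).symm with hG
  have hFx : F (M.chart c A x) = N.chart d A (SmoothMan.fn (φ.app A) x) := by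
    simp only [hF, Function.comp_apply, hb]
  have hcont : ContinuousAt (fun v => SmoothMan.fn (φ.app A) ((M.chart c A).symm v))
      (M.chart c A x) :=
    (SmoothMan.fn_smooth (φ.app A)).continuous.continuousAt.comp
      ((M.chart c A).continuousAt_symm ((M.chart c A).map_source hx))
  have heq : (P.chart e A ∘ SmoothMan.fn ((φ ≫ ψ).app A) ∘ (M.chart c A).symm)
      =ᶠ[nhds (M.chart c A x)] G ∘ F := by
    have := hcont.preimage_mem_nhds (t := (N.chart d A).source) (by
      simp only [hb]
      exact (N.chart d A).open_source.mem_nhds hd)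
    filter_upwards [this] with v hv
    have hv' := (N.chart d A).left_inv hv
    change _ = P.chart e A (SmoothMan.fn (ψ.app A) ((N.chart d A).symm
      (N.chart d A (SmoothMan.fn (φ.app A) ((M.chart c A).symm v)))))
    rw [hv']
    rfl
  have hdF := differentiableAt φ c d A x hx hd
  have hdG := differentiableAt ψ d e A _ hd hz'
  have hcomp : fderiv ℝ (G ∘ F) (M.chart c A x) =
      (fderiv ℝ G (N.chart d A (SmoothMan.fn (φ.app A) x))).comp (fderiv ℝ F (M.chart c A x)) := by
    rw [← hFx] at hdG ⊢
    exact fderiv_comp _ hdG hdF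
  have h1 := hφ c d A x hx hd a w
  have h2 := hψ d e A _ hd hz' a (fderiv ℝ F (M.chart c A x) w)
  rw [heq.fderiv_eq, hcomp]
  simp only [ContinuousLinearMap.comp_apply]
  rw [h1, h2]

instance : Category SuperMan.{u} where
  Hom := Hom
  id M := ⟨𝟙 M.pts, isSmooth_id M⟩
  comp f g := ⟨f.trans ≫ g.trans, isSmooth_comp f.smooth g.smooth⟩
  id_comp f := Hom.ext (Category.id_comp f.trans)
  comp_id f := Hom.ext (Category.comp_id f.trans)
  assoc f g h := Hom.ext (Category.assoc f.trans g.trans h.trans)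

/-- The component `φ_A` of a smooth map, as a function. -/
def comp {M N : SuperMan.{u}} (φ : M ⟶ N) (A : GrAlg) : (M.pts.obj A).pt → (N.pts.obj A).pt :=
  SmoothMan.fn ((Hom.trans φ).app A)

theorem hom_ext {M N : SuperMan.{u}} {φ ψ : M ⟶ N} (h : ∀ A x, comp φ A x = comp ψ A x) :
    φ = ψ :=
  Hom.ext (NatTrans.ext (funext fun A => SmoothMan.hom_ext (h A)))

/-- The one-point supermanifold. -/
@[reducible] def point : SuperMan.{u} where
  pts := (Functor.const GrAlg).obj SmoothMan.point
  ι := Empty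
  parity := Empty.elim
  Chart := PUnit
  dom _ := Set.univ
  dom_open _ := isOpen_univ
  chart _ A :=
    { toFun := fun _ i => i.elim
      invFun := fun _ => PUnit.unit
      source := Set.univ
      target := Set.univ
      map_source' := fun _ _ => trivial
      map_target' := fun _ _ => trivial
      left_inv' := fun _ _ => rfl
      right_inv' := fun _ _ => funext fun i => i.elim
      open_source := isOpen_univ
      open_target := isOpen_univ
      continuousOn_toFun := continuousOn_const
      continuousOn_invFun := continuousOn_const }
  chart_target _ _ := rfl
  chart_smooth _ _ := contMDiffOn_const
  chart_symm_smooth _ _ := contMDiffOn_const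
  chart_natural _ _ _ _ _ _ := rfl
  chart_cover _ _ := ⟨PUnit.unit, trivial⟩
  transition _ _ _ _ _ _ _ _ := funext fun i => i.elim

section Prod

variable {ι κ τ : Type} [Fintype ι] [Fintype κ] [Fintype τ] {p : ι → ZMod 2} {q : κ → ZMod 2}
  {r : τ → ZMod 2} {A : GrAlg}

/-- The points of a direct sum of super vector spaces. -/
def join (p : ι → ZMod 2) (q : κ → ZMod 2) (A : GrAlg) :
    (SuperPoint p A × SuperPoint q A) ≃L[ℝ] SuperPoint (Sum.elim p q) A where
  toFun v := fun i => match i with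
    | .inl i => v.1 i
    | .inr j => v.2 j
  invFun v := (fun i => v (.inl i), fun j => v (.inr j))
  map_add' _ _ := funext fun i => match i with
    | .inl _ => rfl
    | .inr _ => rfl
  map_smul' _ _ := funext fun i => match i with
    | .inl _ => rfl
    | .inr _ => rfl
  left_inv _ := rfl
  right_inv _ := funext fun i => match i with
    | .inl _ => rfl
    | .inr _ => rfl
  continuous_toFun := continuous_pi fun i => match i with
    | .inl i => (continuous_apply i).comp continuous_fst
    | .inr j => (continuous_apply j).comp continuous_snd
  continuous_invFun := (continuous_pi fun i => continuous_apply (Sum.inl i)).prodMk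
    (continuous_pi fun j => continuous_apply (Sum.inr j))

theorem join_evenSMul (a : A.Part 0) (v : SuperPoint p A) (w : SuperPoint q A) :
    join p q A (SuperPoint.evenSMul a v, SuperPoint.evenSMul a w) =
      SuperPoint.evenSMul a (join p q A (v, w)) :=
  funext fun i => match i with
    | .inl _ => rfl
    | .inr _ => rfl

theorem evenLinearAt_join {F : SuperPoint r A → SuperPoint p A} {G : SuperPoint r A → SuperPoint q A}
    {v : SuperPoint r A} (hF : DifferentiableAt ℝ F v) (hG : DifferentiableAt ℝ G v)
    (eF : SuperPoint.EvenLinearAt F v) (eG : SuperPoint.EvenLinearAt G v) :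
    SuperPoint.EvenLinearAt (fun x => join p q A (F x, G x)) v := by
  intro a w
  have h : HasFDerivAt (fun x => join p q A (F x, G x))
      ((join p q A).toContinuousLinearMap.comp ((fderiv ℝ F v).prod (fderiv ℝ G v))) v :=
    (join p q A).toContinuousLinearMap.hasFDerivAt.comp v (hF.hasFDerivAt.prodMk hG.hasFDerivAt)
  rw [h.fderiv]
  change join p q A (fderiv ℝ F v (SuperPoint.evenSMul a w),
    fderiv ℝ G v (SuperPoint.evenSMul a w)) = _
  rw [eF a w, eG a w, join_evenSMul]
  rfl

theorem evenLinearAt_comp {F : SuperPoint p A → SuperPoint r A}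
    (T : SuperPoint q A →L[ℝ] SuperPoint p A)
    (hT : ∀ a w, T (SuperPoint.evenSMul a w) = SuperPoint.evenSMul a (T w))
    {v : SuperPoint q A} (hF : DifferentiableAt ℝ F (T v))
    (eF : SuperPoint.EvenLinearAt F (T v)) : SuperPoint.EvenLinearAt (F ∘ T) v := by
  intro a w
  have h : HasFDerivAt (F ∘ T) ((fderiv ℝ F (T v)).comp T) v := hF.hasFDerivAt.comp v T.hasFDerivAt
  rw [h.fderiv]
  change fderiv ℝ F (T v) (T (SuperPoint.evenSMul a w)) = _
  rw [hT, eF]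
  rfl

/-- The projection of points of a direct sum to the first summand. -/
def left (p : ι → ZMod 2) (q : κ → ZMod 2) (A : GrAlg) :
    SuperPoint (Sum.elim p q) A →L[ℝ] SuperPoint p A :=
  (ContinuousLinearMap.fst ℝ _ _).comp (join p q A).symm.toContinuousLinearMap

/-- The projection of points of a direct sum to the second summand. -/
def right (p : ι → ZMod 2) (q : κ → ZMod 2) (A : GrAlg) :
    SuperPoint (Sum.elim p q) A →L[ℝ] SuperPoint q A :=
  (ContinuousLinearMap.snd ℝ _ _).comp (join p q A).symm.toContinuousLinearMap

theorem differentiableAt_transition (M : SuperMan.{u}) (c d A) (x : (M.pts.obj A).pt)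
    (hx : x ∈ (M.chart c A).source) (hy : x ∈ (M.chart d A).source) :
    DifferentiableAt ℝ (M.chart d A ∘ (M.chart c A).symm) (M.chart c A x) :=
  differentiableAt (M := M) (N := M) (𝟙 M.pts) c d A x hx hy

/-- The functor `A ↦ M_A × N_A`. -/
@[reducible] def prodPts (M N : SuperMan.{u}) : GrAlg ⥤ SmoothMan.{u} where
  obj A := SmoothMan.prod (M.pts.obj A) (N.pts.obj A)
  map f := SmoothMan.prodLift (SmoothMan.prodFst _ _ ≫ M.pts.map f)
    (SmoothMan.prodSnd _ _ ≫ N.pts.map f)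
  map_id A := by simp only [M.pts.map_id, N.pts.map_id]; rfl
  map_comp f g := by simp only [M.pts.map_comp, N.pts.map_comp]; rfl

/-- The product of two charts. -/
def prodChart (M N : SuperMan.{u}) (c : M.Chart × N.Chart) (A : GrAlg) :
    OpenPartialHomeomorph ((prodPts M N).obj A).pt (SuperPoint (Sum.elim M.parity N.parity) A) :=
  ((M.chart c.1 A).prod (N.chart c.2 A)).transHomeomorph
    (join M.parity N.parity A).toHomeomorph

/-- The product of two supermanifolds. -/
@[reducible] def prod (M N : SuperMan.{u}) : SuperMan.{u} where
  pts := prodPts M N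
  ι := M.ι ⊕ N.ι
  parity := Sum.elim M.parity N.parity
  Chart := M.Chart × N.Chart
  dom c := {v | (fun i : {i // M.parity i = 0} => v ⟨.inl i.1, i.2⟩) ∈ M.dom c.1 ∧
    (fun j : {j // N.parity j = 0} => v ⟨.inr j.1, j.2⟩) ∈ N.dom c.2}
  dom_open c := ((M.dom_open c.1).preimage (continuous_pi fun _ => continuous_apply _)).inter
    ((N.dom_open c.2).preimage (continuous_pi fun _ => continuous_apply _))
  chart c A := prodChart M N c A
  chart_target c A := by
    have h1 := M.chart_target c.1 A
    have h2 := N.chart_target c.2 A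
    ext v
    change (left _ _ A v ∈ (M.chart c.1 A).target ∧ right _ _ A v ∈ (N.chart c.2 A).target) ↔ _
    rw [h1, h2]
    rfl
  chart_smooth c A := contMDiffOn_pi_space.2 fun i => match i with
    | .inl i => (contMDiffOn_pi_space.1 (M.chart_smooth c.1 A) i).comp contMDiff_fst.contMDiffOn
        fun _ h => h.1
    | .inr j => (contMDiffOn_pi_space.1 (N.chart_smooth c.2 A) j).comp contMDiff_snd.contMDiffOn
        fun _ h => h.2
  chart_symm_smooth c A := by
    have h1 := (M.chart_symm_smooth c.1 A).comp
      (left M.parity N.parity A).contMDiff.contMDiffOn fun v (h : v ∈ (prodChart M N c A).target) =>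
        h.1
    have h2 := (N.chart_symm_smooth c.2 A).comp
      (right M.parity N.parity A).contMDiff.contMDiffOn
        fun v (h : v ∈ (prodChart M N c A).target) => h.2
    exact h1.prodMk h2
  chart_natural c {A B} f v hv :=
    Prod.ext (M.chart_natural c.1 f (left _ _ A v) hv.1)
      (N.chart_natural c.2 f (right _ _ A v) hv.2)
  chart_cover A x := by
    obtain ⟨c, hc⟩ := M.chart_cover A x.1
    obtain ⟨d, hd⟩ := N.chart_cover A x.2
    exact ⟨(c, d), hc, hd⟩
  transition c d A x hx hy :=
    have h1 := differentiableAt_transition M c.1 d.1 A x.1 hx.1 hy.1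
    have h2 := differentiableAt_transition N c.2 d.2 A x.2 hx.2 hy.2
    have hL := (left M.parity N.parity A).differentiableAt (x := prodChart M N c A x)
    have hR := (right M.parity N.parity A).differentiableAt (x := prodChart M N c A x)
    evenLinearAt_join
      (F := (M.chart d.1 A ∘ (M.chart c.1 A).symm) ∘ left M.parity N.parity A)
      (G := (N.chart d.2 A ∘ (N.chart c.2 A).symm) ∘ right M.parity N.parity A)
      (DifferentiableAt.comp (prodChart M N c A x) h1 hL)
      (DifferentiableAt.comp (prodChart M N c A x) h2 hR)
      (evenLinearAt_comp (v := prodChart M N c A x) (left M.parity N.parity A) (fun _ _ => rfl)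
        h1 (M.transition c.1 d.1 A x.1 hx.1 hy.1))
      (evenLinearAt_comp (v := prodChart M N c A x) (right M.parity N.parity A) (fun _ _ => rfl)
        h2 (N.transition c.2 d.2 A x.2 hx.2 hy.2))

/-- The first projection. -/
def prodFst (M N : SuperMan.{u}) : prod M N ⟶ M where
  trans := { app := fun A => SmoothMan.prodFst (M.pts.obj A) (N.pts.obj A) }
  smooth c d A x hx hy :=
    evenLinearAt_comp (v := prodChart M N c A x) (left M.parity N.parity A) (fun _ _ => rfl)
      (differentiableAt_transition M c.1 d A x.1 hx.1 hy) (M.transition c.1 d A x.1 hx.1 hy)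

/-- The second projection. -/
def prodSnd (M N : SuperMan.{u}) : prod M N ⟶ N where
  trans := { app := fun A => SmoothMan.prodSnd (M.pts.obj A) (N.pts.obj A) }
  smooth c d A x hx hy :=
    evenLinearAt_comp (v := prodChart M N c A x) (right M.parity N.parity A) (fun _ _ => rfl)
      (differentiableAt_transition N c.2 d A x.2 hx.2 hy) (N.transition c.2 d A x.2 hx.2 hy)

/-- The pairing of two smooth maps. -/
def prodLift {M N P : SuperMan.{u}} (f : P ⟶ M) (g : P ⟶ N) : P ⟶ prod M N where
  trans :=
    { app := fun A => SmoothMan.prodLift ((Hom.trans f).app A) ((Hom.trans g).app A)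
      naturality := fun A B h => SmoothMan.hom_ext fun x => Prod.ext
        (congrArg (fun k => SmoothMan.fn k x) ((Hom.trans f).naturality h))
        (congrArg (fun k => SmoothMan.fn k x) ((Hom.trans g).naturality h)) }
  smooth c d A x hx hy :=
    evenLinearAt_join (differentiableAt (Hom.trans f) c d.1 A x hx hy.1)
      (differentiableAt (Hom.trans g) c d.2 A x hx hy.2)
      (Hom.smooth f c d.1 A x hx hy.1) (Hom.smooth g c d.2 A x hx hy.2)

end Prod

/-- The one-point supermanifold is terminal. -/
def pointIsTerminal : IsTerminal point.{u} :=
  IsTerminal.ofUniqueHom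
    (fun M =>
      { trans := { app := fun A => SmoothMan.mk' (fun _ => PUnit.unit) contMDiff_const }
        smooth := fun _ _ _ _ _ _ _ _ => funext fun i => i.elim })
    (fun _ _ => hom_ext fun _ _ => rfl)

/-- The product is a categorical product. -/
def prodIsLimit (M N : SuperMan.{u}) : IsLimit (BinaryFan.mk (prodFst M N) (prodSnd M N)) :=
  BinaryFan.IsLimit.mk _ (fun f g => prodLift f g) (fun _ _ => rfl) (fun _ _ => rfl)
    (fun f g m hf hg => by subst hf hg; rfl)

instance : CartesianMonoidalCategory SuperMan.{u} :=
  CartesianMonoidalCategory.ofChosenFiniteProducts ⟨asEmptyCone point, pointIsTerminal⟩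
    (fun M N => ⟨BinaryFan.mk (prodFst M N) (prodSnd M N), prodIsLimit M N⟩)

end SuperMan

/-! ## Cochains -/

namespace Cochain

variable {G H : Type*} {p : ℕ}

/-- `act` is an action of the group `G` on the abelian group `H` by automorphisms. -/
structure IsActionByAut [Group G] [AddCommGroup H] (act : G → H → H) : Prop where
  one : ∀ h, act 1 h = h
  mul : ∀ g g' h, act (g * g') h = act g (act g' h)
  add : ∀ g h h', act g (h + h') = act g h + act g h'

/-- The coboundary of a cochain, `d f (g₁, …, gₚ₊₁) = g₁ f (g₂, …, gₚ₊₁) +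
∑ᵢ (-1)ⁱ f (g₁, …, gᵢ gᵢ₊₁, …, gₚ₊₁) + (-1)ᵖ⁺¹ f (g₁, …, gₚ)`. -/
def coboundary [Group G] [AddCommGroup H] (act : G → H → H) (f : (Fin p → G) → H)
    (g : Fin (p + 1) → G) : H :=
  act (g 0) (f fun i => g i.succ) +
    ∑ i : Fin p, (-1 : ℤ) ^ ((i : ℕ) + 1) • f (Fin.contractNth i.castSucc (· * ·) g) +
    (-1 : ℤ) ^ (p + 1) • f fun i => g i.castSucc

/-- A cochain is a cocycle if its coboundary vanishes. -/
def IsCocycle [Group G] [AddCommGroup H] (act : G → H → H) (f : (Fin p → G) → H) : Prop :=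
  ∀ g, coboundary act f g = 0

/-- A cochain is normalized if it vanishes when any of its entries is `1`. -/
def IsNormalized [Group G] [AddCommGroup H] (f : (Fin p → G) → H) : Prop :=
  ∀ g, (∃ i, g i = 1) → f g = 0

/-- A function on `G × (G × (G × G))` as a 4-cochain. -/
def ofProd (π : G × G × G × G → H) (g : Fin 4 → G) : H := π (g 0, g 1, g 2, g 3)

end Cochain

/-! ## Lie groups -/

section Lie

variable {E F M N G H : Type u} [NormedAddCommGroup E] [NormedSpace ℝ E] [FiniteDimensional ℝ E]
  [TopologicalSpace M] (I : ModelWithCorners ℝ E M) [I.Boundaryless]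
  [NormedAddCommGroup F] [NormedSpace ℝ F] [FiniteDimensional ℝ F]
  [TopologicalSpace N] (J : ModelWithCorners ℝ F N) [J.Boundaryless]
  [TopologicalSpace G] [ChartedSpace M G] [T2Space G] [SecondCountableTopology G]
  [Group G] [LieGroup I ∞ G]
  [TopologicalSpace H] [ChartedSpace N H] [T2Space H] [SecondCountableTopology H]
  [AddCommGroup H] [LieAddGroup J ∞ H]

/-- The data of `Brane_π(G, H)` in smooth manifolds, for a Lie group `G` that acts smoothly on an
abelian Lie group `H` and a smooth `π : G⁴ → H`. -/
def lieBrane [DistribMulAction G H] [ContMDiffSMul I J ∞ G H] (π : G × G × G × G → H)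
    (hπ : ContMDiff (I.prod (I.prod (I.prod I))) J ∞ π) : InternalTricatData SmoothMan.{u} :=
  brane (G := SmoothMan.of I G) (H := SmoothMan.of J H)
    (SmoothMan.mk' (X := SmoothMan.prod (SmoothMan.of I G) (SmoothMan.of J H))
      (fun p => (p.1 • p.2 : H)) (ContMDiffSMul.contMDiff_smul (I := I) (I' := J)))
    (SmoothMan.mk' (X := SmoothMan.prod (SmoothMan.of I G) (SmoothMan.prod (SmoothMan.of I G)
      (SmoothMan.prod (SmoothMan.of I G) (SmoothMan.of I G)))) π hπ)

end Lie

/-! ## Supergroups -/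

namespace SuperMan

instance : BraidedCategory SuperMan.{u} := .ofCartesianMonoidalCategory

/-- The component at `A` of a smooth map `M × N ⟶ P`, as a function of two variables. -/
def comp₂ {M N P : SuperMan.{u}} (φ : M ⊗ N ⟶ P) (A : GrAlg) (x : (M.pts.obj A).pt)
    (y : (N.pts.obj A).pt) : (P.pts.obj A).pt :=
  comp (M := prod M N) φ A (x, y)

/-- The component at `A` of a smooth map `M⁴ ⟶ P`. -/
def comp₄ {M P : SuperMan.{u}} (φ : M ⊗ (M ⊗ (M ⊗ M)) ⟶ P) (A : GrAlg)
    (x : (M.pts.obj A).pt × (M.pts.obj A).pt × (M.pts.obj A).pt × (M.pts.obj A).pt) :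
    (P.pts.obj A).pt :=
  comp (M := prod M (prod M (prod M M))) φ A x

/-- The `A`-points of a supergroup form a group. -/
instance (G : SuperMan.{u}) [GrpObj G] (A : GrAlg) : Group (G.pts.obj A).pt where
  mul := comp₂ (MonObj.mul (X := G)) A
  one := comp (M := point) (MonObj.one (X := G)) A PUnit.unit
  inv := comp (GrpObj.inv (X := G)) A
  mul_assoc x y z := congrArg (fun f => comp (M := prod (prod G G) G) (N := G) f A ((x, y), z))
    (MonObj.mul_assoc G)
  one_mul x := congrArg (fun f => comp (M := prod point G) (N := G) f A (PUnit.unit, x))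
    (MonObj.one_mul G)
  mul_one x := congrArg (fun f => comp (M := prod G point) (N := G) f A (x, PUnit.unit))
    (MonObj.mul_one G)
  inv_mul_cancel x := congrArg (fun f => comp (M := G) (N := G) f A x) (GrpObj.left_inv G)

instance (H : SuperMan.{u}) [AddGrpObj H] (A : GrAlg) : Zero (H.pts.obj A).pt :=
  ⟨comp (M := point) (AddMonObj.zero (X := H)) A PUnit.unit⟩

instance (H : SuperMan.{u}) [AddGrpObj H] (A : GrAlg) : Add (H.pts.obj A).pt :=
  ⟨comp₂ (AddMonObj.add (X := H)) A⟩

instance (H : SuperMan.{u}) [AddGrpObj H] (A : GrAlg) : Neg (H.pts.obj A).pt :=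
  ⟨comp (AddGrpObj.neg (X := H)) A⟩

/-- The `A`-points of a supergroup, written additively, form a group. -/
instance (H : SuperMan.{u}) [AddGrpObj H] (A : GrAlg) : AddGroup (H.pts.obj A).pt where
  nsmul := nsmulRec
  zsmul := zsmulRec
  add_assoc x y z := congrArg (fun f => comp (M := prod (prod H H) H) (N := H) f A ((x, y), z))
    (AddMonObj.add_assoc H)
  zero_add x := congrArg (fun f => comp (M := prod point H) (N := H) f A (PUnit.unit, x))
    (AddMonObj.zero_add H)
  add_zero x := congrArg (fun f => comp (M := prod H point) (N := H) f A (x, PUnit.unit))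
    (AddMonObj.add_zero H)
  neg_add_cancel x := congrArg (fun f => comp (M := H) (N := H) f A x) (AddGrpObj.left_neg H)

/-- The `A`-points of an abelian supergroup form an abelian group. -/
instance (H : SuperMan.{u}) [AddGrpObj H] [IsCommAddMonObj H] (A : GrAlg) :
    AddCommGroup (H.pts.obj A).pt where
  add_comm x y := (congrArg (fun f => comp (M := prod H H) (N := H) f A (y, x))
    (IsCommAddMonObj.add_comm H))

/-- A smooth map `G × H ⟶ H` is an action of the supergroup `G` on the abelian supergroup `H` by
automorphisms, if it is one on `A`-points for all `A`. -/
def IsActionByAut {G H : SuperMan.{u}} [GrpObj G] [AddGrpObj H] [IsCommAddMonObj H]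
    (act : G ⊗ H ⟶ H) : Prop :=
  ∀ A, Cochain.IsActionByAut (comp₂ act A)

/-- A smooth map `G⁴ ⟶ H` is a cocycle if it is one on `A`-points for all `A`. -/
def IsCocycle {G H : SuperMan.{u}} [GrpObj G] [AddGrpObj H] [IsCommAddMonObj H]
    (act : G ⊗ H ⟶ H) (π : G ⊗ (G ⊗ (G ⊗ G)) ⟶ H) : Prop :=
  ∀ A, Cochain.IsCocycle (comp₂ act A) (Cochain.ofProd (comp₄ π A))

/-- A smooth map `G⁴ ⟶ H` is normalized if it is so on `A`-points for all `A`. -/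
def IsNormalized {G H : SuperMan.{u}} [GrpObj G] [AddGrpObj H] [IsCommAddMonObj H]
    (π : G ⊗ (G ⊗ (G ⊗ G)) ⟶ H) : Prop :=
  ∀ A, Cochain.IsNormalized (Cochain.ofProd (comp₄ π A))

end SuperMan

end

/-! The argument takes place in an arbitrary category `K` with chosen finite products and is
specialised to manifolds and supermanifolds only at the end. On `X`-points `G` is a group acting by
automorphisms on the abelian group of points of `H`, and `π` is a 4-cochain. All 2-morphisms are
identities, so a 3-morphism with given source and target is nothing but a point of `H` (`hom₂_ext`),
and every tricategory axiom becomes one equation between points of `H`.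

In these terms composition at a 1-cell or a 2-cell is addition, whiskering at a 1-cell changes
nothing, and only composition at a 0-cell involves the action: the left factor acts on the component
of the right one. All constraints except the pentagonator and its inverse have component zero.
Interchange is then commutativity of `H`, functoriality of composition at a 0-cell is additivity of
the action, and naturality of associator and unitors is associativity and unitality of the
semidirect product.

The associahedron has six pentagons and three squares. The squares contribute zero, and the
pentagons contribute the six terms of `dπ`, three on each half (`k5_iff`); this gives the
equivalence with the cocycle condition. In the two normalization axioms the only cell that is not
trivial at once is the pentagonator with a neutral second or third entry, which a normalized cochain
kills.

By the Yoneda lemma, smoothness of the operations is naturality in `X`, which holds because they are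
all built from multiplication, addition, action and `π` (`isNatural_brane`). The required fibre
products exist because they can be written as products (`hasComposables_brane`). -/

namespace Brane

variable {K : Type*} [Category.{u} K] [CartesianMonoidalCategory K] {G H : K}

/-! ### 3-morphisms and their `H`-components -/

section Cells

variable [GrpObj G] [AddGrpObj H] {X : K} {x y : X ⟶ 𝟙_ K}
  {f g : (((globular G H).points X).cells x y).Ob}

theorem val₃_mk₃ (α β : (((globular G H).points X).cells x y).Hom f g) (h : X ⟶ H) :
    val₃ (mk₃ α β h) = h := lift_snd _ _

-- The `G`-component is forced by the source 2-morphism, so only the `H`-component can differ. This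
-- turns each axiom into an equation between points of `H`.
omit [GrpObj G] [AddGrpObj H] in
theorem hom₂_ext {α β : (((globular G H).points X).cells x y).Hom f g}
    {Γ Δ : (((globular G H).points X).cells x y).Hom₂ α β} (h : val₃ Γ = val₃ Δ) : Γ = Δ :=
  Subtype.ext (CartesianMonoidalCategory.hom_ext _ _ (Γ.2.1.trans Δ.2.1.symm) h)

end Cells

/-! ### Group laws and action on points -/

section Points

variable [GrpObj G] [AddGrpObj H] {X : K}

/-- The laws of this section come from the group structure on the morphisms into a group object,
whose operations unfold to `add`, `zero`, `mul` and `one`. -/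
theorem zero_add' (h : X ⟶ H) : add (zero H X) h = h :=
  let := Hom.addGroup (G := H) (X := X)
  _root_.zero_add h

theorem add_zero' (h : X ⟶ H) : add h (zero H X) = h :=
  let := Hom.addGroup (G := H) (X := X)
  _root_.add_zero h

theorem add_assoc' (h h' h'' : X ⟶ H) : add (add h h') h'' = add h (add h' h'') :=
  let := Hom.addGroup (G := H) (X := X)
  _root_.add_assoc h h' h''

theorem add_neg' (h : X ⟶ H) : add h (h ≫ AddGrpObj.neg) = zero H X :=
  let := Hom.addGroup (G := H) (X := X)
  _root_.add_neg_cancel h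

theorem neg_add' (h : X ⟶ H) : add (h ≫ AddGrpObj.neg) h = zero H X :=
  let := Hom.addGroup (G := H) (X := X)
  _root_.neg_add_cancel h

theorem mul_inv' (g : X ⟶ G) : mul g (g ≫ GrpObj.inv) = one G X :=
  let := Hom.group (G := G) (X := X)
  _root_.mul_inv_cancel g

theorem inv_mul' (g : X ⟶ G) : mul (g ≫ GrpObj.inv) g = one G X :=
  let := Hom.group (G := G) (X := X)
  _root_.inv_mul_cancel g

/-- The points of `H` form an abelian group, on which the points of `G` act by automorphisms. -/
structure IsActionByAut (act : G ⊗ H ⟶ H) : Prop where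
  add_comm : ∀ {X : K} (h h' : X ⟶ H), add h h' = add h' h
  one_smul : ∀ {X : K} (h : X ⟶ H), smul act (one G X) h = h
  mul_smul : ∀ {X : K} (g g' : X ⟶ G) (h : X ⟶ H),
    smul act (mul g g') h = smul act g (smul act g' h)
  smul_add : ∀ {X : K} (g : X ⟶ G) (h h' : X ⟶ H),
    smul act g (add h h') = add (smul act g h) (smul act g h')

variable {act : G ⊗ H ⟶ H}

/-- From `0 + 0 = 0` one gets `g 0 = g 0 + g 0`, and cancellation in the group of points finishes.
-/
theorem IsActionByAut.smul_zero (ha : IsActionByAut act) (g : X ⟶ G) :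
    smul act g (zero H X) = zero H X := by
  let := Hom.addGroup (G := H) (X := X)
  have h := ha.smul_add g (zero H X) (zero H X)
  rw [zero_add'] at h
  exact left_eq_add.1 h

/-- Once sums are bracketed to the right, this is the form in which interchange laws need
commutativity. -/
theorem IsActionByAut.add_left_comm (ha : IsActionByAut act) (h h' h'' : X ⟶ H) :
    add h (add h' h'') = add h' (add h h'') := by
  rw [← add_assoc', ha.add_comm h, add_assoc']

end Points

/-! ### Cochains on points and the bicategories of morphisms -/

variable [GrpObj G] [AddGrpObj H] {act : G ⊗ H ⟶ H} {π : G ⊗ (G ⊗ (G ⊗ G)) ⟶ H}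

/-- The value of `π` at a quadruple of points. -/
def cochain (π : G ⊗ (G ⊗ (G ⊗ G)) ⟶ H) {X : K} (g₁ g₂ g₃ g₄ : X ⟶ G) : X ⟶ H :=
  lift g₁ (lift g₂ (lift g₃ g₄)) ≫ π

/-- The cocycle equation on points, without subtractions. -/
def IsCocycle (act : G ⊗ H ⟶ H) (π : G ⊗ (G ⊗ (G ⊗ G)) ⟶ H) : Prop :=
  ∀ (X : K) (f g h k p : X ⟶ G),
    add (cochain π f g h k) (add (cochain π f g (mul h k) p) (cochain π (mul f g) h k p)) =
      add (smul act f (cochain π g h k p))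
        (add (cochain π f (mul g h) k p) (cochain π f g h (mul k p)))

/-- With all constraints zero, every axiom but interchange follows from associativity and the unit
laws of addition. Interchange reads `(a + b) + (c + d) = (a + c) + (b + d)`, the Eckmann–Hilton
reason why `H` has to be abelian. -/
theorem isBicategory_homData (ha : IsActionByAut act) (X : K) (x y : X ⟶ 𝟙_ K) :
    (homData (G := G) (H := H) X x y).IsBicategory := by
  constructor
  all_goals intros
  -- An `Inverse` goal consists of two equations of 3-morphisms; the other goals are single
  -- equations.
  all_goals first | refine ⟨hom₂_ext ?_, hom₂_ext ?_⟩ | apply hom₂_ext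
  all_goals simp only [BicatData.wl, BicatData.wr, val₃_mk₃, zero_add', add_zero', add_assoc']
  -- Only `hcomp_vcomp` is left.
  exact congrArg _ (ha.add_left_comm _ _ _)

end Brane

/-! ### Composition at a 0-cell and trivial constraints -/

namespace Brane

variable {K : Type*} [Category.{u} K] [CartesianMonoidalCategory K] {G H : K}
variable [GrpObj G] [AddGrpObj H] {act : G ⊗ H ⟶ H} {π : G ⊗ (G ⊗ (G ⊗ G)) ⟶ H}

section

variable {X : K} {x y : X ⟶ 𝟙_ K}

/-- The point of `G` underlying a morphism. -/
def pt (f : (((globular G H).points X).cells x y).Ob) : X ⟶ G := f.1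

/-- A 2-morphism is the identity of its source, so the acting point can be read off the source. As a
rewriting rule this brings acting points to a common form. -/
theorem smul_hom_val {f g : (((globular G H).points X).cells x y).Ob}
    (α : (((globular G H).points X).cells x y).Hom f g) (h : X ⟶ H) :
    smul act α.1 h = smul act (pt f) h := congrArg (smul act · h) (hom_val α)

theorem pt_eq {f g : (((globular G H).points X).cells x y).Ob}
    (α : (((globular G H).points X).cells x y).Hom f g) : pt f = pt g := eq_of_hom α

end

/-- Compatibility of `h + g h'` with vertical and horizontal composition is additivity of the action
together with commutativity. In the remaining axioms both sides are zero. -/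
theorem isPseudofunctor_tensor (ha : IsActionByAut act) (X : K) (x y z : X ⟶ 𝟙_ K) :
    ((base (G := G) (H := H) act X).tensor x y z).IsPseudofunctor := by
  constructor
  case map₂_vcomp | mapComp_natural =>
    intros
    apply hom₂_ext
    rename_i f' g g' _ _
    simp only [val₃_mk₃, zero_add', add_zero', add_assoc', ha.smul_add, smul_hom_val]
    -- In `mapComp_natural` the action is by the sources of two consecutive 2-morphisms. These are
    -- the same point, because 2-morphisms join only equal morphisms.
    rw [pt_eq f'.1]
    exact congrArg _ (ha.add_left_comm _ _ _)
  all_goals intros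
  all_goals first | refine ⟨hom₂_ext ?_, hom₂_ext ?_⟩ | apply hom₂_ext
  all_goals simp only [BicatData.wl, BicatData.wr, val₃_mk₃, zero_add',
    ha.smul_zero, smul_hom_val]

/-- A pseudofunctor with trivial constraints. -/
structure IsStrict {C : Cells.{u}} {B : BicatData C} {X : K} {x y : X ⟶ 𝟙_ K}
    (F : PseudoData B (homData (G := G) (H := H) X x y)) : Prop where
  mapComp : ∀ {b c d} (f : C.Hom b c) (g : C.Hom c d), val₃ (F.mapComp f g) = zero H X
  mapId : ∀ b, val₃ (F.mapId b) = zero H X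

/-- With all constraint cells zero, the only equation with content is naturality in 3-morphisms, and
this is `h`. The lemma serves for the associator and both unitors. -/
theorem isAdjEquiv_trivialEquiv {C : Cells.{u}} {B : BicatData C} {X : K} {x y : X ⟶ 𝟙_ K}
    {F F' : PseudoData B (homData (G := G) (H := H) X x y)} (hF : IsStrict F) (hF' : IsStrict F')
    (e : ∀ b, (F.obj b).1 = (F'.obj b).1)
    (h : ∀ {b c} {f g : C.Hom b c} (Γ : C.Hom₂ f g), val₃ (F.map₂ Γ) = val₃ (F'.map₂ Γ)) :
    (trivialEquiv X F.toMapData F'.toMapData e).IsAdjEquiv (F := F) (G := F') := by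
  constructor
  case hom | inv =>
    constructor
    all_goals intros
    all_goals first | refine ⟨hom₂_ext ?_, hom₂_ext ?_⟩ | apply hom₂_ext
    all_goals simp only [BicatData.wl, BicatData.wr, val₃_mk₃, zero_add', add_zero', hF.mapComp,
      hF.mapId, hF'.mapComp, hF'.mapId, h]
  case unit | counit =>
    refine ⟨fun _ => ⟨hom₂_ext ?_, hom₂_ext ?_⟩, fun _ => hom₂_ext ?_⟩
    all_goals simp only [BicatData.wl, BicatData.wr, TransData.id, TransData.comp,
      BicatData.sqComp, val₃_mk₃, zero_add']
  all_goals
    intros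
    apply hom₂_ext
    simp only [BicatData.wl, BicatData.wr, val₃_mk₃, zero_add']

/-- The naturality cells drop out of the modification equation. What is left is that the component
agrees at both ends of a morphism, which is `hm`. -/
theorem isModIso_of_trivial {C : Cells.{u}} {X : K} {x y : X ⟶ 𝟙_ K}
    {F F' : MapData C (((globular G H).points X).cells x y)}
    {θ φ : TransData (homData (G := G) (H := H) X x y) F F'}
    {m : ∀ b, (((globular G H).points X).cells x y).Hom₂ (θ.app b) (φ.app b)}
    {m' : ∀ b, (((globular G H).points X).cells x y).Hom₂ (φ.app b) (θ.app b)}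
    (hθ : ∀ {b c} (f : C.Hom b c), val₃ (θ.nat f) = zero H X)
    (hφ : ∀ {b c} (f : C.Hom b c), val₃ (φ.nat f) = zero H X)
    (h : ∀ b, add (val₃ (m b)) (val₃ (m' b)) = zero H X)
    (h' : ∀ b, add (val₃ (m' b)) (val₃ (m b)) = zero H X)
    (hm : ∀ {b c} (_ : C.Hom b c), val₃ (m b) = val₃ (m c)) :
    TransData.IsModIso θ φ m m' := by
  refine ⟨fun b => ⟨hom₂_ext ?_, hom₂_ext ?_⟩, fun {b c} f => hom₂_ext ?_⟩
  · simp only [val₃_mk₃, h]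
  · simp only [val₃_mk₃, h']
  · simp only [BicatData.wl, BicatData.wr, val₃_mk₃, zero_add', add_zero', hθ, hφ, hm f]

/-! ### `H`-components of the operations of the tricategory -/

section Vals

variable {X : K} {x y z w v : X ⟶ 𝟙_ K}

theorem val₃_vcomp {f g : (((globular G H).points X).cells x y).Ob}
    {α β γ : (((globular G H).points X).cells x y).Hom f g}
    (Γ : (((globular G H).points X).cells x y).Hom₂ α β)
    (Δ : (((globular G H).points X).cells x y).Hom₂ β γ) :
    val₃ ((ops act π X).v₃ Γ Δ) = add (val₃ Γ) (val₃ Δ) := val₃_mk₃ _ _ _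

/-- Composition at a 1-cell adds without acting, and an identity 3-morphism has component zero. -/
theorem val₃_wl {f g h : (((globular G H).points X).cells x y).Ob}
    (α : (((globular G H).points X).cells x y).Hom f g)
    {β γ : (((globular G H).points X).cells x y).Hom g h}
    (Γ : (((globular G H).points X).cells x y).Hom₂ β γ) :
    val₃ ((ops act π X).wl α Γ) = val₃ Γ :=
  (val₃_mk₃ _ _ _).trans ((congrArg (add · (val₃ Γ)) (val₃_mk₃ _ _ _)).trans (zero_add' _))

theorem val₃_wr {f g h : (((globular G H).points X).cells x y).Ob}
    {β γ : (((globular G H).points X).cells x y).Hom f g}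
    (Γ : (((globular G H).points X).cells x y).Hom₂ β γ)
    (α : (((globular G H).points X).cells x y).Hom g h) :
    val₃ ((ops act π X).wr Γ α) = val₃ Γ :=
  (val₃_mk₃ _ _ _).trans ((congrArg (add (val₃ Γ)) (val₃_mk₃ _ _ _)).trans (add_zero' _))

theorem val₃_as {f g h k : (((globular G H).points X).cells x y).Ob}
    (α : (((globular G H).points X).cells x y).Hom f g)
    (β : (((globular G H).points X).cells x y).Hom g h)
    (γ : (((globular G H).points X).cells x y).Hom h k) :
    val₃ ((ops act π X).as α β γ) = zero H X := val₃_mk₃ _ _ _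

theorem val₃_asInv {f g h k : (((globular G H).points X).cells x y).Ob}
    (α : (((globular G H).points X).cells x y).Hom f g)
    (β : (((globular G H).points X).cells x y).Hom g h)
    (γ : (((globular G H).points X).cells x y).Hom h k) :
    val₃ ((ops act π X).asInv α β γ) = zero H X := val₃_mk₃ _ _ _

theorem val₃_id {f g : (((globular G H).points X).cells x y).Ob}
    (α : (((globular G H).points X).cells x y).Hom f g) :
    val₃ ((ops act π X).id₃ α) = zero H X := val₃_mk₃ _ _ _

/-- Composition at a 0-cell is the only operation in which the action enters. It produces the
leading term `g₁ π(g₂, …, g₅)` of the coboundary. -/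
theorem val₃_c₃ {f f' : (((globular G H).points X).cells x y).Ob}
    {g g' : (((globular G H).points X).cells y z).Ob}
    {α β : (((globular G H).points X).cells x y).Hom f f'}
    {γ δ : (((globular G H).points X).cells y z).Hom g g'}
    (Γ : (((globular G H).points X).cells x y).Hom₂ α β)
    (Δ : (((globular G H).points X).cells y z).Hom₂ γ δ) :
    val₃ ((ops act π X).c₃ Γ Δ) = add (val₃ Γ) (smul act (pt f) (val₃ Δ)) := by
  refine (val₃_mk₃ _ _ _).trans ?_
  rw [smul_hom_val]

theorem val₃_χ {f f' f'' : (((globular G H).points X).cells x y).Ob}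
    {g g' g'' : (((globular G H).points X).cells y z).Ob}
    (α : (((globular G H).points X).cells x y).Hom f f')
    (α' : (((globular G H).points X).cells x y).Hom f' f'')
    (β : (((globular G H).points X).cells y z).Hom g g')
    (β' : (((globular G H).points X).cells y z).Hom g' g'') :
    val₃ ((ops act π X).χ α α' β β') = zero H X := val₃_mk₃ _ _ _

theorem val₃_χInv {f f' f'' : (((globular G H).points X).cells x y).Ob}
    {g g' g'' : (((globular G H).points X).cells y z).Ob}
    (α : (((globular G H).points X).cells x y).Hom f f')
    (α' : (((globular G H).points X).cells x y).Hom f' f'')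
    (β : (((globular G H).points X).cells y z).Hom g g')
    (β' : (((globular G H).points X).cells y z).Hom g' g'') :
    val₃ ((ops act π X).χInv α α' β β') = zero H X := val₃_mk₃ _ _ _

theorem val₃_i (f : (((globular G H).points X).cells x y).Ob)
    (g : (((globular G H).points X).cells y z).Ob) :
    val₃ ((ops act π X).i f g) = zero H X := val₃_mk₃ _ _ _

theorem val₃_iInv (f : (((globular G H).points X).cells x y).Ob)
    (g : (((globular G H).points X).cells y z).Ob) :
    val₃ ((ops act π X).iInv f g) = zero H X := val₃_mk₃ _ _ _

theorem val₃_lun {f g : (((globular G H).points X).cells x y).Ob}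
    (α : (((globular G H).points X).cells x y).Hom f g) :
    val₃ (((ops act π X).hom x y).lun α) = zero H X := val₃_mk₃ _ _ _

theorem val₃_lunInv {f g : (((globular G H).points X).cells x y).Ob}
    (α : (((globular G H).points X).cells x y).Hom f g) :
    val₃ (((ops act π X).hom x y).lunInv α) = zero H X := val₃_mk₃ _ _ _

theorem val₃_run {f g : (((globular G H).points X).cells x y).Ob}
    (α : (((globular G H).points X).cells x y).Hom f g) :
    val₃ (((ops act π X).hom x y).run α) = zero H X := val₃_mk₃ _ _ _

theorem val₃_aNat {f f' : (((globular G H).points X).cells x y).Ob}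
    {g g' : (((globular G H).points X).cells y z).Ob}
    {h h' : (((globular G H).points X).cells z w).Ob}
    (α : (((globular G H).points X).cells x y).Hom f f')
    (β : (((globular G H).points X).cells y z).Hom g g')
    (γ : (((globular G H).points X).cells z w).Hom h h') :
    val₃ ((ops act π X).aNat α β γ) = zero H X := val₃_mk₃ _ _ _

theorem val₃_aNatInv {f f' : (((globular G H).points X).cells x y).Ob}
    {g g' : (((globular G H).points X).cells y z).Ob}
    {h h' : (((globular G H).points X).cells z w).Ob}
    (α : (((globular G H).points X).cells x y).Hom f f')
    (β : (((globular G H).points X).cells y z).Hom g g')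
    (γ : (((globular G H).points X).cells z w).Hom h h') :
    val₃ ((ops act π X).aNatInv α β γ) = zero H X := val₃_mk₃ _ _ _

theorem val₃_pent (f : (((globular G H).points X).cells x y).Ob)
    (g : (((globular G H).points X).cells y z).Ob) (h : (((globular G H).points X).cells z w).Ob)
    (k : (((globular G H).points X).cells w v).Ob) :
    val₃ ((ops act π X).pent f g h k) = cochain π (pt f) (pt g) (pt h) (pt k) := val₃_mk₃ _ _ _

theorem pt_c₁ (f : (((globular G H).points X).cells x y).Ob)
    (g : (((globular G H).points X).cells y z).Ob) :
    pt ((ops act π X).c₁ f g) = mul (pt f) (pt g) := rfl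

/-- Rebracketing has component zero, so a face of the associahedron keeps its component when it is
placed inside a longer composite. The same holds for `on₃`. -/
theorem val₃_on₂ {f g g' h k : (((globular G H).points X).cells x y).Ob}
    {α : (((globular G H).points X).cells x y).Hom f g}
    {β : (((globular G H).points X).cells x y).Hom g h}
    {γ : (((globular G H).points X).cells x y).Hom f g'}
    {δ : (((globular G H).points X).cells x y).Hom g' h}
    (Γ : (((globular G H).points X).cells x y).Hom₂ ((ops act π X).k₂ α β)
      ((ops act π X).k₂ γ δ)) (ε : (((globular G H).points X).cells x y).Hom h k) :
    val₃ ((ops act π X).on₂ Γ ε) = val₃ Γ := by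
  simp only [TricatData.on₂, val₃_vcomp, val₃_wr, val₃_as, val₃_asInv, zero_add', add_zero']

theorem val₃_on₃ {f g g₁ g' h k : (((globular G H).points X).cells x y).Ob}
    {α : (((globular G H).points X).cells x y).Hom f g}
    {β : (((globular G H).points X).cells x y).Hom g g₁}
    {β' : (((globular G H).points X).cells x y).Hom g₁ h}
    {γ : (((globular G H).points X).cells x y).Hom f g'}
    {δ : (((globular G H).points X).cells x y).Hom g' h}
    (Γ : (((globular G H).points X).cells x y).Hom₂
      ((ops act π X).k₂ α ((ops act π X).k₂ β β')) ((ops act π X).k₂ γ δ))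
    (ε : (((globular G H).points X).cells x y).Hom h k) :
    val₃ ((ops act π X).on₃ Γ ε) = val₃ Γ := by
  simp only [TricatData.on₃, val₃_on₂, val₃_vcomp, val₃_wl, val₃_asInv, zero_add']

end Vals

/-- The three squares are naturality cells of the associator and contribute zero. Of the six
pentagons, the one composed with `1_p` on the right keeps its component, and the one composed with
`1_f` on the left is acted on by `f`. Each half retains its three terms in the order of composition,
so commutativity is not needed here. -/
theorem k5_iff (ha : IsActionByAut act) {X : K} {x y z w v u : X ⟶ 𝟙_ K}
    (f : (((globular G H).points X).cells x y).Ob) (g : (((globular G H).points X).cells y z).Ob)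
    (h : (((globular G H).points X).cells z w).Ob) (k : (((globular G H).points X).cells w v).Ob)
    (p : (((globular G H).points X).cells v u).Ob) :
    (ops act π X).K5left f g h k p = (ops act π X).K5right f g h k p ↔
      add (cochain π (pt f) (pt g) (pt h) (pt k))
          (add (cochain π (pt f) (pt g) (mul (pt h) (pt k)) (pt p))
            (cochain π (mul (pt f) (pt g)) (pt h) (pt k) (pt p))) =
        add (smul act (pt f) (cochain π (pt g) (pt h) (pt k) (pt p)))
          (add (cochain π (pt f) (mul (pt g) (pt h)) (pt k) (pt p))
            (cochain π (pt f) (pt g) (pt h) (mul (pt k) (pt p)))) := by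
  -- Both halves have the same source and target, so they agree exactly when their components do.
  refine (⟨congrArg val₃, hom₂_ext⟩ : _ ↔ val₃ _ = val₃ _).trans ?_
  simp only [TricatData.K5source, TricatData.K5target, TricatData.K5left, TricatData.K5right,
    TricatData.pentR, TricatData.pentL,
    TricatData.aNatR, TricatData.aNatL, TricatData.mergeL, TricatData.mergeR, TricatData.splitL,
    TricatData.splitR, val₃_vcomp, val₃_wl, val₃_wr, val₃_on₂, val₃_on₃, val₃_c₃, val₃_id, val₃_χ,
    val₃_χInv, val₃_iInv, val₃_lun, val₃_lunInv, val₃_aNat, val₃_aNatInv, val₃_pent, pt_c₁,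
    zero_add', add_zero', ha.smul_zero]

end Brane

namespace Brane

variable {K : Type*} [Category.{u} K] [CartesianMonoidalCategory K] {G H : K}
variable [GrpObj G] [AddGrpObj H] {act : G ⊗ H ⟶ H} {π : G ⊗ (G ⊗ (G ⊗ G)) ⟶ H}

/-- The cochain `π` vanishes on points when any of its entries is the neutral point. -/
def IsNormalized (π : G ⊗ (G ⊗ (G ⊗ G)) ⟶ H) : Prop :=
  ∀ (X : K) (f g h k : X ⟶ G), f = one G X ∨ g = one G X ∨ h = one G X ∨ k = one G X →
    cochain π f g h k = zero H X

/-! ### The two normalization axioms -/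

section Normalization

variable {X : K} {x y z w v : X ⟶ 𝟙_ K}

/-- The `H`-part of a 3-morphism vanishes. -/
def IsTrivial {f g : (((globular G H).points X).cells x y).Ob}
    {α β : (((globular G H).points X).cells x y).Hom f g}
    (Γ : (((globular G H).points X).cells x y).Hom₂ α β) : Prop := val₃ Γ = zero H X

/-- Closure of trivial cells under the operations lets a long composite be treated by following its
syntax, one factor at a time. -/
theorem IsTrivial.vcomp {f g : (((globular G H).points X).cells x y).Ob}
    {α β γ : (((globular G H).points X).cells x y).Hom f g}
    {Γ : (((globular G H).points X).cells x y).Hom₂ α β}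
    {Δ : (((globular G H).points X).cells x y).Hom₂ β γ} (hΓ : IsTrivial Γ) (hΔ : IsTrivial Δ) :
    IsTrivial ((ops act π X).v₃ Γ Δ) :=
  (val₃_vcomp Γ Δ).trans (by rw [hΓ, hΔ, zero_add'])

theorem IsTrivial.wl {f g h : (((globular G H).points X).cells x y).Ob}
    {α : (((globular G H).points X).cells x y).Hom f g}
    {β γ : (((globular G H).points X).cells x y).Hom g h}
    {Γ : (((globular G H).points X).cells x y).Hom₂ β γ} (hΓ : IsTrivial Γ) :
    IsTrivial ((ops act π X).wl α Γ) := (val₃_wl α Γ).trans hΓ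

theorem IsTrivial.wr {f g h : (((globular G H).points X).cells x y).Ob}
    {β γ : (((globular G H).points X).cells x y).Hom f g}
    {Γ : (((globular G H).points X).cells x y).Hom₂ β γ}
    {α : (((globular G H).points X).cells x y).Hom g h} (hΓ : IsTrivial Γ) :
    IsTrivial ((ops act π X).wr Γ α) := (val₃_wr Γ α).trans hΓ

theorem IsTrivial.c₃ (ha : IsActionByAut act) {f f' : (((globular G H).points X).cells x y).Ob}
    {g g' : (((globular G H).points X).cells y z).Ob}
    {α β : (((globular G H).points X).cells x y).Hom f f'}
    {γ δ : (((globular G H).points X).cells y z).Hom g g'}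
    {Γ : (((globular G H).points X).cells x y).Hom₂ α β}
    {Δ : (((globular G H).points X).cells y z).Hom₂ γ δ} (hΓ : IsTrivial Γ) (hΔ : IsTrivial Δ) :
    IsTrivial ((ops act π X).c₃ Γ Δ) :=
  (val₃_c₃ Γ Δ).trans (by rw [hΓ, hΔ, ha.smul_zero, zero_add'])

theorem isTrivial_mergeR (ha : IsActionByAut act) {f g h : (((globular G H).points X).cells x y).Ob}
    (α : (((globular G H).points X).cells x y).Hom f g)
    (β : (((globular G H).points X).cells x y).Hom g h)
    (k : (((globular G H).points X).cells y z).Ob) :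
    IsTrivial ((ops act π X).mergeR α β k) :=
  .vcomp (val₃_χ _ _ _ _) (.c₃ ha (val₃_id _) (val₃_lun _))

theorem isTrivial_mergeL (ha : IsActionByAut act) (k : (((globular G H).points X).cells x y).Ob)
    {f g h : (((globular G H).points X).cells y z).Ob}
    (α : (((globular G H).points X).cells y z).Hom f g)
    (β : (((globular G H).points X).cells y z).Hom g h) :
    IsTrivial ((ops act π X).mergeL k α β) :=
  .vcomp (val₃_χ _ _ _ _) (.c₃ ha (val₃_lun _) (val₃_id _))

/-- The unit of the adjoint equivalence for `r`, the cell `μ` and all structural cells in this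
composite have component zero. -/
theorem isTrivial_mid (ha : IsActionByAut act) (f : (((globular G H).points X).cells x y).Ob)
    (g : (((globular G H).points X).cells y z).Ob) :
    IsTrivial ((ops act π X).mid f g) :=
  .vcomp (val₃_lunInv _) <|
  .vcomp (.wr (.vcomp (val₃_i _ _) (.vcomp (.c₃ ha (val₃_mk₃ _ _ _) (val₃_id _))
    (.vcomp (.c₃ ha (val₃_id _) (val₃_lunInv _)) (val₃_χInv _ _ _ _))))) <|
  .vcomp (val₃_as _ _ _) <|
  .vcomp (.wl (.vcomp (val₃_mk₃ _ _ _) (val₃_iInv _ _))) (val₃_run _)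

theorem isTrivial_lamC (f : (((globular G H).points X).cells x y).Ob)
    (g : (((globular G H).points X).cells y z).Ob) :
    IsTrivial ((ops act π X).lamC f g) := val₃_mk₃ _ _ _

theorem isTrivial_rhoC (f : (((globular G H).points X).cells x y).Ob)
    (g : (((globular G H).points X).cells y z).Ob) :
    IsTrivial ((ops act π X).rhoC f g) :=
  .vcomp (.wl (val₃_mk₃ _ _ _)) <| .vcomp (val₃_asInv _ _ _) <|
    .vcomp (.wr (val₃_mk₃ _ _ _)) (val₃_lun _)

/-- Both composites are trivial: the pentagonator at `(f, 1, g, h)` vanishes because its second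
entry is neutral, and no other cell involves `π`. -/
theorem leftNormalization_ops (ha : IsActionByAut act) (hπ : IsNormalized π) (X : K) :
    (ops act π X).LeftNormalization := by
  intro x y z w f g h
  have hn : IsTrivial ((ops act π X).pent f ((ops act π X).one y) g h) :=
    (val₃_pent _ _ _ _).trans (hπ X _ _ _ _ (.inr (.inl rfl)))
  refine hom₂_ext (Eq.trans (b := zero H X) ?_ (Eq.symm ?_))
  · exact IsTrivial.vcomp ((val₃_on₃ _ _).trans hn) <| .vcomp (.wl (isTrivial_mid ha _ _)) <|
      .vcomp (.wl (.c₃ ha (val₃_id _) (val₃_i _ _))) (val₃_aNatInv _ _ _)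
  · exact IsTrivial.vcomp (.wl (.wl (.vcomp (isTrivial_mergeL ha _ _ _)
      (.c₃ ha (val₃_id _) (isTrivial_lamC _ _))))) <| .vcomp (.wl (val₃_aNatInv _ _ _)) <|
      .vcomp (val₃_asInv _ _ _) <|
      .wr (.vcomp (isTrivial_mergeR ha _ _ _) (.c₃ ha (isTrivial_mid ha _ _) (val₃_id _)))

/-- The same reasoning applies, now with the pentagonator at `(f, g, 1, h)` and its neutral third
entry. -/
theorem rightNormalization_ops (ha : IsActionByAut act) (hπ : IsNormalized π) (X : K) :
    (ops act π X).RightNormalization := by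
  intro x y z w f g h
  have hn : IsTrivial ((ops act π X).pent f g ((ops act π X).one z) h) :=
    (val₃_pent _ _ _ _).trans (hπ X _ _ _ _ (.inr (.inr (.inl rfl))))
  refine hom₂_ext (Eq.trans (b := zero H X) ?_ (Eq.symm ?_))
  · exact IsTrivial.vcomp ((val₃_on₃ _ _).trans hn) <|
      .vcomp (.wl (.vcomp (val₃_aNatInv _ _ _) (.wr (.c₃ ha (val₃_iInv _ _) (val₃_id _))))) <|
      .vcomp (val₃_asInv _ _ _) (.wr (isTrivial_mid ha _ _))
  · exact IsTrivial.vcomp (.wl (.wl (.vcomp (isTrivial_mergeL ha _ _ _)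
      (.c₃ ha (val₃_id _) (isTrivial_mid ha _ _))))) <| .vcomp (.wl (val₃_aNatInv _ _ _)) <|
      .vcomp (val₃_asInv _ _ _) <|
      .wr (.vcomp (isTrivial_mergeR ha _ _ _) (.c₃ ha (isTrivial_rhoC _ _) (val₃_id _)))

end Normalization

/-! ### Strict pseudofunctors and trivial transformations -/

section Strict

variable {C : Cells.{u}} {B : BicatData C} {X : K} {x y z w v : X ⟶ 𝟙_ K}

/-- The constraint of the composite is the zero constraint of the tensor plus the product of two
zero cells, and the action fixes zero. -/
theorem IsStrict.ten (ha : IsActionByAut act) {P : PseudoData B (homData (G := G) (H := H) X x y)}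
    {Q : PseudoData B (homData (G := G) (H := H) X y z)} (hP : IsStrict P) (hQ : IsStrict Q) :
    IsStrict ((base act X).ten P Q) where
  mapComp f g := by
    simp only [TricatBase.ten, PseudoData.comp, PseudoData.pair, val₃_mk₃, hP.mapComp, hQ.mapComp,
      smul_hom_val, ha.smul_zero, zero_add']
  mapId b := by
    simp only [TricatBase.ten, PseudoData.comp, PseudoData.pair, val₃_mk₃, hP.mapId, hQ.mapId,
      smul_hom_val, ha.smul_zero, zero_add']

/-- The multiplication of the semidirect product; iterated, it computes both bracketings of a triple
product and the products with the unit. -/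
theorem val₃_ten_map₂ (P : PseudoData B (homData (G := G) (H := H) X x y))
    (Q : PseudoData B (homData (G := G) (H := H) X y z)) {b c : C.Ob} {f g : C.Hom b c}
    (Γ : C.Hom₂ f g) :
    val₃ (((base act X).ten P Q).map₂ Γ) =
      add (val₃ (P.map₂ Γ)) (smul act (pt (P.obj b)) (val₃ (Q.map₂ Γ))) := by
  simp only [TricatBase.ten, PseudoData.comp, PseudoData.pair, val₃_mk₃, smul_hom_val]

theorem isStrict_id : IsStrict (PseudoData.id (homData (G := G) (H := H) X x y)) :=
  ⟨fun _ _ => val₃_mk₃ _ _ _, fun _ => val₃_mk₃ _ _ _⟩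

theorem isStrict_unit : IsStrict ((base (H := H) act X).unit B x) :=
  ⟨fun _ _ => val₃_mk₃ _ _ _, fun _ => val₃_mk₃ _ _ _⟩

theorem isStrict_snd : IsStrict (PseudoData.snd B (homData (G := G) (H := H) X x y)) :=
  ⟨fun _ _ => val₃_mk₃ _ _ _, fun _ => val₃_mk₃ _ _ _⟩

theorem isStrict_fst_fst {C' : Cells.{u}} {B' : BicatData C'} :
    IsStrict ((PseudoData.fst ((homData (G := G) (H := H) X x y).prod B) B').comp
      (PseudoData.fst _ _)) :=
  ⟨fun _ _ => (val₃_mk₃ _ _ _).trans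
    ((congrArg₂ add (val₃_mk₃ _ _ _) (val₃_mk₃ _ _ _)).trans (zero_add' _)),
  fun _ => (val₃_mk₃ _ _ _).trans
    ((congrArg₂ add (val₃_mk₃ _ _ _) (val₃_mk₃ _ _ _)).trans (zero_add' _))⟩

theorem isStrict_fst_snd {C' : Cells.{u}} {B' : BicatData C'} :
    IsStrict ((PseudoData.fst (B.prod (homData (G := G) (H := H) X x y)) B').comp
      (PseudoData.snd _ _)) :=
  ⟨fun _ _ => (val₃_mk₃ _ _ _).trans
    ((congrArg₂ add (val₃_mk₃ _ _ _) (val₃_mk₃ _ _ _)).trans (zero_add' _)),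
  fun _ => (val₃_mk₃ _ _ _).trans
    ((congrArg₂ add (val₃_mk₃ _ _ _) (val₃_mk₃ _ _ _)).trans (zero_add' _))⟩

/-- A transformation with trivial naturality cells. -/
def IsTrivialTrans {F F' : MapData C (((globular G H).points X).cells x y)}
    (θ : TransData (homData (G := G) (H := H) X x y) F F') : Prop :=
  ∀ {b c} (f : C.Hom b c), val₃ (θ.nat f) = zero H X

theorem IsTrivialTrans.comp {F F' F'' : MapData C (((globular G H).points X).cells x y)}
    {θ : TransData (homData (G := G) (H := H) X x y) F F'}
    {φ : TransData (homData (G := G) (H := H) X x y) F' F''} (hθ : IsTrivialTrans θ)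
    (hφ : IsTrivialTrans φ) : IsTrivialTrans (θ.comp φ) := fun f => by
  simp only [TransData.comp, BicatData.sqComp, BicatData.wl, BicatData.wr, val₃_mk₃, hθ f, hφ f,
    zero_add']

theorem IsTrivialTrans.tenTrans (ha : IsActionByAut act)
    {P P' : MapData C (((globular G H).points X).cells x y)}
    {Q Q' : MapData C (((globular G H).points X).cells y z)}
    {θ : TransData (homData (G := G) (H := H) X x y) P P'}
    {φ : TransData (homData (G := G) (H := H) X y z) Q Q'} (hθ : IsTrivialTrans θ)
    (hφ : IsTrivialTrans φ) : IsTrivialTrans ((base act X).tenTrans θ φ) := fun f => by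
  -- The naturality cell is `χ`, then the product of the two given cells, then `χInv`; the nested
  -- terms expose these three summands.
  refine ((val₃_mk₃ _ _ _).trans <| congrArg₂ add (val₃_mk₃ _ _ _) <| (val₃_mk₃ _ _ _).trans <|
    congrArg₂ add (val₃_mk₃ _ _ _) (val₃_mk₃ _ _ _)).trans ?_
  simp only [hθ f, hφ f, smul_hom_val, ha.smul_zero, zero_add']

theorem isTrivialTrans_idT (P : MapData C (((globular G H).points X).cells x y)) :
    IsTrivialTrans ((constraints act X).idT P) := fun _ =>
  (val₃_mk₃ _ _ _).trans ((congrArg₂ add (val₃_mk₃ _ _ _) (val₃_mk₃ _ _ _)).trans (zero_add' _))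

section

variable (P : MapData C (((globular G H).points X).cells x y))
  (Q : MapData C (((globular G H).points X).cells y z))
  (R : MapData C (((globular G H).points X).cells z w))

theorem isTrivialTrans_aT : IsTrivialTrans ((constraints act X).aT P Q R) :=
  fun _ => val₃_mk₃ _ _ _

theorem isTrivialTrans_aT' : IsTrivialTrans ((constraints act X).aT' P Q R) :=
  fun _ => val₃_mk₃ _ _ _

theorem isTrivialTrans_lT : IsTrivialTrans ((constraints act X).lT P) := fun _ => val₃_mk₃ _ _ _

theorem isTrivialTrans_rT : IsTrivialTrans ((constraints act X).rT P) := fun _ => val₃_mk₃ _ _ _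

theorem isTrivialTrans_rT' : IsTrivialTrans ((constraints act X).rT' P) :=
  fun _ => val₃_mk₃ _ _ _

end

/-- The case of the three triangulators, whose components are constantly zero. -/
theorem isModIso_zero {F F' : MapData C (((globular G H).points X).cells x y)}
    {θ φ : TransData (homData (G := G) (H := H) X x y) F F'}
    (hθ : IsTrivialTrans θ) (hφ : IsTrivialTrans φ) :
    TransData.IsModIso θ φ (fun _ => mk₃ _ _ (zero H X)) (fun _ => mk₃ _ _ (zero H X)) := by
  refine isModIso_of_trivial hθ hφ ?_ ?_ ?_ <;> intros <;> simp only [val₃_mk₃, zero_add']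

end Strict

/-- The cocycle equation enters only through `pentagonator`, and normalization only through the last
two fields. The other fields hold for any cochain. -/
theorem isTricategory_ops (ha : IsActionByAut act) (hc : IsCocycle act π) (hn : IsNormalized π)
    (X : K) : (ops act π X).IsTricategory where
  hom := isBicategory_homData ha X
  tensor := isPseudofunctor_tensor ha X
  a x y z w := by
    refine isAdjEquiv_trivialEquiv (F := (base act X).left₃ x y z w)
      (F' := (base act X).right₃ x y z w)
      (.ten ha (.ten ha isStrict_fst_fst isStrict_fst_snd) isStrict_snd)
      (.ten ha isStrict_fst_fst (.ten ha isStrict_fst_snd isStrict_snd)) _ fun {b c f g} Γ => ?_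
    -- The two bracketings have components `(a + f b) + (f g) c` and `a + f (b + g c)`; their
    -- equality is associativity in the semidirect product.
    refine (val₃_ten_map₂ _ _ _).trans (Eq.trans ?_ (val₃_ten_map₂ _ _ _).symm)
    refine (congrArg (add · _) (val₃_ten_map₂ _ _ _)).trans (Eq.trans ?_
      (congrArg (fun h => add _ (smul act _ h)) (val₃_ten_map₂ _ _ _).symm))
    rw [ha.smul_add, add_assoc', ← ha.mul_smul]
    rfl
  l x y :=
    -- Naturality is the left unit law `0 + 1 a = a`.
    isAdjEquiv_trivialEquiv (F := (base act X).oneLeft x y) (F' := PseudoData.id _)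
      (.ten ha isStrict_unit isStrict_id) isStrict_id _ fun Γ =>
        (val₃_ten_map₂ _ _ _).trans ((congrArg₂ add (val₃_mk₃ _ _ _) (ha.one_smul _)).trans
          (zero_add' _))
  r x y :=
    -- Naturality is the right unit law `a + f 0 = a`.
    isAdjEquiv_trivialEquiv (F := (base act X).oneRight x y) (F' := PseudoData.id _)
      (.ten ha isStrict_id isStrict_unit) isStrict_id _ fun Γ =>
        (val₃_ten_map₂ _ _ _).trans ((congrArg (fun h => add _ (smul act _ h))
          (val₃_mk₃ _ _ _)).trans (by rw [ha.smul_zero, add_zero']))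
  π x y z w v := by
    refine isModIso_of_trivial
      (IsTrivialTrans.comp
        (IsTrivialTrans.tenTrans ha (isTrivialTrans_aT _ _ _) (isTrivialTrans_idT _))
        (IsTrivialTrans.comp (isTrivialTrans_aT _ _ _)
          (IsTrivialTrans.tenTrans ha (isTrivialTrans_idT _) (isTrivialTrans_aT _ _ _))))
      (IsTrivialTrans.comp (isTrivialTrans_aT _ _ _) (isTrivialTrans_aT _ _ _))
      -- `πInv` is defined through the composite `π ≫ AddGrpObj.neg`; reassociating exhibits it as
      -- the negative of the value of `π`.
      (fun b => (congrArg₂ add (val₃_mk₃ _ _ _)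
        ((val₃_mk₃ _ _ _).trans (Category.assoc _ _ _).symm)).trans (add_neg' _))
      (fun b => (congrArg₂ add ((val₃_mk₃ _ _ _).trans (Category.assoc _ _ _).symm)
        (val₃_mk₃ _ _ _)).trans (neg_add' _))
      (fun {b c} u => (val₃_mk₃ _ _ _).trans (Eq.trans ?_ (val₃_mk₃ _ _ _).symm))
    -- A quadruple of 2-morphisms joins equal quadruples of points, so `π` takes the same value at
    -- both ends.
    rw [eq_of_hom u.1.1.1, eq_of_hom u.1.1.2, eq_of_hom u.1.2, eq_of_hom u.2]
  μ x y z :=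
    isModIso_zero
      (IsTrivialTrans.comp
        (IsTrivialTrans.tenTrans ha (isTrivialTrans_rT' _) (isTrivialTrans_idT _))
        (IsTrivialTrans.comp (isTrivialTrans_aT _ _ _)
          (IsTrivialTrans.tenTrans ha (isTrivialTrans_idT _) (isTrivialTrans_lT _))))
      (IsTrivialTrans.tenTrans ha (isTrivialTrans_idT _) (isTrivialTrans_idT _))
  lam x y z :=
    isModIso_zero (IsTrivialTrans.tenTrans ha (isTrivialTrans_lT _) (isTrivialTrans_idT _))
      (IsTrivialTrans.comp (isTrivialTrans_aT _ _ _) (isTrivialTrans_lT _))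
  ρ x y z :=
    isModIso_zero (IsTrivialTrans.tenTrans ha (isTrivialTrans_idT _) (isTrivialTrans_rT _))
      (IsTrivialTrans.comp (isTrivialTrans_aT' _ _ _) (isTrivialTrans_rT _))
  pentagonator f g h k p := (k5_iff ha f g h k p).2 (hc X _ _ _ _ _)
  leftNormalization := leftNormalization_ops ha hn X
  rightNormalization := rightNormalization_ops ha hn X

end Brane

namespace Brane

variable {K : Type*} [Category.{u} K] [CartesianMonoidalCategory K] {G H : K}

/-! ### Existence of the objects of composable cells -/

section Composables

/-- Over the terminal object a fibre product is a product. This matters because pullbacks of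
manifolds do not exist in general. -/
theorem hasPullback_unit {A B : K} (f : A ⟶ 𝟙_ K) (g : B ⟶ 𝟙_ K) : HasPullback f g :=
  IsPullback.hasPullback (fst := fst A B) (snd := snd A B)
    ⟨⟨toUnit_unique _ _⟩, ⟨PullbackCone.IsLimit.mk _ (fun s => lift s.fst s.snd)
      (fun _ => lift_fst _ _) (fun _ => lift_snd _ _)
      fun s m h₁ h₂ => CartesianMonoidalCategory.hom_ext _ _ (by simpa using h₁) (by simpa using h₂)⟩⟩

/-- A trivial bundle with fibre `B` pulls back to the trivial bundle `P ⊗ B`. This applies to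
3-morphisms, which form the trivial bundle `G ⊗ H` over `G`. -/
theorem hasPullback_fst {A B P : K} (f : P ⟶ A) : HasPullback (fst A B) f :=
  IsPullback.hasPullback (fst := lift (fst P B ≫ f) (snd P B)) (snd := fst P B)
    ⟨⟨lift_fst _ _⟩, ⟨PullbackCone.IsLimit.mk _ (fun s => lift s.snd (s.fst ≫ snd A B))
      (fun s => CartesianMonoidalCategory.hom_ext _ _ (by simp [s.condition]) (by simp))
      (fun _ => lift_fst _ _)
      fun s m h₁ h₂ => CartesianMonoidalCategory.hom_ext _ _ (by simpa using h₂)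
        (by simp [← h₁])⟩⟩

variable [GrpObj G] [AddGrpObj H] {act : G ⊗ H ⟶ H} {π : G ⊗ (G ⊗ (G ⊗ G)) ⟶ H}

theorem hasComposables_brane : (brane act π).HasComposables where
  pairs₁ := hasPullback_unit _ _
  triples₁ := ⟨hasPullback_unit _ _, hasPullback_unit _ _⟩
  quadruples₁ := ⟨hasPullback_unit _ _, hasPullback_unit _ _, hasPullback_unit _ _⟩
  pairs₂ := hasPullback_unit _ _
  triples₂ := ⟨hasPullback_unit _ _, hasPullback_unit _ _⟩
  pairs₃ := hasPullback_unit _ _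
  vpairs₂ := inferInstanceAs (HasPullback (𝟙 G) (𝟙 G))
  vtriples₂ := ⟨inferInstanceAs (HasPullback (𝟙 G) (𝟙 G)),
    inferInstanceAs (HasPullback (pullback.snd (𝟙 G) (𝟙 G) ≫ 𝟙 G) (𝟙 G))⟩
  vpairs₃ := by
    have : HasPullback (fst G H) (fst G H) := hasPullback_fst _
    have : HasPullback (fst G H ≫ 𝟙 G) (fst G H ≫ 𝟙 G) := by rwa [Category.comp_id]
    exact this
  tpairs₃ := hasPullback_fst (fst G H)
  squares₂ := ⟨inferInstanceAs (HasPullback (𝟙 G) (𝟙 G)), hasPullback_unit _ _⟩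

end Composables

variable [GrpObj G] [AddGrpObj H] {act : G ⊗ H ⟶ H} {π : G ⊗ (G ⊗ (G ⊗ G)) ⟶ H}

/-! ### Naturality of the operations in the test object -/

section Natural

variable {X Y : K} (φ : Y ⟶ X)

theorem comp_mul (g g' : X ⟶ G) : φ ≫ mul g g' = mul (φ ≫ g) (φ ≫ g') := by
  simp only [mul, comp_lift_assoc]

theorem comp_one : φ ≫ one G X = one G Y := by
  simp only [one, ← Category.assoc, toUnit_unique (φ ≫ toUnit X) (toUnit Y)]

theorem comp_add (h h' : X ⟶ H) : φ ≫ add h h' = add (φ ≫ h) (φ ≫ h') := by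
  simp only [add, comp_lift_assoc]

theorem comp_zero : φ ≫ zero H X = zero H Y := by
  simp only [zero, ← Category.assoc, toUnit_unique (φ ≫ toUnit X) (toUnit Y)]

omit [GrpObj G] [AddGrpObj H] in
theorem comp_smul (g : X ⟶ G) (h : X ⟶ H) : φ ≫ smul act g h = smul act (φ ≫ g) (φ ≫ h) := by
  simp only [smul, comp_lift_assoc]

omit [GrpObj G] [AddGrpObj H] in
theorem val₃_restrict {x y : X ⟶ 𝟙_ K} {f g : (((globular G H).points X).cells x y).Ob}
    {α β : (((globular G H).points X).cells x y).Hom f g}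
    (Γ : (((globular G H).points X).cells x y).Hom₂ α β) :
    val₃ (((globular G H).restrict φ).hom₂ Γ) = φ ≫ val₃ Γ := Category.assoc _ _ _

/-- The `G`-component of `mk₃` is the point of the source morphism, so restriction need only be
checked on that point and on `h`. -/
theorem mk₃_natural {x y : X ⟶ 𝟙_ K} {x' y' : Y ⟶ 𝟙_ K}
    {f g : (((globular G H).points X).cells x y).Ob}
    {f' g' : (((globular G H).points Y).cells x' y').Ob}
    {α β : (((globular G H).points X).cells x y).Hom f g}
    {α' β' : (((globular G H).points Y).cells x' y').Hom f' g'} {h : X ⟶ H} {h' : Y ⟶ H}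
    (hα : pt f' = φ ≫ pt f) (hh : h' = φ ≫ h) :
    (mk₃ α' β' h').1 = φ ≫ (mk₃ α β h).1 := by
  have : α'.1 = φ ≫ α.1 := (hom_val α').trans (hα.trans (congrArg (φ ≫ ·) (hom_val α).symm))
  exact (congrArg₂ lift this hh).trans (comp_lift _ _ _).symm

theorem zero_natural {x y : X ⟶ 𝟙_ K} {x' y' : Y ⟶ 𝟙_ K}
    {f g : (((globular G H).points X).cells x y).Ob}
    {f' g' : (((globular G H).points Y).cells x' y').Ob}
    {α β : (((globular G H).points X).cells x y).Hom f g}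
    {α' β' : (((globular G H).points Y).cells x' y').Hom f' g'}
    (hα : pt f' = φ ≫ pt f) :
    (mk₃ α' β' (zero H Y)).1 = φ ≫ (mk₃ α β (zero H X)).1 :=
  mk₃_natural φ hα (comp_zero φ).symm

/-- The cells of `hom` and the unit lie over the points of the first map, those of `inv` and the
counit over the points of the second. Since the two maps agree on points, `hF` suffices for both. -/
theorem trivialEquiv_preserved {C C' : Cells.{u}} {x y : X ⟶ 𝟙_ K} {x' y' : Y ⟶ 𝟙_ K}
    {F F' : MapData C (((globular G H).points X).cells x y)}
    {E E' : MapData C' (((globular G H).points Y).cells x' y')}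
    (e : ∀ b, (F.obj b).1 = (F'.obj b).1) (e' : ∀ b, (E.obj b).1 = (E'.obj b).1)
    (o : C.Ob → C'.Ob) (m : ∀ {x y}, C.Hom x y → C'.Hom (o x) (o y))
    (hF : ∀ b, pt (E.obj (o b)) = φ ≫ pt (F.obj b)) :
    (trivialEquiv X F F' e).Preserved (trivialEquiv Y E E' e') o m
      (fun α => φ ≫ α.1) (fun α => α.1) (fun Γ => φ ≫ Γ.1) (fun Γ => Γ.1) := by
  have hF' : ∀ b, pt (E'.obj (o b)) = φ ≫ pt (F'.obj b) := fun b =>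
    (e' (o b)).symm.trans ((hF b).trans (congrArg (φ ≫ ·) (e b)))
  constructor
  case hom_app => exact hF
  case inv_app => exact hF'
  case hom_nat | hom_natInv | unit | unitInv => intros; exact zero_natural φ (hF _)
  case inv_nat | inv_natInv | counit | counitInv => intros; exact zero_natural φ (hF' _)

end Natural

omit [GrpObj G] [AddGrpObj H] in
theorem comp_cochain {X Y : K} (φ : Y ⟶ X) (f g h k : X ⟶ G) :
    φ ≫ cochain π f g h k = cochain π (φ ≫ f) (φ ≫ g) (φ ≫ h) (φ ≫ k) := by
  simp only [cochain, comp_lift_assoc, comp_lift]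

/-- Precomposition commutes with pairing, hence with everything built from the structure morphisms
of `G` and `H`, from `act` and from `π`. Each case splits into its `G`-component and its
`H`-component. -/
theorem isNatural_brane : (brane act π).IsNatural := by
  intro X Y φ
  have h₂ (g g' : X ⟶ G) : mul (φ ≫ g) (φ ≫ g') = φ ≫ mul g g' := (comp_mul φ _ _).symm
  have h₃ (g g' g'' : X ⟶ G) : mul (mul (φ ≫ g) (φ ≫ g')) (φ ≫ g'') = φ ≫ mul (mul g g') g'' := by
    rw [h₂, h₂]
  have h₄ (g g' g'' k : X ⟶ G) : mul (mul (mul (φ ≫ g) (φ ≫ g')) (φ ≫ g'')) (φ ≫ k) =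
      φ ≫ mul (mul (mul g g') g'') k := by rw [h₂, h₂, h₂]
  have h₁ : one G Y = φ ≫ one G X := (comp_one φ).symm
  constructor
  case id | comp => intros; rfl
  case one => exact fun _ => h₁
  case vcomp | hcomp =>
    intros
    exact mk₃_natural φ rfl ((congrArg₂ add (val₃_restrict φ _) (val₃_restrict φ _)).trans
      (comp_add φ _ _).symm)
  case c₁ | c₂ => intros; exact h₂ _ _
  case c₃ =>
    intros
    exact mk₃_natural φ (h₂ _ _) ((congrArg₂ add (val₃_restrict φ _)
      ((congrArg (smul act _) (val₃_restrict φ _)).trans (comp_smul φ _ _).symm)).trans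
      (comp_add φ _ _).symm)
  case a => exact fun _ _ _ _ => trivialEquiv_preserved φ _ _ _ _ fun _ => h₃ _ _ _
  case l =>
    exact fun _ _ => trivialEquiv_preserved φ _ _ _ _ fun _ =>
      (congrArg (mul · _) h₁).trans (h₂ _ _)
  case r =>
    exact fun _ _ => trivialEquiv_preserved φ _ _ _ _ fun _ => (congrArg (mul _) h₁).trans (h₂ _ _)
  case π =>
    intros
    exact mk₃_natural φ (h₄ _ _ _ _) (comp_cochain φ _ _ _ _).symm
  case πInv =>
    intros
    -- The inverse pentagonator is treated as the cochain of `π ≫ AddGrpObj.neg`.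
    exact mk₃_natural φ (h₄ _ _ _ _)
      (comp_cochain (π := π ≫ AddGrpObj.neg) φ _ _ _ _).symm
  case id₂ | assoc | assocInv | lun | lunInv | run | runInv => intros; exact zero_natural φ rfl
  case χ | χInv | i | iInv | μInv => intros; exact zero_natural φ (h₂ _ _)
  case μ => intros; exact zero_natural φ (h₂ _ _)
  case lam | lamInv =>
    intros
    -- The 2-morphism `l_f · 1_g` starts at `(1 f) g`, whose neutral factor has to be restricted as
    -- well.
    exact zero_natural φ ((congrArg (fun g => mul (mul g _) _) h₁).trans (h₃ _ _ _))
  case ρ | ρInv =>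
    intros
    -- Here the starting morphism is `f (g 1)`.
    exact zero_natural φ ((congrArg (fun g => mul _ (mul _ g)) h₁).trans
      ((congrArg (mul _) (h₂ _ _)).trans (h₂ _ _)))

/-! ### Weak invertibility of all cells -/

section Invertible

variable {X : K} {x y : X ⟶ 𝟙_ K}

theorem invertible₃ {f g : (((globular G H).points X).cells x y).Ob}
    {α β : (((globular G H).points X).cells x y).Hom f g}
    (Γ : (((globular G H).points X).cells x y).Hom₂ α β) : (ops act π X).Invertible₃ Γ :=
  ⟨mk₃ _ _ (val₃ Γ ≫ AddGrpObj.neg),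
    hom₂_ext ((val₃_mk₃ _ _ _).trans (((congrArg (add _) (val₃_mk₃ _ _ _)).trans
      (add_neg' _)).trans (val₃_mk₃ _ _ _).symm)),
    hom₂_ext ((val₃_mk₃ _ _ _).trans (((congrArg (add · _) (val₃_mk₃ _ _ _)).trans
      (neg_add' _)).trans (val₃_mk₃ _ _ _).symm))⟩

theorem invertible₂ {f g : (((globular G H).points X).cells x y).Ob}
    (α : (((globular G H).points X).cells x y).Hom f g) : (ops act π X).Invertible₂ α :=
  ⟨mk₂ g f (eq_of_hom α).symm, ⟨mk₃ _ _ (zero H X), invertible₃ _⟩,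
    ⟨mk₃ _ _ (zero H X), invertible₃ _⟩⟩

/-- The group inverse gives products that are strictly neutral, so identity 2-morphisms witness
invertibility. -/
theorem invertible₁ (f : (((globular G H).points X).cells x y).Ob) :
    (ops act π X).Invertible₁ f :=
  ⟨mk₁ y x (pt f ≫ GrpObj.inv), ⟨mk₂ _ _ (mul_inv' (pt f)), invertible₂ _⟩,
    ⟨mk₂ _ _ (inv_mul' (pt f)), invertible₂ _⟩⟩

end Invertible

/-- The pentagonator identity for `Brane_π(G, H)` is the cocycle equation for `π`. -/
theorem pentagonatorIdentity_brane_iff (ha : IsActionByAut act) :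
    (brane act π).PentagonatorIdentity ↔ IsCocycle act π :=
  -- The terminal object has a single `X`-point, so any five points of `G` form a composable
  -- quintet.
  ⟨fun hp X f g h k p => (k5_iff ha (mk₁ (toUnit X) (toUnit X) f) (mk₁ _ (toUnit X) g)
      (mk₁ _ (toUnit X) h) (mk₁ _ (toUnit X) k) (mk₁ _ (toUnit X) p)).1 (hp X _ _ _ _ _),
    fun hc X _ _ _ _ _ _ f g h k p => (k5_iff ha f g h k p).2 (hc X _ _ _ _ _)⟩

/-- `Brane_π(G, H)` is a 3-group if `π` is a normalized cocycle. -/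
theorem isThreeGroup_brane (ha : IsActionByAut act) (hc : IsCocycle act π) (hn : IsNormalized π) :
    (brane act π).IsThreeGroup where
  composables := hasComposables_brane
  natural := isNatural_brane
  pointwise := isTricategory_ops ha hc hn
  one_object := ⟨isTerminalTensorUnit⟩
  invertible₁ _ _ _ := invertible₁
  invertible₂ _ _ _ _ _ := invertible₂
  invertible₃ _ _ _ _ _ _ _ := invertible₃

end Brane

/-! ### The cocycle condition without signs -/

namespace Cochain

variable {G H : Type*} [Group G] [AddCommGroup H] {act : G → H → H} {π : G × G × G × G → H}

/-- Grouping the six terms of the coboundary by sign yields the two halves of the associahedron: the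
negative terms form the left side and the positive ones the right side. -/
theorem isCocycle_ofProd_iff : IsCocycle act (ofProd π) ↔ ∀ f g h k p : G,
    π (f, g, h, k) + (π (f, g, h * k, p) + π (f * g, h, k, p)) =
      act f (π (g, h, k, p)) + (π (f, g * h, k, p) + π (f, g, h, k * p)) := by
  -- The four contractions carry the signs `-, +, -, +`, and the last term carries `(-1)^5`.
  have key (g : Fin 5 → G) : coboundary act (ofProd π) g =
      act (g 0) (π (g 1, g 2, g 3, g 4)) +
        (π (g 0, g 1 * g 2, g 3, g 4) + π (g 0, g 1, g 2, g 3 * g 4)) -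
      (π (g 0, g 1, g 2, g 3) + (π (g 0, g 1, g 2 * g 3, g 4) + π (g 0 * g 1, g 2, g 3, g 4))) := by
    simp only [coboundary, Fin.sum_univ_four]
    simp [ofProd, Fin.contractNth]
    abel
  constructor
  · intro hc f g h k p
    have := hc ![f, g, h, k, p]
    rw [key] at this
    exact (sub_eq_zero.1 this).symm
  · intro hc g
    rw [key]
    exact sub_eq_zero.2 (hc _ _ _ _ _).symm

theorem isNormalized_ofProd_iff : IsNormalized (ofProd π) ↔ ∀ f g h k : G,
    f = 1 ∨ g = 1 ∨ h = 1 ∨ k = 1 → π (f, g, h, k) = 0 := by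
  refine ⟨fun hn f g h k hg => hn ![f, g, h, k] ?_, fun hn g hg => hn _ _ _ _ ?_⟩
  · simpa [Fin.exists_fin_succ] using hg
  · simpa [Fin.exists_fin_succ] using hg

end Cochain

/-! ### Passage from points to functions: Lie groups -/

section Lie

variable {E F M N G H : Type u}
  [NormedAddCommGroup E] [NormedSpace ℝ E] [FiniteDimensional ℝ E]
  [NormedAddCommGroup F] [NormedSpace ℝ F] [FiniteDimensional ℝ F]
  [TopologicalSpace M] [TopologicalSpace N]
  (I : ModelWithCorners ℝ E M) [I.Boundaryless] (J : ModelWithCorners ℝ F N) [J.Boundaryless]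
  [TopologicalSpace G] [ChartedSpace M G] [T2Space G] [SecondCountableTopology G]
  [Group G] [LieGroup I ∞ G]
  [TopologicalSpace H] [ChartedSpace N H] [T2Space H] [SecondCountableTopology H]
  [AddCommGroup H] [LieAddGroup J ∞ H]
  [DistribMulAction G H] [ContMDiffSMul I J ∞ G H]

namespace SmoothMan

/-- The action of a Lie group as a morphism of manifolds. -/
noncomputable abbrev smulHom : of I G ⊗ of J H ⟶ of J H :=
  mk' (X := prod (of I G) (of J H)) (fun p => (p.1 • p.2 : H))
    (ContMDiffSMul.contMDiff_smul (I := I) (I' := J))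

/-- A smooth function on `G⁴` as a morphism of manifolds. -/
noncomputable abbrev cochainHom (π : G × G × G × G → H)
    (hπ : ContMDiff (I.prod (I.prod (I.prod I))) J ∞ π) :
    of I G ⊗ (of I G ⊗ (of I G ⊗ of I G)) ⟶ of J H :=
  mk' (X := prod (of I G) (prod (of I G) (prod (of I G) (of I G)))) π hπ

/-- Morphisms of manifolds are equal once their values agree, and the operations on `X`-points are
computed value by value. -/
theorem isActionByAut_smulHom : Brane.IsActionByAut (smulHom (G := G) (H := H) I J) where
  add_comm h h' := hom_ext fun x => add_comm (fn h x : H) (fn h' x)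
  one_smul h := hom_ext fun x => one_smul G (fn h x : H)
  mul_smul g g' h := hom_ext fun x => mul_smul (fn g x : G) (fn g' x : G) (fn h x : H)
  smul_add g h h' := hom_ext fun x => smul_add (fn g x : G) (fn h x : H) (fn h' x : H)

variable (π : G × G × G × G → H) (hπ : ContMDiff (I.prod (I.prod (I.prod I))) J ∞ π)

/-- Elements of a Lie group are maps from the one-point manifold, so testing on constant points
recovers the equation for functions. Conversely, the latter can be applied at each point of `X`. -/
theorem isCocycle_cochainHom_iff :
    Brane.IsCocycle (smulHom I J) (cochainHom I J π hπ) ↔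
      Cochain.IsCocycle (fun (g : G) (h : H) => g • h) (Cochain.ofProd π) := by
  rw [Cochain.isCocycle_ofProd_iff]
  constructor
  · intro hc f g h k p
    let c (g : G) : point.{u} ⟶ of I G := mk' (fun _ => g) contMDiff_const
    exact congrArg (fun φ => fn φ PUnit.unit) (hc point (c f) (c g) (c h) (c k) (c p))
  · intro hc X f g h k p
    exact hom_ext fun x => hc (fn f x) (fn g x) (fn h x) (fn k x) (fn p x)

omit [DistribMulAction G H] [ContMDiffSMul I J ∞ G H] in
theorem isNormalized_cochainHom (hn : Cochain.IsNormalized (Cochain.ofProd π)) :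
    Brane.IsNormalized (cochainHom I J π hπ) := by
  rw [Cochain.isNormalized_ofProd_iff] at hn
  intro X f g h k hg
  have h1 {g : X ⟶ of I G} (hg : g = Brane.one (of I G) X) (x) : (fn g x : G) = 1 := by
    rw [hg]; rfl
  exact hom_ext fun x => hn (fn f x) (fn g x) (fn h x) (fn k x)
    (hg.imp (h1 · x) (.imp (h1 · x) (.imp (h1 · x) (h1 · x))))

end SmoothMan

end Lie

/-! ### Passage from points to functions: supergroups -/

namespace SuperMan

variable {G H : SuperMan.{u}} [GrpObj G] [AddGrpObj H] [IsCommAddMonObj H] {act : G ⊗ H ⟶ H}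
  {π : G ⊗ (G ⊗ (G ⊗ G)) ⟶ H}

theorem IsActionByAut.points (ha : IsActionByAut act) : Brane.IsActionByAut act where
  add_comm h h' := hom_ext fun A x => add_comm (comp h A x) (comp h' A x)
  one_smul h := hom_ext fun A x => (ha A).one (comp h A x)
  mul_smul g g' h := hom_ext fun A x => (ha A).mul (comp g A x) (comp g' A x) (comp h A x)
  smul_add g h h' := hom_ext fun A x => (ha A).add (comp g A x) (comp h A x) (comp h' A x)

/-- An `A`-point of a supermanifold need not come from a map out of the one-point supermanifold, so
constant points do not suffice. They are replaced by the universal quintuple, the five projections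
of `G⁵`, whose component at `A` is evaluated at `(f, g, h, k, p)`. -/
theorem isCocycle_points_iff : Brane.IsCocycle act π ↔ IsCocycle act π := by
  refine Iff.trans ?_ (forall_congr' fun A => Cochain.isCocycle_ofProd_iff.symm)
  constructor
  · intro hc A f g h k p
    let X := prod G (prod G (prod G (prod G G)))
    have := hc X (prodFst _ _) (prodSnd _ _ ≫ prodFst _ _)
      (prodSnd _ _ ≫ prodSnd _ _ ≫ prodFst _ _)
      (prodSnd _ _ ≫ prodSnd _ _ ≫ prodSnd _ _ ≫ prodFst _ _)
      (prodSnd _ _ ≫ prodSnd _ _ ≫ prodSnd _ _ ≫ prodSnd _ _)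
    exact congrArg (fun φ => comp (M := X) φ A (f, g, h, k, p)) this
  · intro hc X f g h k p
    exact hom_ext fun A x => hc A (comp f A x) (comp g A x) (comp h A x) (comp k A x) (comp p A x)

theorem IsNormalized.points (hn : IsNormalized π) : Brane.IsNormalized π := by
  intro X f g h k hg
  have h1 {g : X ⟶ G} (hg : g = Brane.one G X) (A x) : comp g A x = 1 := by
    rw [hg]; rfl
  exact hom_ext fun A x => Cochain.isNormalized_ofProd_iff.1 (hn A) (comp f A x) (comp g A x)
    (comp h A x) (comp k A x)
    (hg.imp (h1 · A x) (.imp (h1 · A x) (.imp (h1 · A x) (h1 · A x))))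

end SuperMan

theorem mainTheorem10 :
    (∀ {E F M N G H : Type u}
      [NormedAddCommGroup E] [NormedSpace ℝ E] [FiniteDimensional ℝ E]
      [NormedAddCommGroup F] [NormedSpace ℝ F] [FiniteDimensional ℝ F]
      [TopologicalSpace M] [TopologicalSpace N]
      (I : ModelWithCorners ℝ E M) [I.Boundaryless] (J : ModelWithCorners ℝ F N) [J.Boundaryless]
      [TopologicalSpace G] [ChartedSpace M G] [T2Space G] [SecondCountableTopology G]
      [Group G] [LieGroup I ∞ G]
      [TopologicalSpace H] [ChartedSpace N H] [T2Space H] [SecondCountableTopology H]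
      [AddCommGroup H] [LieAddGroup J ∞ H]
      [DistribMulAction G H] [ContMDiffSMul I J ∞ G H]
      (π : G × G × G × G → H) (hπ : ContMDiff (I.prod (I.prod (I.prod I))) J ∞ π),
      ((lieBrane I J π hπ).PentagonatorIdentity ↔
        Cochain.IsCocycle (fun (g : G) (h : H) => g • h) (Cochain.ofProd π)) ∧
      (Cochain.IsNormalized (Cochain.ofProd π) →
        Cochain.IsCocycle (fun (g : G) (h : H) => g • h) (Cochain.ofProd π) →
        (lieBrane I J π hπ).IsThreeGroup)) ∧
    (∀ {G H : SuperMan.{u}} [GrpObj G] [AddGrpObj H] [IsCommAddMonObj H]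
      (act : G ⊗ H ⟶ H) (_ : SuperMan.IsActionByAut act)
      (π : G ⊗ (G ⊗ (G ⊗ G)) ⟶ H),
      ((brane act π).PentagonatorIdentity ↔ SuperMan.IsCocycle act π) ∧
      (SuperMan.IsNormalized π → SuperMan.IsCocycle act π → (brane act π).IsThreeGroup)) := by

  refine ⟨?_, ?_⟩
  · intro E F M N G H _ _ _ _ _ _ _ _ I _ J _ _ _ _ _ _ _ _ _ _ _ _ _ _ _ π hπ
    have ha := SmoothMan.isActionByAut_smulHom (G := G) (H := H) I J
    have hc := SmoothMan.isCocycle_cochainHom_iff I J π hπ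
    -- `lieBrane` unfolds to `brane` of `smulHom` and `cochainHom`, so the general results apply
    -- directly.
    exact ⟨(Brane.pentagonatorIdentity_brane_iff ha).trans hc, fun hn h =>
      Brane.isThreeGroup_brane ha (hc.2 h) (SmoothMan.isNormalized_cochainHom I J π hπ hn)⟩
  · intro G H _ _ _ act ha π
    exact ⟨(Brane.pentagonatorIdentity_brane_iff ha.points).trans SuperMan.isCocycle_points_iff,
      fun hn h => Brane.isThreeGroup_brane ha.points (SuperMan.isCocycle_points_iff.2 h) hn.points⟩
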